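/- Fix integers $2\le k<n$. Let $\binom{[n]}{k}$ be the set of $k$-subsets of $[n]=\{1,\dots,n\}$, and let $\{e^I\}$ be the standard basis of $\mathbb R^{\binom{[n]}{k}}$. Indices in $[n]$ are read modulo $n$; a subset is cyclic if it is of the form $\{a,a+1,\dots,a+m-1\}$ modulo $n$. *Tropical spaces.* Let $L_{k,n}=\mathrm{span}\bigl(\sum_{I\ni i}e^I : i\in[n]\bigr)$. Let $\mathrm{Trop}_{>0}\mathrm{Gr}(k,n)\subset\mathbb R^{\binom{[n]}{k}}$ be the closure of the set of vectors $(\mathrm{val}\,p_I(A))_I$, where $A$ runs over the $k\times n$ matrices of Puiseux series over $\mathbb C$ all of whose maximal minors $p_I(A)$ have real positive leading coefficient. Let $\mathrm{Trop}_{>0}X(k,n)$ be its image in $\mathbb R^{\binom{[n]}{k}}/L_{k,n}$, and let $\mathrm{Trop}_{>0}X(k,n)(\mathbb Z)$ be the set of those points of it that have a representative in $\mathbb Z^{\binom{[n]}{k}}$. Let $\mathbb T^{k,n}=\bigl(\mathbb R^{n-k}/\mathbb R(1,\dots,1)\bigr)^{k-1}$, and let $e_{i,s}$ be the image of the $s$-th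 basis vector of the $i$-th factor. *Vectors.* For $J=\{j_1<\dots<j_k\}$ put $$\mathfrak h_J=\frac1n\sum_I d(e_J,e_I)\,e^I\in\mathbb R^{\binom{[n]}{k}},\qquad \mathfrak t_J=\sum_{i=1}^{k-1}\ \sum_{s=j_i-(i-1)}^{j_{i+1}-(i+1)}e_{i,s}\in\mathbb T^{k,n},$$ where $e_I=\sum_{i\in I}e_i\in\mathbb R^n$, and $d(e_J,e_I)$ is the minimal number of steps in directions $e_i-e_{i+1}$ (indices mod $n$) needed to travel from $e_J$ to $e_I$ through the points $e_K$, $K\in\binom{[n]}{k}$. *Noncrossing tableaux.* Two subsets $I,J$ of $[n]$ are weakly separated if $e_I-e_J$ has at most two sign changes when read cyclically. Two $k$-subsets $I=\{i_1<\dots<i_k\}$ and $J=\{j_1<\dots<j_k\}$ are noncrossing if for all $1\le a<b\le k$ the sets $\{i_a,\dots,i_b\}$ and $\{j_a,\dots,j_b\}$ are weakly separated or $\{i_{a+1},\dots,i_{b-1}\}\ne\{j_{a+1},\dots,j_{b-1}\}$. A noncrossing tableau is a finite multiset $\mathcal J$ of pairwise noncrossing, non-cyclic $k$-subsets; put $\mathfrak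 t_{\mathcal J}=\sum_{J\in\mathcal J}\mathfrak t_J$. *Parametrization.* Let $M(\mathbf x)$ be the $k\times n$ matrix, in variables $x_{\ell,t}$ with $1\le\ell\le k-1$ and $1\le t\le n-k$, whose first $k$ columns form the identity matrix and whose entry in row $i$ and column $k+j$ is $(-1)^{k-i}\sum_{1\le b_i\le\dots\le b_{k-1}\le j}x_{i,b_i}\cdots x_{k-1,b_{k-1}}$ (equal to $1$ for $i=k$). Its maximal minors $p_I(\mathbf x)$ are nonzero polynomials with nonnegative coefficients; let $p_I^t(\mathbf y)$ be the minimum, over the monomials of $p_I$, of $\sum_{\ell,t}m_{\ell,t}\,y_{\ell,t}$, where $m_{\ell,t}$ is the exponent of $x_{\ell,t}$. **Theorem.** 1. The $\mathfrak h_J$ form a basis of $\mathbb R^{\binom{[n]}{k}}$, and the linear map $\Psi:\mathbb R^{\binom{[n]}{k}}\to\mathbb T^{k,n}$ with $\Psi(\mathfrak h_J)=\mathfrak t_J$ for all $J$ descends to a linear map $\Psi$ on $\mathbb R^{\binom{[n]}{k}}/L_{k,n}$. 2. The map $\mathbf y\mapsto(p_I^t(\mathbf y))_I$ descends to a map $\rho:\mathbb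 T^{k,n}\to\mathbb R^{\binom{[n]}{k}}/L_{k,n}$ with image in $\mathrm{Trop}_{>0}X(k,n)$, and $\Psi$ restricts to a bijection $\mathrm{Trop}_{>0}X(k,n)\to\mathbb T^{k,n}$ with inverse $\rho$. 3. There is a bijection from $\mathrm{Trop}_{>0}X(k,n)(\mathbb Z)$ to the set of noncrossing tableaux that sends a point $\pi$ to the tableau $\mathcal J$ exactly when $\Psi(\pi)=\mathfrak t_{\mathcal J}$. -/

import Mathlib

noncomputable section

/-! ### Subsets of `[n]`. The element `j` of `[n] = {1, …, n}` is `j - 1 : Fin n`. -/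

/-- The set of `k`-element subsets of `[n]`. -/
abbrev KSubset (k n : ℕ) : Type := {J : Finset (Fin n) // J.card = k}

/-- The elements `j_1 < ⋯ < j_k` of `J`, in increasing order, indexed from `0`. -/
def KSubset.elt {k n : ℕ} (J : KSubset k n) : Fin k ↪o Fin n :=
  J.1.orderEmbOfFin J.2

/-- The set `{a, a + 1, …, a + m - 1}` modulo `n`, for some `a` and `m`. -/
def IsCyclicInterval {n : ℕ} (J : Finset (Fin n)) : Prop :=
  ∃ a m : ℕ, ∀ x : Fin n, x ∈ J ↔ ∃ r < m, (x : ℕ) = (a + r) % n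

/-- The cyclic successor `i + 1` modulo `n`. -/
def cycSucc {n : ℕ} (i : Fin n) : Fin n :=
  ⟨((i : ℕ) + 1) % n, Nat.mod_lt _ (Nat.lt_of_le_of_lt (Nat.zero_le _) i.isLt)⟩

/-- The indicator vector `e_J`. -/
def indVec {n : ℕ} (J : Finset (Fin n)) : Fin n → ℤ :=
  fun x => if x ∈ J then 1 else 0

/-! ### Lineality space, positive tropical Grassmannian and configuration space -/

/-- The lineality space, spanned by the vectors `∑_{I ∋ i} e^I`. -/
def lineality (k n : ℕ) : Submodule ℝ (KSubset k n → ℝ) :=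
  Submodule.span ℝ (Set.range fun (i : Fin n) (I : KSubset k n) => if i ∈ I.1 then (1 : ℝ) else 0)

/-- The ring of Puiseux series over `ℂ`: series in which the exponents have a common
denominator. -/
def puiseux : Subring (HahnSeries ℚ ℂ) where
  carrier := {f | ∃ N : ℕ, 0 < N ∧ ∀ q ∈ f.support, ∃ m : ℤ, (N : ℚ) * q = m}
  mul_mem' := by
    rintro f g ⟨M, hM, hf⟩ ⟨N, hN, hg⟩
    refine ⟨M * N, Nat.mul_pos hM hN, fun q hq => ?_⟩
    obtain ⟨a, ha, b, hb, rfl⟩ := Set.mem_add.1 (HahnSeries.support_mul_subset hq)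
    obtain ⟨x, hx⟩ := hf a ha
    obtain ⟨y, hy⟩ := hg b hb
    refine ⟨N * x + M * y, ?_⟩
    push_cast
    rw [← hx, ← hy]
    ring
  one_mem' := by
    refine ⟨1, Nat.one_pos, fun q hq => ⟨0, ?_⟩⟩
    have : q = 0 := by
      by_contra h
      exact hq (by simp [HahnSeries.coeff_one, h])
    simp [this]
  add_mem' := by
    rintro f g ⟨M, hM, hf⟩ ⟨N, hN, hg⟩
    refine ⟨M * N, Nat.mul_pos hM hN, fun q hq => ?_⟩
    rcases HahnSeries.support_add_subset _ _ hq with h | h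
    · obtain ⟨x, hx⟩ := hf q h
      refine ⟨N * x, ?_⟩
      push_cast
      rw [← hx]
      ring
    · obtain ⟨y, hy⟩ := hg q h
      refine ⟨M * y, ?_⟩
      push_cast
      rw [← hy]
      ring
  zero_mem' := ⟨1, Nat.one_pos, fun q hq => absurd rfl hq⟩
  neg_mem' := by
    rintro f ⟨M, hM, hf⟩
    exact ⟨M, hM, fun q hq => hf q (by simpa using hq)⟩

/-- Puiseux series whose leading (lowest order) coefficient is real and positive.
The leading coefficient of `0` is `0`. -/
def PuiseuxPos (f : puiseux) : Prop :=
  0 < (f : HahnSeries ℚ ℂ).leadingCoeff.re ∧ (f : HahnSeries ℚ ℂ).leadingCoeff.im = 0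

/-- The Plücker coordinate `p_J` of the row space of a `k × n` matrix: the maximal minor in the
columns `j_1 < ⋯ < j_k`. -/
def plucker {R : Type*} [CommRing R] {k n : ℕ} (A : Matrix (Fin k) (Fin n) R)
    (J : KSubset k n) : R :=
  (A.submatrix id J.elt).det

/-- The positive tropical Grassmannian: the closure of the set of tropical Plücker vectors
`(val p_J(A))_J`, where `A` runs over the `k × n` matrices of Puiseux series with all Plücker
coordinates positive. -/
def tropPosGr (k n : ℕ) : Set (KSubset k n → ℝ) :=
  closure {π | ∃ A : Matrix (Fin k) (Fin n) puiseux, (∀ J, PuiseuxPos (plucker A J)) ∧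
    ∀ J, π J = (((plucker A J : puiseux) : HahnSeries ℚ ℂ).order : ℝ)}

/-- The positive tropical configuration space. -/
def tropPosX (k n : ℕ) : Set ((KSubset k n → ℝ) ⧸ lineality k n) :=
  (lineality k n).mkQ '' tropPosGr k n

/-- The integral points of the positive tropical configuration space: those with an integral
representative. -/
def tropPosXInt (k n : ℕ) : Set ((KSubset k n → ℝ) ⧸ lineality k n) :=
  (lineality k n).mkQ '' {π ∈ tropPosGr k n | ∀ J, ∃ m : ℤ, π J = m}

/-! ### The planar basis -/

/-- One step from the vertex `e_I` of the hypersimplex to the vertex `e_K`, in a direction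
`e_i - e_{i+1}` (indices modulo `n`). -/
def PlanarStep {k n : ℕ} (I K : KSubset k n) : Prop :=
  ∃ i : Fin n, indVec K.1 = indVec I.1 + Pi.single i 1 - Pi.single (cycSucc i) 1

/-- The directed distance `d(e_I, e_J)`: the minimal number of steps from `e_I` to `e_J`. -/
def directedDist {k n : ℕ} (I J : KSubset k n) : ℕ :=
  sInf {m | ∃ w : ℕ → KSubset k n, w 0 = I ∧ w m = J ∧ ∀ s < m, PlanarStep (w s) (w (s + 1))}

/-- The planar basis element `𝔥_J = (1/n) ∑_I d(e_J, e_I) e^I`. -/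
def planarBasis {k n : ℕ} (J : KSubset k n) : KSubset k n → ℝ :=
  fun I => (1 / (n : ℝ)) * (directedDist J I : ℝ)

/-! ### The space `𝕋^{k,n}` and the vectors `𝔱_J` -/

/-- The space `ℝ^N / ℝ(1, …, 1)`. -/
abbrev TropTorus (N : ℕ) : Type :=
  (Fin N → ℝ) ⧸ Submodule.span ℝ {fun _ : Fin N => (1 : ℝ)}

/-- The space `𝕋^{k,n} = (ℝ^{n-k} / ℝ(1, …, 1))^{k-1}`. -/
abbrev TropSpace (k n : ℕ) : Type := Fin (k - 1) → TropTorus (n - k)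

/-- The projection `(ℝ^{n-k})^{k-1} → 𝕋^{k,n}`. -/
def toTropSpace {k n : ℕ} (y : Fin (k - 1) → Fin (n - k) → ℝ) : TropSpace k n :=
  fun l => Submodule.Quotient.mk (y l)

/-- The vector `𝔱_J = ∑_{i=1}^{k-1} ∑_{s = j_i - (i-1)}^{j_{i+1} - (i+1)} e_{i,s}`.
The variables `i`, `s` and the values of `J.elt` below are the mathematical ones minus one. -/
def tVec {k n : ℕ} (J : KSubset k n) : TropSpace k n :=
  toTropSpace fun i s =>
    if ((J.elt ⟨i, by omega⟩ : ℕ) : ℤ) + 1 - i ≤ s + 1 ∧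
      ((s : ℕ) : ℤ) + 1 ≤ ((J.elt ⟨i + 1, by omega⟩ : ℕ) : ℤ) + 1 - (i + 2) then 1 else 0

/-! ### Noncrossing tableaux -/

/-- Weak separation: `e_I - e_J` has at most two sign changes when read cyclically. The number
of cyclic sign changes is even, so that this fails exactly if there are four, that is, if there
are positions `a < b < c < d` at which `e_I - e_J` has alternating (nonzero) signs. -/
def WeaklySeparated {n : ℕ} (I J : Finset (Fin n)) : Prop :=
  ¬ ∃ a b c d : Fin n, a < b ∧ b < c ∧ c < d ∧
    ((a ∈ I \ J ∧ b ∈ J \ I ∧ c ∈ I \ J ∧ d ∈ J \ I) ∨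
      (a ∈ J \ I ∧ b ∈ I \ J ∧ c ∈ J \ I ∧ d ∈ I \ J))

/-- For all `a < b`, the subpair `({i_a, …, i_b}, {j_a, …, j_b})` is weakly separated, or the
interiors `{i_{a+1}, …, i_{b-1}}` and `{j_{a+1}, …, j_{b-1}}` differ. -/
def Noncrossing {k n : ℕ} (I J : KSubset k n) : Prop :=
  ∀ a b : Fin k, a < b →
    WeaklySeparated ((Finset.Icc a b).map I.elt.toEmbedding)
        ((Finset.Icc a b).map J.elt.toEmbedding) ∨
      (Finset.Ioo a b).map I.elt.toEmbedding ≠ (Finset.Ioo a b).map J.elt.toEmbedding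

/-- Noncrossing tableaux: multisets of pairwise noncrossing, non-cyclic `k`-subsets. -/
def NoncrossingTableau (k n : ℕ) : Type :=
  {𝒥 : Multiset (KSubset k n) // (∀ J ∈ 𝒥, ¬ IsCyclicInterval J.1) ∧
    ∀ I ∈ 𝒥, ∀ J ∈ 𝒥, Noncrossing I J}

/-- The point `𝔱_𝒥 = ∑_{J ∈ 𝒥} 𝔱_J`. -/
def NoncrossingTableau.point {k n : ℕ} (𝒥 : NoncrossingTableau k n) : TropSpace k n :=
  (𝒥.1.map tVec).sum

/-! ### The tropical positive parametrization -/

open Classical in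
/-- The positive parametrization matrix. Its first `k` columns form the identity matrix, and its
entry in row `i` and column `k + j` is
`(-1)^{k-i} ∑_{b_i ≤ ⋯ ≤ b_{k-1} ≤ j} x_{i,b_i} ⋯ x_{k-1,b_{k-1}}` (which is `1` for `i = k`). -/
def paramMatrix (k n : ℕ) :
    Matrix (Fin k) (Fin n) (MvPolynomial (Fin (k - 1) × Fin (n - k)) ℤ) :=
  fun i c =>
    if (c : ℕ) < k then
      if (c : ℕ) = i then 1 else 0
    else
      (-1) ^ (k - 1 - (i : ℕ)) *
        ∑ b : {l : Fin (k - 1) // (i : ℕ) ≤ l} → Fin (n - k),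
          if Monotone b ∧ ∀ l, k + (b l : ℕ) ≤ c then
            ∏ l, MvPolynomial.X (l.1, b l) else 0

/-- Tropicalization of a polynomial with nonnegative coefficients (that is, addition becomes
minimum and multiplication becomes addition): the minimum over its monomials. -/
def tropEval {σ : Type*} [Fintype σ] (f : MvPolynomial σ ℤ) (y : σ → ℝ) : ℝ :=
  ⨅ m : f.support, ∑ v, (m.1 v : ℝ) * y v

/-- The tropicalized Plücker coordinates of the parametrization matrix. These Plücker
coordinates are nonzero polynomials with nonnegative coefficients. -/
def tropParam {k n : ℕ} (y : Fin (k - 1) → Fin (n - k) → ℝ) : KSubset k n → ℝ :=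
  fun J => tropEval (plucker (paramMatrix k n) J) fun v => y v.1 v.2

/-- The tropical positive parametrization `ρ`, computed on a representative. -/
def rho {k n : ℕ} (t : TropSpace k n) : (KSubset k n → ℝ) ⧸ lineality k n :=
  Submodule.Quotient.mk (tropParam fun l => Quotient.out (t l))

end

/-!
# The positive tropical configuration space, `𝕋^{k,n}` and noncrossing tableaux

Elements of `[n]` are numbered from `0`.

*The planar basis and `Ψ`.* A path from `e_J` to `e_I` in the directions `e_i - e_{i+1}` uses each
direction a number of times that is determined up to a common constant by the counting functions
`x ↦ #{j ∈ J | j < x}` of `J` and `I`, and the shortest path uses some direction not at all. So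
`d(e_J, e_I) = ∑_j (m + #{i ∈ I | i ≤ j} - #{j' ∈ J | j' ≤ j})`, where `m` is the least constant
that makes all summands nonnegative (`directedDist_eq`). Modulo the lineality space, which contains
the counting functions and the constants, `𝔥_J` is therefore the function sending `I` to `m`. Summing
`d(e_K, e_I)` with alternating signs over the `I` that arise from `J` by moving some of the ends of
its cyclic intervals forward by one gives a nonnegative number depending on `J` only, minus `n` if
`K = J` (`alternating_sum_directedDist`). So the coefficients of a linear relation among the `𝔥_J`
are nonnegative multiples of their sum. As the `𝔥_J` have nonnegative entries, this forces the
coefficients to vanish (`linearIndependent_planarBasis`). On the subset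
`{0, …, i - 1} ∪ {a, a + 1, …}` the number `m` is the excess over `i`, if any, of the number of
elements of `J` below `a` (`planarBasis_twoIntervals`). Hence the mixed second differences of `π` at
these subsets (`psiRepr`) take `𝔥_J` to `𝔱_J` and the lineality space to `0`, so that they define
`Ψ` (`psi`, `exists_planarBasis_basis`).

*Minors of the parametrization matrix.* Its bottom row consists of ones from column `k - 1` on.
Subtracting consecutive columns leaves differences which are `x_{k-1,t}` times the columns of the
parametrization matrix with one row less, and this expands each minor as a sum of products of
variables and minors with one row less, without signs (`colMinor_succ`, `webMinor_succ`). So all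
minors are subtraction-free (`webMinor_induction`) and homogeneous in each row of variables
(`homogeneous_plucker`), which makes `ρ` well defined (`rho_toTropSpace`). The minors in the columns
`0, …, i - 1, a, a + 1, …` are monomials (`webMinor_twoSeq`), and the mixed second differences of
their exponents are single variables, so that `Ψ ∘ ρ = id` (`psiRepr_tropParam`, `psi_rho`).

*Tropicalization.* There is no cancellation among series with positive leading coefficients, so that
the valuation of a subtraction-free polynomial is its tropicalization (`HahnPos.eval₂`). Substituting
powers of the variable, and using that rational points are dense, shows that `ρ` takes values in
`Trop_{>0} X(k,n)`. Conversely, let all maximal minors of a matrix be positive. Row operations and a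
rescaling of the columns, which change the vector of valuations only by an element of the lineality
space, bring it to the shape of the parametrization matrix, and reading the expansion of minors
backwards recovers positive parameters one row after the other (`exists_web_eq`). So `ρ ∘ Ψ = id` at
the valuations of positive matrices, and then on their closure because this is a closed condition
(`rho_psi_of_mem`).

*Noncrossing tableaux.* By the previous step, and since `Ψ` and `ρ` preserve integrality, the last
claim says that every integral point of `𝕋^{k,n}` is `𝔱_𝒥` for exactly one tableau `𝒥`. Up to
cyclic intervals, which cross no other subset, the point `𝔱_𝒥` and the multisets of the `s`-th
elements of the members of `𝒥`, for `s = 1, …, k`, determine each other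
(`NoncrossingTableau.point_injective`, `NoncrossingTableau.exists_point_eq`). A multiset of
sequences `j_1 < ⋯ < j_k` has a unique noncrossing rearrangement with the same multisets of entries
at each position: extending the sequences by one entry at a time, the new entries are distributed
over the sequences found so far, each time giving the lexicographically largest sequence (comparing
last entries first) the smallest new entry that exceeds its last one (`exists_listNoncrossing`,
`listNoncrossing_unique`).
-/

/-! ### Noncrossing matchings of multisets -/

/-- A multiset of pairs `(p, v)` is noncrossing with respect to `h` if no two of its members
`(p, v)`, `(p', v')` with `p < p'` satisfy `h p' < v < v'`. -/
def NoncrossingPairs {α : Type*} [LinearOrder α] (h : α → ℕ) (R : Multiset (α × ℕ)) : Prop :=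
  ∀ p ∈ R, ∀ q ∈ R, p.1 < q.1 → ¬ (h q.1 < p.2 ∧ p.2 < q.2)

section Matching

variable {α : Type*} [LinearOrder α] {h : α → ℕ}

theorem NoncrossingPairs.mono {R S : Multiset (α × ℕ)} (hS : NoncrossingPairs h S) (hRS : R ≤ S) :
    NoncrossingPairs h R :=
  fun p hp q hq => hS p (Multiset.mem_of_le hRS hp) q (Multiset.mem_of_le hRS hq)

/-- In a noncrossing matching the largest `p` is matched with the smallest `v > h p`. -/
theorem NoncrossingPairs.mem_of_max {R : Multiset (α × ℕ)} (hR : NoncrossingPairs h R)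
    (hv : ∀ p ∈ R, h p.1 < p.2) {p : α} {v : ℕ} (hp : p ∈ R.map Prod.fst)
    (hpmax : ∀ q ∈ R.map Prod.fst, q ≤ p) (hvR : v ∈ R.map Prod.snd) (hpv : h p < v)
    (hvmin : ∀ w ∈ R.map Prod.snd, h p < w → v ≤ w) : (p, v) ∈ R := by
  obtain ⟨⟨p₀, w⟩, hw, rfl⟩ := Multiset.mem_map.1 hp
  obtain ⟨⟨q, v₀⟩, hq, rfl⟩ := Multiset.mem_map.1 hvR
  dsimp only at *
  rcases (hpmax q (Multiset.mem_map_of_mem Prod.fst hq)).eq_or_lt with h1 | h1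
  · rwa [← h1]
  · have h2 := hR _ hq _ hw h1
    have h3 := hvmin w (Multiset.mem_map_of_mem Prod.snd hw) (hv _ hw)
    have : v₀ = w := by
      by_contra h4
      exact h2 ⟨hpv, lt_of_le_of_ne h3 h4⟩
    rwa [this]

theorem exists_max_fst {R : Multiset (α × ℕ)} (hR : R ≠ 0) :
    ∃ p ∈ R, ∀ q ∈ R.map Prod.fst, q ≤ p.1 := by
  obtain ⟨x, hx⟩ := Multiset.exists_mem_of_ne_zero hR
  obtain ⟨p, hp, hmax⟩ := Finset.exists_max_image R.toFinset Prod.fst ⟨x, by simpa using hx⟩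
  refine ⟨p, by simpa using hp, fun q hq => ?_⟩
  obtain ⟨r, hr, rfl⟩ := Multiset.mem_map.1 hq
  exact hmax r (by simpa using hr)

theorem exists_min_snd {R : Multiset (α × ℕ)} {p : α × ℕ} (hp : p ∈ R) (hv : h p.1 < p.2) :
    ∃ q ∈ R, h p.1 < q.2 ∧ ∀ w ∈ R.map Prod.snd, h p.1 < w → q.2 ≤ w := by
  obtain ⟨q, hq, hmin⟩ := Finset.exists_min_image (R.toFinset.filter fun q => h p.1 < q.2) Prod.snd
    ⟨p, by simpa using ⟨hp, hv⟩⟩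
  simp only [Finset.mem_filter, Multiset.mem_toFinset] at hq hmin
  refine ⟨q, hq.1, hq.2, fun w hw hpw => ?_⟩
  obtain ⟨r, hr, rfl⟩ := Multiset.mem_map.1 hw
  exact hmin r ⟨hr, hpw⟩

theorem NoncrossingPairs.unique {R S : Multiset (α × ℕ)} (hR : NoncrossingPairs h R)
    (hS : NoncrossingPairs h S) (hRv : ∀ p ∈ R, h p.1 < p.2) (hSv : ∀ p ∈ S, h p.1 < p.2)
    (hfst : R.map Prod.fst = S.map Prod.fst) (hsnd : R.map Prod.snd = S.map Prod.snd) :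
    R = S := by
  induction hn : R.card generalizing R S with
  | zero =>
    have hS0 : S.card = 0 := by
      rw [← Multiset.card_map Prod.fst S, ← hfst, Multiset.card_map, hn]
    rw [Multiset.card_eq_zero.1 hn, Multiset.card_eq_zero.1 hS0]
  | succ n ih =>
    have hR0 : R ≠ 0 := by
      rintro rfl
      simp at hn
    obtain ⟨p, hp, hpmax⟩ := exists_max_fst hR0
    obtain ⟨q, hq, hpq, hqmin⟩ := exists_min_snd hp (hRv p hp)
    have hpR := Multiset.mem_map_of_mem Prod.fst hp
    have hqR := Multiset.mem_map_of_mem Prod.snd hq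
    have h1 : (p.1, q.2) ∈ R := hR.mem_of_max hRv hpR hpmax hqR hpq hqmin
    have h2 : (p.1, q.2) ∈ S := hS.mem_of_max hSv (hfst ▸ hpR) (hfst ▸ hpmax) (hsnd ▸ hqR) hpq
      (hsnd ▸ hqmin)
    obtain ⟨R', rfl⟩ := Multiset.exists_cons_of_mem h1
    obtain ⟨S', rfl⟩ := Multiset.exists_cons_of_mem h2
    rw [ih (hR.mono (Multiset.le_cons_self _ _)) (hS.mono (Multiset.le_cons_self _ _))
      (fun p hp => hRv p (Multiset.mem_cons_of_mem hp))
      (fun p hp => hSv p (Multiset.mem_cons_of_mem hp)) (by simpa using hfst) (by simpa using hsnd)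
      (by simpa using hn)]

theorem exists_noncrossingPairs (hh : Monotone h) (R : Multiset (α × ℕ))
    (hRv : ∀ p ∈ R, h p.1 < p.2) :
    ∃ S : Multiset (α × ℕ), NoncrossingPairs h S ∧ (∀ p ∈ S, h p.1 < p.2) ∧
      S.map Prod.fst = R.map Prod.fst ∧ S.map Prod.snd = R.map Prod.snd := by
  induction hn : R.card generalizing R with
  | zero =>
    rw [Multiset.card_eq_zero] at hn
    subst hn
    exact ⟨0, by simp [NoncrossingPairs]⟩
  | succ n ih =>
    have hR0 : R ≠ 0 := by
      rintro rfl
      simp at hn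
    obtain ⟨p, hp, hpmax⟩ := exists_max_fst hR0
    obtain ⟨q, hq, hpq, hqmin⟩ := exists_min_snd hp (hRv p hp)
    -- exchanging partners, `p` may be assumed to be matched with the smallest `v > h p`
    obtain ⟨R', hR'v, hR'1, hR'2⟩ : ∃ R' : Multiset (α × ℕ), (∀ r ∈ R', h r.1 < r.2) ∧
        R.map Prod.fst = p.1 ::ₘ R'.map Prod.fst ∧ R.map Prod.snd = q.2 ::ₘ R'.map Prod.snd := by
      obtain ⟨R₁, rfl⟩ := Multiset.exists_cons_of_mem hp
      rcases Multiset.mem_cons.1 hq with rfl | hq1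
      · exact ⟨R₁, fun r hr => hRv r (Multiset.mem_cons_of_mem hr), by simp, by simp⟩
      · obtain ⟨R₂, rfl⟩ := Multiset.exists_cons_of_mem hq1
        refine ⟨(q.1, p.2) ::ₘ R₂, fun r hr => ?_, by simp, ?_⟩
        · rcases Multiset.mem_cons.1 hr with rfl | hr
          · exact lt_of_le_of_lt (hh (hpmax q.1 (Multiset.mem_map_of_mem Prod.fst hq)))
              (hRv p hp)
          · exact hRv r (Multiset.mem_cons_of_mem (Multiset.mem_cons_of_mem hr))
        · simp [Multiset.cons_swap]
    obtain ⟨S, hS, hSv, hS1, hS2⟩ := ih R' hR'v (by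
      have := congrArg Multiset.card hR'1
      simp only [Multiset.card_map, Multiset.card_cons] at this
      omega)
    refine ⟨(p.1, q.2) ::ₘ S, ?_, ?_, by simp [hS1, hR'1], by simp [hS2, hR'2]⟩
    · intro x hx y hy hxy
      rcases Multiset.mem_cons.1 hx with rfl | hx
      · have hy1 : y.1 ∈ R.map Prod.fst := by
          rcases Multiset.mem_cons.1 hy with rfl | hy
          · exact absurd hxy (lt_irrefl _)
          · rw [hR'1, ← hS1]
            exact Multiset.mem_cons_of_mem (Multiset.mem_map_of_mem _ hy)
        exact absurd hxy (not_lt.2 (hpmax _ hy1))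
      · rcases Multiset.mem_cons.1 hy with rfl | hy
        · rintro ⟨h1, h2⟩
          refine absurd h2 (not_lt.2 (hqmin _ ?_ h1))
          rw [hR'2, ← hS2]
          exact Multiset.mem_cons_of_mem (Multiset.mem_map_of_mem _ hx)
        · exact hS x hx y hy hxy
    · intro x hx
      rcases Multiset.mem_cons.1 hx with rfl | hx
      · exact hpq
      · exact hSv x hx

/-- A multiset of pairs can be lifted along `h` in the first component. -/
theorem exists_lift_fst {β γ : Type*} (g : β → γ) (S : Multiset (γ × ℕ)) (P : Multiset β)
    (hSP : S.map Prod.fst = P.map g) :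
    ∃ T : Multiset (β × ℕ), T.map Prod.fst = P ∧ T.map (fun t => (g t.1, t.2)) = S := by
  induction S using Multiset.induction_on generalizing P with
  | empty =>
    refine ⟨0, ?_, rfl⟩
    have : P.map g = 0 := by simpa using hSP.symm
    simpa using (Multiset.map_eq_zero.1 this).symm
  | cons x S ih =>
    have hx : x.1 ∈ P.map g := by
      rw [← hSP]
      simp
    obtain ⟨p, hp, hpx⟩ := Multiset.mem_map.1 hx
    obtain ⟨P', rfl⟩ := Multiset.exists_cons_of_mem hp
    obtain ⟨T, hT1, hT2⟩ := ih P' (by simpa [hpx] using hSP)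
    exact ⟨(p, x.2) ::ₘ T, by simp [hT1], by simp [hT2, hpx]⟩

end Matching

/-! ### Noncrossing multisets of decreasing lists -/

/-- The noncrossing relation on decreasing lists, by recursion along the common tails: the last
step compares the heads according to the lexicographic order of the tails. -/
def ListNoncrossing : List ℕ → List ℕ → Prop
  | i :: I, j :: J => ListNoncrossing I J ∧ (I < J → ¬ (J.headD 0 < i ∧ i < j)) ∧
      (J < I → ¬ (I.headD 0 < j ∧ j < i))
  | _, _ => True

/-- Strictly decreasing lists of positive numbers. -/
def ListDecreasing : List ℕ → Prop
  | [] => True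
  | i :: I => I.headD 0 < i ∧ ListDecreasing I

theorem headD_monotone : Monotone fun I : List ℕ => I.headD 0 := by
  intro I J hIJ
  cases I with
  | nil => exact Nat.zero_le _
  | cons i I =>
    cases J with
    | nil => exact absurd hIJ (not_le.2 (List.nil_lt_cons i I))
    | cons j J =>
      rcases hIJ.eq_or_lt with h | h
      · rw [h]
      · exact List.head_le_of_lt h

theorem cons_headD_tail {I : List ℕ} {k : ℕ} (h : I.length = k + 1) :
    I.headD 0 :: I.tail = I := by
  cases I with
  | nil => simp at h
  | cons i I => rfl

theorem getD_tail (I : List ℕ) (p : ℕ) : I.tail.getD p 0 = I.getD (p + 1) 0 := by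
  cases I <;> simp

theorem headD_eq_getD (I : List ℕ) : I.headD 0 = I.getD 0 0 := by
  cases I <;> simp

/-- Splitting off the heads. -/
def splitHead (I : List ℕ) : List ℕ × ℕ := (I.tail, I.headD 0)

theorem map_splitHead_noncrossingPairs {k : ℕ} {R : Multiset (List ℕ)}
    (hlen : ∀ I ∈ R, I.length = k + 1)
    (hR : ∀ I ∈ R, ∀ J ∈ R, ListNoncrossing I J) :
    NoncrossingPairs (fun I : List ℕ => I.headD 0) (R.map splitHead) := by
  intro p hp q hq hpq
  obtain ⟨I, hI, rfl⟩ := Multiset.mem_map.1 hp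
  obtain ⟨J, hJ, rfl⟩ := Multiset.mem_map.1 hq
  have h := hR I hI J hJ
  rw [← cons_headD_tail (hlen I hI), ← cons_headD_tail (hlen J hJ)] at h
  exact h.2.1 hpq

theorem splitHead_decreasing {k : ℕ} {I : List ℕ} (hlen : I.length = k + 1)
    (hI : ListDecreasing I) : (splitHead I).1.headD 0 < (splitHead I).2 := by
  rw [← cons_headD_tail hlen] at hI
  exact hI.1

theorem ListDecreasing.tail {I : List ℕ} (hI : ListDecreasing I) : ListDecreasing I.tail := by
  cases I with
  | nil => exact hI
  | cons i I => exact hI.2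

theorem ListNoncrossing.tail {I J : List ℕ} (h : ListNoncrossing I J) :
    ListNoncrossing I.tail J.tail := by
  cases I with
  | nil => cases J <;> simp [ListNoncrossing]
  | cons i I =>
    cases J with
    | nil => cases I <;> simp [ListNoncrossing]
    | cons j J => exact h.1

/-- A noncrossing multiset of decreasing lists is determined by the multisets of its entries in
each position. -/
theorem listNoncrossing_unique (k : ℕ) {R S : Multiset (List ℕ)} (hcard : R.card = S.card)
    (hRlen : ∀ I ∈ R, I.length = k) (hSlen : ∀ I ∈ S, I.length = k)
    (hRd : ∀ I ∈ R, ListDecreasing I) (hSd : ∀ I ∈ S, ListDecreasing I)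
    (hR : ∀ I ∈ R, ∀ J ∈ R, ListNoncrossing I J) (hS : ∀ I ∈ S, ∀ J ∈ S, ListNoncrossing I J)
    (hRS : ∀ p < k, R.map (fun I => I.getD p 0) = S.map fun I => I.getD p 0) : R = S := by
  induction k generalizing R S with
  | zero =>
    rw [Multiset.eq_replicate_card.2 fun I hI => List.length_eq_zero_iff.1 (hRlen I hI),
      Multiset.eq_replicate_card.2 fun I hI => List.length_eq_zero_iff.1 (hSlen I hI), hcard]
  | succ k ih =>
    have key : R.map List.tail = S.map List.tail := by
      refine ih (by simpa using hcard) ?_ ?_ ?_ ?_ ?_ ?_ fun p hp => ?_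
      · simp only [Multiset.mem_map, forall_exists_index, and_imp, forall_apply_eq_imp_iff₂]
        intro I hI
        simp [hRlen I hI]
      · simp only [Multiset.mem_map, forall_exists_index, and_imp, forall_apply_eq_imp_iff₂]
        intro I hI
        simp [hSlen I hI]
      · simp only [Multiset.mem_map, forall_exists_index, and_imp, forall_apply_eq_imp_iff₂]
        exact fun I hI => (hRd I hI).tail
      · simp only [Multiset.mem_map, forall_exists_index, and_imp, forall_apply_eq_imp_iff₂]
        exact fun I hI => (hSd I hI).tail
      · simp only [Multiset.mem_map, forall_exists_index, and_imp, forall_apply_eq_imp_iff₂]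
        exact fun I hI J hJ => (hR I hI J hJ).tail
      · simp only [Multiset.mem_map, forall_exists_index, and_imp, forall_apply_eq_imp_iff₂]
        exact fun I hI J hJ => (hS I hI J hJ).tail
      · simpa only [Multiset.map_map, Function.comp_def, getD_tail] using hRS (p + 1) (by omega)
    have h := NoncrossingPairs.unique (map_splitHead_noncrossingPairs hRlen hR)
      (map_splitHead_noncrossingPairs hSlen hS)
      (by
        intro p hp
        obtain ⟨I, hI, rfl⟩ := Multiset.mem_map.1 hp
        exact splitHead_decreasing (hRlen I hI) (hRd I hI))
      (by
        intro p hp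
        obtain ⟨I, hI, rfl⟩ := Multiset.mem_map.1 hp
        exact splitHead_decreasing (hSlen I hI) (hSd I hI))
      (by simpa only [Multiset.map_map, Function.comp_def, splitHead] using key)
      (by
        simpa only [Multiset.map_map, Function.comp_def, splitHead, headD_eq_getD]
          using hRS 0 (by omega))
    have h2 := congrArg (Multiset.map fun x : List ℕ × ℕ => x.2 :: x.1) h
    simp only [Multiset.map_map, Function.comp_def, splitHead] at h2
    rwa [Multiset.map_congr rfl fun I hI => cons_headD_tail (hRlen I hI),
      Multiset.map_congr rfl fun I hI => cons_headD_tail (hSlen I hI), Multiset.map_id',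
      Multiset.map_id'] at h2

/-- Every multiset of decreasing lists can be rearranged, position by position, into a noncrossing
one. -/
theorem exists_listNoncrossing (k : ℕ) (R : Multiset (List ℕ))
    (hRlen : ∀ I ∈ R, I.length = k) (hRd : ∀ I ∈ R, ListDecreasing I) :
    ∃ S : Multiset (List ℕ), S.card = R.card ∧ (∀ I ∈ S, I.length = k) ∧
      (∀ I ∈ S, ListDecreasing I) ∧ (∀ I ∈ S, ∀ J ∈ S, ListNoncrossing I J) ∧
      ∀ p < k, S.map (fun I => I.getD p 0) = R.map fun I => I.getD p 0 := by
  induction k generalizing R with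
  | zero =>
    refine ⟨R, rfl, hRlen, hRd, fun I hI J hJ => ?_, by simp⟩
    rw [List.length_eq_zero_iff.1 (hRlen I hI)]
    cases J <;> simp [ListNoncrossing]
  | succ k ih =>
    obtain ⟨T, hTc, hTlen, hTd, hT, hTR⟩ := ih (R.map List.tail)
      (by
        simp only [Multiset.mem_map, forall_exists_index, and_imp, forall_apply_eq_imp_iff₂]
        intro I hI
        simp [hRlen I hI])
      (by
        simp only [Multiset.mem_map, forall_exists_index, and_imp, forall_apply_eq_imp_iff₂]
        exact fun I hI => (hRd I hI).tail)
    have hhead : (R.map fun I => (I.tail.headD 0, I.headD 0)).map Prod.fst =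
        T.map fun I => I.headD 0 := by
      rw [Multiset.map_map]
      rcases Nat.eq_zero_or_pos k with rfl | hk
      · have h1 : ∀ I ∈ T, I.headD 0 = 0 := fun I hI => by
          rw [List.length_eq_zero_iff.1 (hTlen I hI)]
          rfl
        have h2 : ∀ I ∈ R, I.tail.headD 0 = 0 := fun I hI => by
          have h3 : I.tail = [] := List.length_eq_zero_iff.1 (by simp [hRlen I hI])
          rw [h3]
          rfl
        rw [Multiset.map_congr rfl h1]
        simp only [Function.comp_def]
        rw [Multiset.map_congr rfl h2, Multiset.map_const', Multiset.map_const', hTc,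
          Multiset.card_map]
      · have := hTR 0 hk
        simp only [Multiset.map_map, Function.comp_def, ← headD_eq_getD] at this
        simpa only [Function.comp_def] using this.symm
    obtain ⟨Q, hQ1, hQ2⟩ := exists_lift_fst (fun I : List ℕ => I.headD 0) _ T hhead
    have hQv : ∀ p ∈ Q, p.1.headD 0 < p.2 := by
      intro p hp
      have : (p.1.headD 0, p.2) ∈ R.map fun I => (I.tail.headD 0, I.headD 0) := by
        rw [← hQ2]
        exact Multiset.mem_map_of_mem (fun t : List ℕ × ℕ => (t.1.headD 0, t.2)) hp
      obtain ⟨I, hI, hIp⟩ := Multiset.mem_map.1 this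
      have := splitHead_decreasing (hRlen I hI) (hRd I hI)
      simp only [Prod.mk.injEq] at hIp
      rw [← hIp.1, ← hIp.2]
      exact this
    obtain ⟨S, hS, hSv, hS1, hS2⟩ := exists_noncrossingPairs headD_monotone Q hQv
    have hST : ∀ x ∈ S, x.1 ∈ T := fun x hx => by
      rw [← hQ1, ← hS1]
      exact Multiset.mem_map_of_mem _ hx
    have hQR : Q.map Prod.snd = R.map fun I => I.headD 0 := by
      have := congrArg (Multiset.map Prod.snd) hQ2
      simpa only [Multiset.map_map, Function.comp_def] using this
    refine ⟨S.map fun x => x.2 :: x.1, ?_, ?_, ?_, ?_, ?_⟩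
    · rw [Multiset.card_map, ← Multiset.card_map Prod.snd, hS2, hQR, Multiset.card_map]
    · simp only [Multiset.mem_map, forall_exists_index, and_imp, forall_apply_eq_imp_iff₂]
      intro x hx
      simp [hTlen _ (hST x hx)]
    · simp only [Multiset.mem_map, forall_exists_index, and_imp, forall_apply_eq_imp_iff₂]
      exact fun x hx => ⟨hSv x hx, hTd _ (hST x hx)⟩
    · simp only [Multiset.mem_map, forall_exists_index, and_imp, forall_apply_eq_imp_iff₂]
      exact fun x hx y hy =>
        ⟨hT _ (hST x hx) _ (hST y hy), fun h => hS x hx y hy h, fun h => hS y hy x hx h⟩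
    · intro p hp
      rw [Multiset.map_map]
      cases p with
      | zero =>
        simp only [Function.comp_def, ← headD_eq_getD]
        rw [← hQR, ← hS2]
        simp
      | succ p =>
        simp only [Function.comp_def, List.getD_cons_succ]
        have := hTR p (by omega)
        rw [← hQ1, ← hS1] at this
        simpa only [Multiset.map_map, Function.comp_def, getD_tail] using this

/-! ### Subsets as increasing sequences and as decreasing lists -/

/-- The `k`-subset with prescribed increasing sequence of elements. -/
def KSubset.mk' {k n : ℕ} (f : Fin k → ℕ) (hf : StrictMono f) (hn : ∀ s, f s < n) : KSubset k n :=
  ⟨Finset.univ.map ⟨fun s => (⟨f s, hn s⟩ : Fin n), fun s t h =>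
    hf.injective (by simpa using h)⟩, by simp⟩

theorem KSubset.elt_mk' {k n : ℕ} (f : Fin k → ℕ) (hf : StrictMono f) (hn : ∀ s, f s < n)
    (s : Fin k) : ((KSubset.mk' f hf hn).elt s : ℕ) = f s := by
  have h := Finset.orderEmbOfFin_unique (s := (KSubset.mk' f hf hn).1) (KSubset.mk' f hf hn).2
    (f := fun s => (⟨f s, hn s⟩ : Fin n)) (fun s => Finset.mem_map.2 ⟨s, Finset.mem_univ s, rfl⟩)
    (fun s t h => hf h)
  exact (congrArg Fin.val (congrFun h s)).symm

theorem KSubset.mem_iff {k n : ℕ} (J : KSubset k n) (x : Fin n) : x ∈ J.1 ↔ ∃ s, J.elt s = x := by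
  have := Finset.range_orderEmbOfFin J.1 J.2
  rw [← Finset.mem_coe, ← this]
  rfl

theorem KSubset.ext_elt {k n : ℕ} {I J : KSubset k n} (h : ∀ s, (I.elt s : ℕ) = J.elt s) :
    I = J := by
  apply Subtype.ext
  ext x
  rw [I.mem_iff, J.mem_iff]
  simp only [Fin.ext_iff, h]

/-- The elements of `J` as a sequence of positive integers, extended by `0`. -/
def KSubset.entry {k n : ℕ} (J : KSubset k n) (s : ℕ) : ℕ :=
  if h : s < k then (J.elt ⟨s, h⟩ : ℕ) + 1 else 0

theorem KSubset.entry_of_lt {k n : ℕ} (J : KSubset k n) {s : ℕ} (h : s < k) :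
    J.entry s = (J.elt ⟨s, h⟩ : ℕ) + 1 := dif_pos h

theorem KSubset.entry_lt {k n : ℕ} (J : KSubset k n) {s t : ℕ} (hst : s < t) (ht : t < k) :
    J.entry s < J.entry t := by
  rw [J.entry_of_lt ht, J.entry_of_lt (hst.trans ht)]
  have : J.elt ⟨s, hst.trans ht⟩ < J.elt ⟨t, ht⟩ := J.elt.strictMono (by simpa using hst)
  have : (J.elt ⟨s, hst.trans ht⟩ : ℕ) < J.elt ⟨t, ht⟩ := this
  omega

/-- The list `f (b - 1), …, f 0`. -/
def prefixList (f : ℕ → ℕ) : ℕ → List ℕ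
  | 0 => []
  | b + 1 => f b :: prefixList f b

theorem length_prefixList (f : ℕ → ℕ) (b : ℕ) : (prefixList f b).length = b := by
  induction b with
  | zero => rfl
  | succ b ih => simp [prefixList, ih]

theorem headD_prefixList (f : ℕ → ℕ) {b : ℕ} (hb : 0 < b) :
    (prefixList f b).headD 0 = f (b - 1) := by
  cases b with
  | zero => omega
  | succ b => rfl

theorem getD_prefixList (f : ℕ → ℕ) (b p : ℕ) (hp : p < b) :
    (prefixList f b).getD p 0 = f (b - 1 - p) := by
  induction b generalizing p with
  | zero => omega
  | succ b ih =>
    cases p with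
    | zero => rfl
    | succ p =>
      rw [prefixList, List.getD_cons_succ, ih p (by omega)]
      congr 1
      omega

theorem prefixList_lt_iff (f g : ℕ → ℕ) (b : ℕ) : prefixList f b < prefixList g b ↔
    ∃ a < b, f a < g a ∧ ∀ s, a < s → s < b → f s = g s := by
  induction b with
  | zero => simp [prefixList]
  | succ b ih =>
    rw [prefixList, prefixList, List.cons_lt_cons_iff, ih]
    constructor
    · rintro (h | ⟨h, a, hab, hfg, hs⟩)
      · exact ⟨b, by omega, h, fun s h1 h2 => by omega⟩
      · refine ⟨a, by omega, hfg, fun s h1 h2 => ?_⟩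
        rcases Nat.lt_succ_iff_lt_or_eq.1 h2 with h3 | rfl
        · exact hs s h1 h3
        · exact h
    · rintro ⟨a, hab, hfg, hs⟩
      rcases Nat.lt_succ_iff_lt_or_eq.1 hab with h3 | rfl
      · exact Or.inr ⟨hs b h3 (by omega), a, h3, hfg, fun s h1 h2 => hs s h1 (by omega)⟩
      · exact Or.inl hfg

theorem listDecreasing_prefixList {f : ℕ → ℕ} {b : ℕ} (h0 : ∀ s < b, 0 < f s)
    (hf : ∀ s t, s < t → t < b → f s < f t) : ListDecreasing (prefixList f b) := by
  induction b with
  | zero => trivial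
  | succ b ih =>
    refine ⟨?_, ih (fun s hs => h0 s (by omega)) fun s t hst ht => hf s t hst (by omega)⟩
    cases b with
    | zero => exact h0 0 (by omega)
    | succ b => exact hf b (b + 1) (by omega) (by omega)

/-- The noncrossing relation for increasing sequences, spelled out. -/
def SeqNoncrossing (k : ℕ) (f g : ℕ → ℕ) : Prop :=
  ∀ b < k, ∀ a < b, (∀ s, a < s → s < b → f s = g s) →
    ¬ (f a < g a ∧ g a < f b ∧ f b < g b) ∧ ¬ (g a < f a ∧ f a < g b ∧ g b < f b)

theorem lex_crossing_iff {f g : ℕ → ℕ} {b : ℕ} (hf : ∀ s t, s < t → t ≤ b → f s < f t)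
    (hg : ∀ s t, s < t → t ≤ b → g s < g t) :
    (prefixList f b < prefixList g b → ¬ ((prefixList g b).headD 0 < f b ∧ f b < g b)) ↔
      ∀ a < b, (∀ s, a < s → s < b → f s = g s) → ¬ (f a < g a ∧ g a < f b ∧ f b < g b) := by
  rw [prefixList_lt_iff]
  constructor
  · rintro h a hab hs ⟨h1, h2, h3⟩
    refine h ⟨a, hab, h1, hs⟩ ⟨?_, h3⟩
    rw [headD_prefixList _ (by omega)]
    rcases Nat.lt_or_ge a (b - 1) with h4 | h4
    · rw [← hs (b - 1) h4 (by omega)]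
      exact hf _ _ (by omega) le_rfl
    · rwa [show b - 1 = a by omega]
  · rintro h ⟨a, hab, h1, hs⟩ ⟨h2, h3⟩
    rw [headD_prefixList _ (by omega)] at h2
    refine h a hab hs ⟨h1, lt_of_le_of_lt ?_ h2, h3⟩
    rcases Nat.lt_or_ge a (b - 1) with h4 | h4
    · exact (hg _ _ h4 (by omega)).le
    · rw [show b - 1 = a by omega]

theorem listNoncrossing_prefixList_iff {k : ℕ} {f g : ℕ → ℕ}
    (hf : ∀ s t, s < t → t < k → f s < f t) (hg : ∀ s t, s < t → t < k → g s < g t) :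
    ListNoncrossing (prefixList f k) (prefixList g k) ↔ SeqNoncrossing k f g := by
  induction k with
  | zero => simp [prefixList, ListNoncrossing, SeqNoncrossing]
  | succ k ih =>
    rw [prefixList, prefixList, ListNoncrossing,
      ih (fun s t h1 h2 => hf s t h1 (by omega)) (fun s t h1 h2 => hg s t h1 (by omega)),
      lex_crossing_iff (fun s t h1 h2 => hf s t h1 (by omega))
        (fun s t h1 h2 => hg s t h1 (by omega)),
      lex_crossing_iff (fun s t h1 h2 => hg s t h1 (by omega))
        (fun s t h1 h2 => hf s t h1 (by omega))]
    constructor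
    · rintro ⟨h1, h2, h3⟩ b hb a hab hs
      rcases Nat.lt_succ_iff_lt_or_eq.1 hb with h4 | rfl
      · exact h1 b h4 a hab hs
      · exact ⟨h2 a hab hs, h3 a hab fun s h5 h6 => (hs s h5 h6).symm⟩
    · intro h
      exact ⟨fun b hb => h b (by omega), fun a hab hs => (h k (by omega) a hab hs).1,
        fun a hab hs => (h k (by omega) a hab fun s h5 h6 => (hs s h5 h6).symm).2⟩

/-- The decreasing list of the elements of `J`, as positive integers. -/
def KSubset.toList {k n : ℕ} (J : KSubset k n) : List ℕ := prefixList J.entry k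

theorem KSubset.toList_injective {k n : ℕ} :
    Function.Injective (KSubset.toList : KSubset k n → List ℕ) := by
  intro I J h
  refine KSubset.ext_elt fun s => ?_
  have h1 := congrArg (fun l => List.getD l (k - 1 - s) 0) h
  simp only [KSubset.toList] at h1
  rw [getD_prefixList _ _ _ (by omega), getD_prefixList _ _ _ (by omega),
    show k - 1 - (k - 1 - (s : ℕ)) = s by omega, I.entry_of_lt s.2, J.entry_of_lt s.2] at h1
  simpa using h1

theorem KSubset.listDecreasing_toList {k n : ℕ} (J : KSubset k n) : ListDecreasing J.toList :=
  listDecreasing_prefixList (fun s hs => by rw [J.entry_of_lt hs]; omega)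
    fun s t hst ht => J.entry_lt hst ht

theorem ListDecreasing.getD_lt {I : List ℕ} (hI : ListDecreasing I) {p : ℕ} (hp : p < I.length) :
    I.getD (p + 1) 0 < I.getD p 0 := by
  induction I generalizing p with
  | nil => simp at hp
  | cons i I ih =>
    cases p with
    | zero =>
      have := hI.1
      rw [headD_eq_getD] at this
      simpa using this
    | succ p =>
      rw [List.getD_cons_succ, List.getD_cons_succ]
      exact ih hI.2 (by simpa using hp)

theorem ListDecreasing.getD_lt_getD {I : List ℕ} (hI : ListDecreasing I) {p q : ℕ} (hpq : p < q)
    (hp : p < I.length) : I.getD q 0 < I.getD p 0 := by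
  induction q, hpq using Nat.le_induction with
  | base => exact hI.getD_lt hp
  | succ q hq ih =>
    rcases Nat.lt_or_ge q I.length with h | h
    · exact (hI.getD_lt h).trans ih
    · rw [List.getD_eq_default _ _ (by omega)]
      exact lt_of_le_of_lt (Nat.zero_le _) ih

theorem exists_toList_eq {k n : ℕ} {I : List ℕ} (hlen : I.length = k) (hI : ListDecreasing I)
    (hn : I.getD 0 0 ≤ n) : ∃ J : KSubset k n, J.toList = I := by
  have hlt : ∀ s : Fin k, I.getD (k - 1 - s) 0 ≤ n ∧ 0 < I.getD (k - 1 - s) 0 := by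
    intro s
    constructor
    · rcases Nat.eq_zero_or_pos (k - 1 - s) with h | h
      · rw [h]
        exact hn
      · exact (hI.getD_lt_getD h (by omega)).le.trans hn
    · exact lt_of_le_of_lt (Nat.zero_le _) (hI.getD_lt (p := k - 1 - s) (by omega))
  have hmono : StrictMono fun s : Fin k => I.getD (k - 1 - s) 0 - 1 := by
    intro s t hst
    have := hI.getD_lt_getD (p := k - 1 - t) (q := k - 1 - s)
      (by have : (s : ℕ) < t := hst; omega) (by omega)
    have h1 := hlt s
    have h2 := hlt t
    dsimp only
    omega
  refine ⟨KSubset.mk' _ hmono fun s => ?_, ?_⟩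
  · have := hlt s
    omega
  · refine List.ext_getElem (by rw [KSubset.toList, length_prefixList, hlen]) fun p h1 h2 => ?_
    rw [← List.getD_eq_getElem _ 0 h1, ← List.getD_eq_getElem _ 0 h2, KSubset.toList,
      getD_prefixList _ _ _ (by omega), KSubset.entry_of_lt _ (by omega), KSubset.elt_mk']
    have := hlt ⟨k - 1 - p, by omega⟩
    dsimp only at *
    rw [show k - 1 - (k - 1 - p) = p by omega] at *
    omega

/-! ### Noncrossing subsets -/

theorem map_Ioo_eq_iff {k n : ℕ} (f g : Fin k ↪o Fin n) (a b : Fin k) :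
    (Finset.Ioo a b).map f.toEmbedding = (Finset.Ioo a b).map g.toEmbedding ↔
      ∀ s, a < s → s < b → f s = g s := by
  constructor
  · intro h
    -- at the first index where the sequences differ, the smaller value occurs in one image only
    have aux : ∀ (f g : Fin k ↪o Fin n), (Finset.Ioo a b).map f.toEmbedding =
        (Finset.Ioo a b).map g.toEmbedding → ∀ s, a < s → s < b →
        (∀ t, a < t → t < s → f t = g t) → g s ≤ f s := by
      intro f g h s has hsb hlt
      by_contra hfg
      have : f s ∈ (Finset.Ioo a b).map g.toEmbedding := by
        rw [← h]
        simp [has, hsb]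
      obtain ⟨t, ht, hts⟩ := Finset.mem_map.1 this
      rw [Finset.mem_Ioo] at ht
      have hts : g t = f s := hts
      have h1 : t < s := g.lt_iff_lt.1 (hts ▸ not_le.1 hfg)
      have := hlt t ht.1 h1
      rw [hts] at this
      exact h1.ne (f.injective this)
    intro s
    induction s using WellFoundedLT.induction with
    | _ s ih =>
      intro has hsb
      exact le_antisymm
        (aux g f h.symm s has hsb fun t h1 h2 => (ih t h2 h1 (h2.trans hsb)).symm)
        (aux f g h s has hsb fun t h1 h2 => ih t h2 h1 (h2.trans hsb))
  · intro h
    ext x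
    simp only [Finset.mem_map, Finset.mem_Ioo]
    constructor
    · rintro ⟨s, hs, rfl⟩
      exact ⟨s, hs, (h s hs.1 hs.2).symm⟩
    · rintro ⟨s, hs, rfl⟩
      exact ⟨s, hs, h s hs.1 hs.2⟩

theorem mem_sdiff_of_eq_interior {k n : ℕ} {f g : Fin k ↪o Fin n} {a b : Fin k}
    (h : ∀ s, a < s → s < b → f s = g s) {x : Fin n}
    (hx : x ∈ (Finset.Icc a b).map f.toEmbedding \ (Finset.Icc a b).map g.toEmbedding) :
    x = f a ∨ x = f b := by
  rw [Finset.mem_sdiff] at hx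
  obtain ⟨s, hs, rfl⟩ := Finset.mem_map.1 hx.1
  rw [Finset.mem_Icc] at hs
  rcases hs.1.eq_or_lt with rfl | h1
  · exact Or.inl rfl
  rcases hs.2.eq_or_lt with rfl | h2
  · exact Or.inr rfl
  refine absurd (Finset.mem_map.2 ⟨s, Finset.mem_Icc.2 hs, ?_⟩) hx.2
  exact (h s h1 h2).symm

theorem weaklySeparated_iff {k n : ℕ} {f g : Fin k ↪o Fin n} {a b : Fin k}
    (hab : a < b) (h : ∀ s, a < s → s < b → f s = g s) :
    WeaklySeparated ((Finset.Icc a b).map f.toEmbedding) ((Finset.Icc a b).map g.toEmbedding) ↔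
      ¬ (f a < g a ∧ g a < f b ∧ f b < g b) ∧ ¬ (g a < f a ∧ f a < g b ∧ g b < f b) := by
  have aux1 : ∀ (f g : Fin k ↪o Fin n), (∀ s, a < s → s < b → f s = g s) →
      (f a < g a ∧ g a < f b ∧ f b < g b) →
      (f a ∈ (Finset.Icc a b).map f.toEmbedding \ (Finset.Icc a b).map g.toEmbedding ∧
      g a ∈ (Finset.Icc a b).map g.toEmbedding \ (Finset.Icc a b).map f.toEmbedding ∧
      f b ∈ (Finset.Icc a b).map f.toEmbedding \ (Finset.Icc a b).map g.toEmbedding ∧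
      g b ∈ (Finset.Icc a b).map g.toEmbedding \ (Finset.Icc a b).map f.toEmbedding) := by
    intro f g h h1
    have hmem : ∀ (f g : Fin k ↪o Fin n) (s : Fin k), a ≤ s → s ≤ b →
        (∀ t, a ≤ t → t ≤ b → g t ≠ f s) →
        f s ∈ (Finset.Icc a b).map f.toEmbedding \ (Finset.Icc a b).map g.toEmbedding := by
      intro f g s h1 h2 h3
      rw [Finset.mem_sdiff, Finset.mem_map, Finset.mem_map]
      refine ⟨⟨s, Finset.mem_Icc.2 ⟨h1, h2⟩, rfl⟩, ?_⟩
      rintro ⟨t, ht, h4⟩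
      rw [Finset.mem_Icc] at ht
      exact h3 t ht.1 ht.2 h4
    refine ⟨hmem f g a le_rfl hab.le fun t h2 h3 => ?_, hmem g f a le_rfl hab.le fun t h2 h3 => ?_,
      hmem f g b hab.le le_rfl fun t h2 h3 => ?_, hmem g f b hab.le le_rfl fun t h2 h3 => ?_⟩
    · exact (h1.1.trans_le (g.monotone h2)).ne'
    · rcases h2.eq_or_lt with rfl | h2
      · exact h1.1.ne
      rcases h3.eq_or_lt with rfl | h3
      · exact h1.2.1.ne'
      · rw [h t h2 h3]
        exact (g.strictMono h2).ne'
    · rcases h2.eq_or_lt with rfl | h2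
      · exact h1.2.1.ne
      rcases h3.eq_or_lt with rfl | h3
      · exact h1.2.2.ne'
      · rw [← h t h2 h3]
        exact (f.strictMono h3).ne
    · exact ((f.monotone h3).trans_lt h1.2.2).ne
  have aux2 : ∀ (f g : Fin k ↪o Fin n), (∀ s, a < s → s < b → f s = g s) →
      ∀ p q r s : Fin n, p < q → q < r → r < s →
      (p ∈ (Finset.Icc a b).map f.toEmbedding \ (Finset.Icc a b).map g.toEmbedding ∧
      q ∈ (Finset.Icc a b).map g.toEmbedding \ (Finset.Icc a b).map f.toEmbedding ∧
      r ∈ (Finset.Icc a b).map f.toEmbedding \ (Finset.Icc a b).map g.toEmbedding ∧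
      s ∈ (Finset.Icc a b).map g.toEmbedding \ (Finset.Icc a b).map f.toEmbedding) →
      f a < g a ∧ g a < f b ∧ f b < g b := by
    rintro f g h p q r s hpq hqr hrs ⟨hp, hq, hr, hs⟩
    have hf := f.strictMono hab
    have hg := g.strictMono hab
    have h' : ∀ s, a < s → s < b → g s = f s := fun s h1 h2 => (h s h1 h2).symm
    rcases mem_sdiff_of_eq_interior h hp with rfl | rfl <;>
    rcases mem_sdiff_of_eq_interior h hr with rfl | rfl <;>
    rcases mem_sdiff_of_eq_interior h' hq with rfl | rfl <;>
    rcases mem_sdiff_of_eq_interior h' hs with rfl | rfl <;>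
    first
      | exact ⟨hpq, hqr, hrs⟩
      | (exfalso; omega)
  rw [WeaklySeparated, ← not_or, not_iff_not]
  constructor
  · rintro ⟨p, q, r, s, hpq, hqr, hrs, h1 | h1⟩
    · exact Or.inl (aux2 f g h p q r s hpq hqr hrs h1)
    · exact Or.inr (aux2 g f (fun s h1 h2 => (h s h1 h2).symm) p q r s hpq hqr hrs h1)
  · rintro (h1 | h1)
    · exact ⟨f a, g a, f b, g b, h1.1, h1.2.1, h1.2.2, Or.inl (aux1 f g h h1)⟩
    · exact ⟨g a, f a, g b, f b, h1.1, h1.2.1, h1.2.2,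
        Or.inr (aux1 g f (fun s h1 h2 => (h s h1 h2).symm) h1)⟩

theorem noncrossing_iff_seq {k n : ℕ} (I J : KSubset k n) :
    Noncrossing I J ↔ SeqNoncrossing k I.entry J.entry := by
  have key : Noncrossing I J ↔ ∀ a b : Fin k, a < b →
      (∀ s, a < s → s < b → I.elt s = J.elt s) →
      ¬ (I.elt a < J.elt a ∧ J.elt a < I.elt b ∧ I.elt b < J.elt b) ∧
      ¬ (J.elt a < I.elt a ∧ I.elt a < J.elt b ∧ J.elt b < I.elt b) := by
    refine forall_congr' fun a => forall_congr' fun b => forall_congr' fun hab => ?_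
    rw [Ne, map_Ioo_eq_iff]
    by_cases h : ∀ s, a < s → s < b → I.elt s = J.elt s
    · rw [weaklySeparated_iff hab h]
      exact ⟨fun h1 _ => h1.resolve_right fun h2 => h2 h, fun h1 => Or.inl (h1 h)⟩
    · exact ⟨fun _ h1 => absurd h1 h, fun _ => Or.inr h⟩
  rw [key]
  constructor
  · intro h b hb a hab hs
    have := h ⟨a, hab.trans hb⟩ ⟨b, hb⟩ hab fun s h1 h2 => by
      have h3 := hs s h1 h2
      rw [I.entry_of_lt s.2, J.entry_of_lt s.2] at h3
      exact Fin.ext (by simpa using h3)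
    rw [I.entry_of_lt hb, J.entry_of_lt hb, I.entry_of_lt (hab.trans hb),
      J.entry_of_lt (hab.trans hb)]
    simpa only [Fin.lt_def, add_lt_add_iff_right] using this
  · intro h a b hab hs
    have := h b b.2 a hab fun s h1 h2 => by
      have h3 := hs ⟨s, h2.trans b.2⟩ h1 h2
      rw [I.entry_of_lt (h2.trans b.2), J.entry_of_lt (h2.trans b.2), h3]
    rw [I.entry_of_lt b.2, J.entry_of_lt b.2, I.entry_of_lt a.2,
      J.entry_of_lt a.2] at this
    simpa only [Fin.lt_def, add_lt_add_iff_right] using this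

theorem noncrossing_iff_list {k n : ℕ} (I J : KSubset k n) :
    Noncrossing I J ↔ ListNoncrossing I.toList J.toList := by
  rw [noncrossing_iff_seq, KSubset.toList, KSubset.toList, listNoncrossing_prefixList_iff]
  · exact fun s t h1 h2 => I.entry_lt h1 h2
  · exact fun s t h1 h2 => J.entry_lt h1 h2

/-- A multiset of pairwise noncrossing `k`-subsets is determined by the multisets of its
`s`-th elements. -/
theorem noncrossing_unique {k n : ℕ} {R S : Multiset (KSubset k n)} (hcard : R.card = S.card)
    (hR : ∀ I ∈ R, ∀ J ∈ R, Noncrossing I J) (hS : ∀ I ∈ S, ∀ J ∈ S, Noncrossing I J)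
    (hRS : ∀ s, R.map (fun J => J.elt s) = S.map fun J => J.elt s) : R = S := by
  apply Multiset.map_injective KSubset.toList_injective
  apply listNoncrossing_unique k (by simpa using hcard)
  · simp only [Multiset.mem_map, forall_exists_index, and_imp, forall_apply_eq_imp_iff₂]
    exact fun J _ => length_prefixList _ _
  · simp only [Multiset.mem_map, forall_exists_index, and_imp, forall_apply_eq_imp_iff₂]
    exact fun J _ => length_prefixList _ _
  · simp only [Multiset.mem_map, forall_exists_index, and_imp, forall_apply_eq_imp_iff₂]
    exact fun J _ => J.listDecreasing_toList
  · simp only [Multiset.mem_map, forall_exists_index, and_imp, forall_apply_eq_imp_iff₂]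
    exact fun J _ => J.listDecreasing_toList
  · simp only [Multiset.mem_map, forall_exists_index, and_imp, forall_apply_eq_imp_iff₂,
      ← noncrossing_iff_list]
    exact hR
  · simp only [Multiset.mem_map, forall_exists_index, and_imp, forall_apply_eq_imp_iff₂,
      ← noncrossing_iff_list]
    exact hS
  · intro p hp
    have h := congrArg (Multiset.map fun x : Fin n => (x : ℕ) + 1) (hRS ⟨k - 1 - p, by omega⟩)
    simp only [Multiset.map_map, Function.comp_def] at h ⊢
    simpa only [KSubset.toList, getD_prefixList _ _ _ hp,
      KSubset.entry_of_lt _ (show k - 1 - p < k by omega)] using h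

/-- Every multiset of `k`-subsets can be rearranged, position by position, into a pairwise
noncrossing one. -/
theorem exists_noncrossing {k n : ℕ} (hk : 0 < k) (R : Multiset (KSubset k n)) :
    ∃ S : Multiset (KSubset k n), (∀ I ∈ S, ∀ J ∈ S, Noncrossing I J) ∧
      ∀ s, S.map (fun J => J.elt s) = R.map fun J => J.elt s := by
  rcases isEmpty_or_nonempty (KSubset k n) with hE | hE
  · exact ⟨R, fun I => (hE.false I).elim, fun s => rfl⟩
  obtain ⟨T, -, hTlen, hTd, hT, hTR⟩ := exists_listNoncrossing k (R.map KSubset.toList)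
    (by
      simp only [Multiset.mem_map, forall_exists_index, and_imp, forall_apply_eq_imp_iff₂]
      exact fun J _ => length_prefixList _ _)
    (by
      simp only [Multiset.mem_map, forall_exists_index, and_imp, forall_apply_eq_imp_iff₂]
      exact fun J _ => J.listDecreasing_toList)
  have hTn : ∀ I ∈ T, (Function.invFun KSubset.toList I : KSubset k n).toList = I := by
    intro I hI
    refine Function.invFun_eq (exists_toList_eq (hTlen I hI) (hTd I hI) ?_)
    have h1 : I.getD 0 0 ∈ T.map fun I => I.getD 0 0 := Multiset.mem_map_of_mem _ hI
    rw [hTR 0 hk, Multiset.map_map] at h1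
    obtain ⟨J, -, hJ⟩ := Multiset.mem_map.1 h1
    rw [← hJ, Function.comp_apply, KSubset.toList, getD_prefixList _ _ _ hk,
      KSubset.entry_of_lt _ (by omega)]
    omega
  have hST : (T.map (Function.invFun (KSubset.toList : KSubset k n → _))).map KSubset.toList = T := by
    rw [Multiset.map_map]
    exact (Multiset.map_congr rfl hTn).trans (Multiset.map_id' T)
  refine ⟨T.map (Function.invFun KSubset.toList), ?_, fun s => ?_⟩
  · simp only [Multiset.mem_map, forall_exists_index, and_imp, forall_apply_eq_imp_iff₂,
      noncrossing_iff_list]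
    intro I hI J hJ
    rw [hTn I hI, hTn J hJ]
    exact hT I hI J hJ
  · have h := hTR (k - 1 - s) (by omega)
    rw [← hST, Multiset.map_map] at h
    simp only [Multiset.map_map, Function.comp_def, KSubset.toList] at h
    have h1 : (fun x : KSubset k n => (prefixList x.entry k).getD (k - 1 - s) 0) =
        fun x => (x.elt s : ℕ) + 1 := by
      funext J
      rw [getD_prefixList _ _ _ (by omega), show k - 1 - (k - 1 - (s : ℕ)) = s by omega,
        KSubset.entry_of_lt _ s.2]
    have h2 : Function.Injective fun x : Fin n => (x : ℕ) + 1 := fun x y hxy =>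
      Fin.ext (by simpa using hxy)
    apply Multiset.map_injective h2
    rw [Multiset.map_map, Multiset.map_map, Multiset.map_map]
    have h3 := Multiset.map_map (fun x : KSubset k n => (prefixList x.entry k).getD (k - 1 - s) 0)
      (Function.invFun KSubset.toList) T
    simp only [Function.comp_def] at h3 ⊢
    rw [h1] at h3 h
    rw [← h, ← h3, Multiset.map_map]
    rfl

/-! ### The vectors `𝔱_J` and noncrossing tableaux -/

theorem KSubset.elt_add_le {k n : ℕ} (J : KSubset k n) {s t : Fin k} (hst : s ≤ t) :
    (J.elt s : ℕ) + (t - s) ≤ J.elt t := by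
  have key : ∀ d (h : (s : ℕ) + d < k), (J.elt s : ℕ) + d ≤ J.elt ⟨s + d, h⟩ := by
    intro d
    induction d with
    | zero => simp
    | succ d ih =>
      intro h
      have h1 := ih (by omega)
      have h2 : J.elt ⟨s + d, by omega⟩ < J.elt ⟨s + (d + 1), h⟩ :=
        J.elt.strictMono (by simp [Fin.lt_def])
      have h3 : (J.elt ⟨s + d, by omega⟩ : ℕ) < J.elt ⟨s + (d + 1), h⟩ := h2
      omega
  have hst' : (s : ℕ) ≤ t := hst
  have := key (t - s) (by omega)
  rwa [show (⟨s + (t - s), by omega⟩ : Fin k) = t from Fin.ext (by simp only; omega)] at this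

theorem KSubset.le_elt {k n : ℕ} (J : KSubset k n) (s : Fin k) : (s : ℕ) ≤ J.elt s := by
  have := J.elt_add_le (s := ⟨0, s.pos⟩) (t := s) (Nat.zero_le _)
  simp only at this
  omega

theorem KSubset.elt_le {k n : ℕ} (J : KSubset k n) (s : Fin k) :
    (J.elt s : ℕ) ≤ n - k + s := by
  have hs := s.2
  have := J.elt_add_le (s := s) (t := ⟨k - 1, by omega⟩) (show (s : ℕ) ≤ k - 1 by omega)
  have h1 := (J.elt ⟨k - 1, by omega⟩).2
  simp only at this
  omega

/-- A representative of `𝔱_J`: the difference of the indicators of `j_i - i ≤ s` and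
`j_{i+1} - (i+1) ≤ s`. -/
def tRepr {k n : ℕ} (J : KSubset k n) : Fin (k - 1) → Fin (n - k) → ℝ := fun i s =>
  (if (J.elt ⟨i, by omega⟩ : ℕ) ≤ i + s then 1 else 0) -
    if (J.elt ⟨i + 1, by omega⟩ : ℕ) ≤ i + 1 + s then 1 else 0

theorem tVec_eq {k n : ℕ} (J : KSubset k n) : tVec J = toTropSpace (tRepr J) := by
  unfold tVec tRepr
  congr 1
  funext i s
  have h := J.elt_add_le (s := ⟨i, by omega⟩) (t := ⟨i + 1, by omega⟩) (by simp [Fin.le_def])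
  simp only at h
  split_ifs <;> first | omega | simp

/-- The projection to `𝕋^{k,n}` as a linear map. -/
def toTropSpaceL (k n : ℕ) : (Fin (k - 1) → Fin (n - k) → ℝ) →ₗ[ℝ] TropSpace k n :=
  LinearMap.pi fun l => (Submodule.mkQ _) ∘ₗ LinearMap.proj l

theorem toTropSpaceL_apply {k n : ℕ} (y : Fin (k - 1) → Fin (n - k) → ℝ) :
    toTropSpaceL k n y = toTropSpace y := rfl

theorem toTropSpace_eq_iff {k n : ℕ} {y z : Fin (k - 1) → Fin (n - k) → ℝ} :
    (toTropSpace y : TropSpace k n) = toTropSpace z ↔ ∀ i, ∃ c, ∀ s, y i s = z i s + c := by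
  rw [funext_iff]
  refine forall_congr' fun i => ?_
  rw [toTropSpace, toTropSpace, Submodule.Quotient.eq, Submodule.mem_span_singleton]
  refine exists_congr fun c => ?_
  rw [funext_iff]
  refine forall_congr' fun s => ?_
  simp only [Pi.smul_apply, Pi.sub_apply, smul_eq_mul, mul_one]
  constructor <;> intro h <;> linarith

theorem toTropSpace_surjective {k n : ℕ} :
    Function.Surjective (toTropSpace : _ → TropSpace k n) := fun t =>
  ⟨fun l => Quotient.out (t l), funext fun l => Quotient.out_eq (t l)⟩

/-- The number of members `J` of `R` with `j_s - s ≤ v`. -/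
def levelCount {k n : ℕ} (s : Fin k) (v : ℕ) : Multiset (KSubset k n) →+ ℕ :=
  Multiset.countPAddMonoidHom fun J => (J.elt s : ℕ) ≤ s + v

theorem levelCount_singleton {k n : ℕ} (s : Fin k) (v : ℕ) (J : KSubset k n) :
    levelCount s v {J} = if (J.elt s : ℕ) ≤ s + v then 1 else 0 := by
  simp only [levelCount, Multiset.coe_countPAddMonoidHom, ← Multiset.cons_zero,
    Multiset.countP_cons, Multiset.countP_zero, zero_add]

theorem levelCount_eq_card {k n : ℕ} (s : Fin k) {v : ℕ} (hv : n - k ≤ v)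
    (R : Multiset (KSubset k n)) : levelCount s v R = R.card := by
  simp only [levelCount, Multiset.coe_countPAddMonoidHom]
  rw [Multiset.countP_eq_card]
  intro J _
  have := J.elt_le s
  omega

theorem sum_tVec {k n : ℕ} (R : Multiset (KSubset k n)) : (R.map tVec).sum =
    toTropSpace fun i s => (levelCount ⟨i, by omega⟩ s R : ℝ) -
      levelCount ⟨i + 1, by omega⟩ s R := by
  induction R using Multiset.induction_on with
  | empty =>
    simp only [Multiset.map_zero, Multiset.sum_zero, map_zero, Nat.cast_zero, sub_zero]
    exact (map_zero (toTropSpaceL k n)).symm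
  | cons J R ih =>
    rw [Multiset.map_cons, Multiset.sum_cons, ih, tVec_eq, ← toTropSpaceL_apply,
      ← toTropSpaceL_apply, ← map_add, ← Multiset.singleton_add, toTropSpaceL_apply]
    congr 1
    funext i s
    simp only [map_add, levelCount_singleton, Pi.add_apply, tRepr, Nat.cast_add, Nat.cast_ite,
      Nat.cast_one, Nat.cast_zero]
    ring

theorem Multiset.eq_of_countP_le {M N : Multiset ℕ}
    (h : ∀ v, M.countP (· ≤ v) = N.countP (· ≤ v)) : M = N := by
  have key : ∀ (M : Multiset ℕ) (v : ℕ),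
      M.countP (· ≤ v + 1) = M.countP (· ≤ v) + M.count (v + 1) := by
    intro M v
    induction M using Multiset.induction_on with
    | empty => simp
    | cons a M ih =>
      rw [Multiset.countP_cons, Multiset.countP_cons, Multiset.count_cons, ih]
      split_ifs <;> omega
  have key0 : ∀ M : Multiset ℕ, M.countP (· ≤ 0) = M.count 0 := by
    intro M
    rw [Multiset.count]
    exact Multiset.countP_congr rfl fun x _ => by simp [eq_comm]
  ext x
  cases x with
  | zero => rw [← key0, ← key0, h]
  | succ x =>
    have h1 := key M x
    have h2 := key N x
    rw [h, h] at h1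
    omega

theorem map_elt_eq_of_levelCount {k n : ℕ} {R S : Multiset (KSubset k n)} (s : Fin k)
    (h : ∀ v ≤ n - k, levelCount s v R = levelCount s v S) :
    R.map (fun J => J.elt s) = S.map fun J => J.elt s := by
  apply Multiset.map_injective Fin.val_injective
  rw [Multiset.map_map, Multiset.map_map]
  apply Multiset.eq_of_countP_le
  intro v
  rw [Multiset.countP_map, Multiset.countP_map, ← Multiset.countP_eq_card_filter,
    ← Multiset.countP_eq_card_filter]
  rcases Nat.lt_or_ge v s with hv | hv
  · rw [Multiset.countP_eq_zero.2, Multiset.countP_eq_zero.2] <;>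
    · intro J _
      have := J.le_elt s
      simp only [Function.comp_apply]
      omega
  · obtain ⟨w, rfl⟩ := Nat.exists_eq_add_of_le hv
    have h1 : levelCount s w R = levelCount s w S := by
      rcases Nat.le_total w (n - k) with hw | hw
      · exact h w hw
      · have := h (n - k) le_rfl
        rwa [levelCount_eq_card s le_rfl, levelCount_eq_card s le_rfl,
          ← levelCount_eq_card s hw, ← levelCount_eq_card s hw] at this
    exact h1

theorem levelCount_eq_of_map_elt {k n : ℕ} {R S : Multiset (KSubset k n)} (s : Fin k)
    (h : R.map (fun J => J.elt s) = S.map fun J => J.elt s) (v : ℕ) :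
    levelCount s v R = levelCount s v S := by
  have h1 := congrArg (Multiset.countP fun x : Fin n => (x : ℕ) ≤ s + v) h
  rw [Multiset.countP_map, Multiset.countP_map, ← Multiset.countP_eq_card_filter,
    ← Multiset.countP_eq_card_filter] at h1
  exact h1

/-! ### Cyclic intervals -/

theorem elt_eq_of_forall_lt_mem {k n : ℕ} (J : KSubset k n) (i : Fin k)
    (h : ∀ z : Fin n, z < J.elt i → z ∈ J.1) : (J.elt i : ℕ) = i := by
  have key : ∀ s : Fin k, s ≤ i → (J.elt s : ℕ) = s := by
    intro s
    induction s using WellFoundedLT.induction with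
    | _ s ih =>
      intro hsi
      by_contra hne
      have hlt : (s : ℕ) < J.elt s := lt_of_le_of_ne (J.le_elt s) (Ne.symm hne)
      have hn : (s : ℕ) < n := hlt.trans (J.elt s).2
      have h1 : (⟨s, hn⟩ : Fin n) < J.elt s := hlt
      obtain ⟨t, ht⟩ := (J.mem_iff _).1 (h ⟨s, hn⟩ (h1.trans_le (J.elt.monotone hsi)))
      have hts : t < s := J.elt.lt_iff_lt.1 (ht ▸ h1)
      have h2 := ih t hts (hts.le.trans hsi)
      rw [ht] at h2
      have h3 : (t : ℕ) < s := hts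
      simp only at h2
      omega
  exact key i le_rfl

theorem elt_eq_of_forall_gt_mem {k n : ℕ} (J : KSubset k n) (i : Fin k)
    (h : ∀ z : Fin n, J.elt i < z → z ∈ J.1) : (J.elt i : ℕ) = n - k + i := by
  have hkn : k ≤ n := by
    have := J.2
    have h1 := Finset.card_le_univ J.1
    rw [this, Fintype.card_fin] at h1
    exact h1
  have key : ∀ s : Fin k, i ≤ s → (J.elt s : ℕ) = n - k + s := by
    intro s
    induction s using WellFoundedGT.induction with
    | _ s ih =>
      intro hsi
      by_contra hne
      have hlt : (J.elt s : ℕ) < n - k + s := lt_of_le_of_ne (J.elt_le s) hne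
      have hn : n - k + (s : ℕ) < n := by omega
      have h1 : J.elt s < (⟨n - k + s, hn⟩ : Fin n) := hlt
      obtain ⟨t, ht⟩ := (J.mem_iff _).1 (h ⟨n - k + s, hn⟩ ((J.elt.monotone hsi).trans_lt h1))
      have hts : s < t := J.elt.lt_iff_lt.1 (ht ▸ h1)
      have h2 := ih t hts (hsi.trans hts.le)
      rw [ht] at h2
      have h3 : (s : ℕ) < t := hts
      simp only at h2
      omega
  exact key i le_rfl

/-- A cyclic interval with a gap contains everything outside of the gap. -/
theorem IsCyclicInterval.mem_of_gap {n : ℕ} {J : Finset (Fin n)} (hJ : IsCyclicInterval J)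
    {x g y z : Fin n} (hxg : x < g) (hgy : g < y) (hx : x ∈ J) (hg : g ∉ J) (hy : y ∈ J)
    (hz : z < x ∨ y < z) : z ∈ J := by
  obtain ⟨a, m, h⟩ := hJ
  have hn : 0 < n := x.pos
  -- membership depends only on the residue of `a`
  have hmem : ∀ w : Fin n, w ∈ J ↔ (w : ℕ) + (if (w : ℕ) < a % n then n else 0) < a % n + m := by
    intro w
    rw [h w]
    have ha : a % n < n := Nat.mod_lt _ hn
    constructor
    · rintro ⟨r, hr, hw⟩
      rw [← Nat.mod_add_mod] at hw
      have h1 := Nat.div_add_mod (a % n + r) n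
      rw [← hw] at h1
      have h2 : (a % n + r) / n = 0 ∨ n ≤ n * ((a % n + r) / n) := by
        rcases Nat.eq_zero_or_pos ((a % n + r) / n) with h3 | h3
        · exact Or.inl h3
        · exact Or.inr (Nat.le_mul_of_pos_right n h3)
      rcases h2 with h2 | h2
      · rw [h2] at h1
        split_ifs <;> omega
      · have := w.2
        split_ifs <;> omega
    · intro hw
      refine ⟨(w : ℕ) + (if (w : ℕ) < a % n then n else 0) - a % n, by split_ifs at * <;> omega, ?_⟩
      rw [← Nat.mod_add_mod]
      have := w.2
      split_ifs with h1
      · rw [show a % n + ((w : ℕ) + n - a % n) = w + n by omega, Nat.add_mod_right,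
          Nat.mod_eq_of_lt w.2]
      · rw [show a % n + ((w : ℕ) + 0 - a % n) = w by omega, Nat.mod_eq_of_lt w.2]
  rw [hmem] at *
  have h1 : (x : ℕ) < g := hxg
  have h2 : (g : ℕ) < y := hgy
  have h3 : (z : ℕ) < x ∨ (y : ℕ) < z := hz
  have := y.2
  have := z.2
  split_ifs at * <;> omega

theorem tVec_eq_zero_of_cyclic {k n : ℕ} (J : KSubset k n) (hJ : IsCyclicInterval J.1) :
    tVec J = 0 := by
  rw [tVec_eq, show (0 : TropSpace k n) = toTropSpace 0 from rfl, toTropSpace_eq_iff]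
  intro i
  have hlt : J.elt ⟨i, by omega⟩ < J.elt ⟨i + 1, by omega⟩ :=
    J.elt.strictMono (by simp [Fin.lt_def])
  have hlt' : (J.elt ⟨i, by omega⟩ : ℕ) < J.elt ⟨i + 1, by omega⟩ := hlt
  rcases Nat.lt_or_ge (J.elt ⟨i, by omega⟩ + 1) (J.elt ⟨i + 1, by omega⟩) with hgap | hgap
  · have hx := (J.mem_iff _).2 ⟨⟨i, by omega⟩, rfl⟩
    have hy := (J.mem_iff _).2 ⟨⟨i + 1, by omega⟩, rfl⟩
    have hgn : (J.elt ⟨i, by omega⟩ : ℕ) + 1 < n := hgap.trans (J.elt ⟨i + 1, by omega⟩).2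
    have hxg : J.elt ⟨i, by omega⟩ < (⟨_, hgn⟩ : Fin n) := by simp [Fin.lt_def]
    have hgy : (⟨_, hgn⟩ : Fin n) < J.elt ⟨i + 1, by omega⟩ := hgap
    have hg : (⟨_, hgn⟩ : Fin n) ∉ J.1 := by
      rw [J.mem_iff]
      rintro ⟨t, ht⟩
      rw [← ht] at hxg hgy
      have h1 := J.elt.lt_iff_lt.1 hxg
      have h2 := J.elt.lt_iff_lt.1 hgy
      simp only [Fin.lt_def] at h1 h2
      omega
    have e1 := elt_eq_of_forall_lt_mem J ⟨i, by omega⟩ fun z hz =>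
      hJ.mem_of_gap hxg hgy hx hg hy (Or.inl hz)
    have e2 := elt_eq_of_forall_gt_mem J ⟨i + 1, by omega⟩ fun z hz =>
      hJ.mem_of_gap hxg hgy hx hg hy (Or.inr hz)
    refine ⟨1, fun s => ?_⟩
    have := s.2
    rw [tRepr, e1, e2, if_pos (by simp), if_neg (by simp only; omega)]
    simp
  · refine ⟨0, fun s => ?_⟩
    rw [tRepr]
    split_ifs <;> first | omega | simp

theorem SeqNoncrossing.symm {k : ℕ} {f g : ℕ → ℕ} (h : SeqNoncrossing k f g) :
    SeqNoncrossing k g f := fun b hb a hab hs =>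
  (h b hb a hab fun s h1 h2 => (hs s h1 h2).symm).symm

theorem Noncrossing.symm {k n : ℕ} {I J : KSubset k n} (h : Noncrossing I J) :
    Noncrossing J I := by
  rw [noncrossing_iff_seq] at *
  exact SeqNoncrossing.symm h

/-- Two sequences do not cross along a stretch on which one of them has no gaps. -/
theorem not_crossing_of_consecutive {f g : ℕ → ℕ} {a b : ℕ} (hab : a < b)
    (hg : ∀ s t, s < t → t ≤ b → g s < g t) (hs : ∀ s, a < s → s < b → f s = g s)
    (hf : ∀ s, a ≤ s → s < b → f (s + 1) = f s + 1) :
    ¬ (f a < g a ∧ g a < f b ∧ f b < g b) ∧ ¬ (g a < f a ∧ f a < g b ∧ g b < f b) := by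
  rcases Nat.lt_or_ge (a + 1) b with h | h
  · have h1 := hs (a + 1) (by omega) h
    have h2 := hs (b - 1) (by omega) (by omega)
    have h3 := hf a le_rfl hab
    have h4 := hf (b - 1) (by omega) (by omega)
    have h5 := hg a (a + 1) (by omega) (by omega)
    have h6 := hg (b - 1) b (by omega) (by omega)
    rw [Nat.sub_add_cancel (by omega)] at h4
    omega
  · obtain rfl : b = a + 1 := by omega
    have h3 := hf a le_rfl hab
    omega

/-- The cyclic interval `{v, …, v + k - 1}`. -/
def intervalSubset (k n v : ℕ) (h : v + k ≤ n) : KSubset k n :=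
  KSubset.mk' (fun s : Fin k => v + s)
    (fun s t (hst : (s : ℕ) < t) => show v + (s : ℕ) < v + t by omega)
    fun s => by omega

/-- The cyclic interval consisting of the first `p` and the last `k - p` elements. -/
def wrapSubset (k n p : ℕ) (h : k ≤ n) : KSubset k n :=
  KSubset.mk' (fun s : Fin k => if (s : ℕ) < p then (s : ℕ) else n - k + s)
    (fun s t (hst : (s : ℕ) < t) => by dsimp only; split_ifs <;> omega)
    fun s => by split_ifs <;> omega

theorem elt_intervalSubset {k n v : ℕ} (h : v + k ≤ n) (s : Fin k) :
    ((intervalSubset k n v h).elt s : ℕ) = v + s := KSubset.elt_mk' _ _ _ s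

theorem elt_wrapSubset {k n p : ℕ} (h : k ≤ n) (s : Fin k) :
    ((wrapSubset k n p h).elt s : ℕ) = if (s : ℕ) < p then (s : ℕ) else n - k + s :=
  KSubset.elt_mk' _ _ _ s

theorem isCyclicInterval_intervalSubset {k n v : ℕ} (h : v + k ≤ n) :
    IsCyclicInterval (intervalSubset k n v h).1 := by
  refine ⟨v, k, fun x => ?_⟩
  rw [KSubset.mem_iff]
  constructor
  · rintro ⟨s, rfl⟩
    refine ⟨s, s.2, ?_⟩
    rw [elt_intervalSubset, Nat.mod_eq_of_lt (by omega)]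
  · rintro ⟨r, hr, hx⟩
    refine ⟨⟨r, hr⟩, Fin.ext ?_⟩
    rw [elt_intervalSubset, hx, Nat.mod_eq_of_lt (by omega)]

theorem isCyclicInterval_wrapSubset {k n p : ℕ} (h : k ≤ n) (hp : p ≤ k) :
    IsCyclicInterval (wrapSubset k n p h).1 := by
  refine ⟨n - k + p, k, fun x => ?_⟩
  rw [KSubset.mem_iff]
  constructor
  · rintro ⟨s, rfl⟩
    rw [elt_wrapSubset]
    split_ifs with hs
    · refine ⟨k - p + s, by omega, ?_⟩
      rw [show n - k + p + (k - p + (s : ℕ)) = s + n by omega, Nat.add_mod_right,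
        Nat.mod_eq_of_lt (by omega)]
    · refine ⟨s - p, by omega, ?_⟩
      rw [Nat.mod_eq_of_lt (by omega)]
      omega
  · rintro ⟨r, hr, hx⟩
    rcases Nat.lt_or_ge (p + r) k with h1 | h1
    · refine ⟨⟨p + r, h1⟩, Fin.ext ?_⟩
      rw [elt_wrapSubset, hx, Nat.mod_eq_of_lt (by omega), if_neg (by simp)]
      simp only
      omega
    · refine ⟨⟨p + r - k, by omega⟩, Fin.ext ?_⟩
      rw [elt_wrapSubset, hx, if_pos (by simp only; omega),
        show n - k + p + r = p + r - k + n by omega, Nat.add_mod_right,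
        Nat.mod_eq_of_lt (by omega)]

theorem noncrossing_intervalSubset {k n v : ℕ} (h : v + k ≤ n) (J : KSubset k n) :
    Noncrossing (intervalSubset k n v h) J := by
  rw [noncrossing_iff_seq]
  intro b hb a hab hs
  refine not_crossing_of_consecutive hab (fun s t h1 h2 => J.entry_lt h1 (by omega)) hs
    fun s h1 h2 => ?_
  rw [KSubset.entry_of_lt _ (by omega), KSubset.entry_of_lt _ (by omega), elt_intervalSubset,
    elt_intervalSubset]
  simp only
  omega

theorem noncrossing_wrapSubset {k n p : ℕ} (h : k ≤ n) (J : KSubset k n) :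
    Noncrossing (wrapSubset k n p h) J := by
  rw [noncrossing_iff_seq]
  intro b hb a hab hs
  have hf : ∀ s < k, (wrapSubset k n p h).entry s = (if s < p then s else n - k + s) + 1 := by
    intro s hs
    rw [KSubset.entry_of_lt _ hs, elt_wrapSubset]
  by_cases hc : a < p ∧ p ≤ b
  · -- here both entries of the special subset are extremal
    have h1 := hf a (by omega)
    have h2 := hf b hb
    rw [if_pos hc.1] at h1
    rw [if_neg (by omega)] at h2
    have h3 := J.entry_of_lt (s := a) (by omega)
    have h4 := J.entry_of_lt hb
    have h5 := J.le_elt ⟨a, by omega⟩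
    have h6 := J.elt_le ⟨b, hb⟩
    simp only at h5 h6
    omega
  · refine not_crossing_of_consecutive hab (fun s t h1 h2 => J.entry_lt h1 (by omega)) hs
      fun s h1 h2 => ?_
    rw [hf _ (by omega), hf _ (by omega)]
    split_ifs <;> omega

/-! ### Noncrossing tableaux and integral points -/

open Classical in
theorem filter_noncyclic_add {k n : ℕ} {R A : Multiset (KSubset k n)}
    (hR : ∀ J ∈ R, ¬ IsCyclicInterval J.1) (hA : ∀ J ∈ A, IsCyclicInterval J.1) :
    (R + A).filter (fun J => ¬ IsCyclicInterval J.1) = R := by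
  rw [Multiset.filter_add, Multiset.filter_eq_self.2 hR,
    Multiset.filter_eq_nil.2 fun J hJ => not_not.2 (hA J hJ), add_zero]

/-- The multiset of wrapping intervals with multiplicities `α i`. -/
def wrapMultiset (k n : ℕ) (h : k ≤ n) (α : Fin (k - 1) → ℕ) : Multiset (KSubset k n) :=
  ∑ i, α i • {wrapSubset k n (i + 1) h}

/-- The multiset of intervals `{v, …, v + k - 1}` with multiplicities `β v`. -/
def intervalMultiset (k n : ℕ) (h : k ≤ n) (β : ℕ → ℕ) : Multiset (KSubset k n) :=
  ∑ v : Fin (n - k + 1), β v • {intervalSubset k n v (by omega)}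

theorem mem_wrapMultiset {k n : ℕ} {h : k ≤ n} {α : Fin (k - 1) → ℕ} {J : KSubset k n}
    (hJ : J ∈ wrapMultiset k n h α) : IsCyclicInterval J.1 ∧ ∀ I, Noncrossing J I := by
  rw [wrapMultiset, Multiset.mem_sum] at hJ
  obtain ⟨i, -, hi⟩ := hJ
  rw [Multiset.mem_singleton.1 (Multiset.mem_of_mem_nsmul hi)]
  exact ⟨isCyclicInterval_wrapSubset h (by omega), noncrossing_wrapSubset h⟩

theorem mem_intervalMultiset {k n : ℕ} {h : k ≤ n} {β : ℕ → ℕ} {J : KSubset k n}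
    (hJ : J ∈ intervalMultiset k n h β) : IsCyclicInterval J.1 ∧ ∀ I, Noncrossing J I := by
  rw [intervalMultiset, Multiset.mem_sum] at hJ
  obtain ⟨i, -, hi⟩ := hJ
  rw [Multiset.mem_singleton.1 (Multiset.mem_of_mem_nsmul hi)]
  exact ⟨isCyclicInterval_intervalSubset _, noncrossing_intervalSubset _⟩

theorem levelCount_wrapMultiset {k n : ℕ} (h : k ≤ n) (α : Fin (k - 1) → ℕ) (s : Fin k) {v : ℕ}
    (hv : v < n - k) :
    levelCount s v (wrapMultiset k n h α) = ∑ i : Fin (k - 1), if (s : ℕ) ≤ i then α i else 0 := by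
  rw [wrapMultiset, map_sum]
  refine Finset.sum_congr rfl fun i _ => ?_
  rw [map_nsmul, levelCount_singleton, elt_wrapSubset, smul_eq_mul]
  split_ifs <;> omega

theorem levelCount_intervalMultiset {k n : ℕ} (h : k ≤ n) (β : ℕ → ℕ) (s : Fin k) {v : ℕ}
    (hv : v ≤ n - k) :
    levelCount s v (intervalMultiset k n h β) = ∑ w ∈ Finset.range (v + 1), β w := by
  rw [intervalMultiset, map_sum]
  have h1 : ∀ x : Fin (n - k + 1), levelCount s v (β x • {intervalSubset k n x (by omega)}) =
      if (x : ℕ) ≤ v then β x else 0 := by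
    intro x
    rw [map_nsmul, levelCount_singleton, elt_intervalSubset, smul_eq_mul]
    split_ifs <;> omega
  rw [Finset.sum_congr rfl fun x _ => h1 x,
    ← Finset.sum_range (n := n - k + 1) fun w => if w ≤ v then β w else 0, ← Finset.sum_filter]
  congr 1
  ext w
  simp only [Finset.mem_filter, Finset.mem_range]
  omega

theorem noncrossing_add_of_forall {k n : ℕ} {R A : Multiset (KSubset k n)}
    (hR : ∀ I ∈ R, ∀ J ∈ R, Noncrossing I J) (hA : ∀ I ∈ A, ∀ J, Noncrossing I J) :
    ∀ I ∈ R + A, ∀ J ∈ R + A, Noncrossing I J := by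
  intro I hI J hJ
  rcases Multiset.mem_add.1 hI with h1 | h1
  · rcases Multiset.mem_add.1 hJ with h2 | h2
    · exact hR I h1 J h2
    · exact (hA J h2 I).symm
  · exact hA I h1 J

/-- A noncrossing tableau is determined by its point. Equality of points means that the
contents agree up to the contents of cyclic intervals, which do not cross any other subset. -/
theorem NoncrossingTableau.point_injective {k n : ℕ} (hk : 0 < k) (hkn : k < n) :
    Function.Injective (NoncrossingTableau.point : NoncrossingTableau k n → TropSpace k n) := by
  classical
  rintro ⟨R, hRc, hR⟩ ⟨S, hSc, hS⟩ h
  apply Subtype.ext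
  dsimp only
  simp only [NoncrossingTableau.point, sum_tVec] at h
  rw [toTropSpace_eq_iff] at h
  have hm : 0 < n - k := by omega
  have hc : ∀ i : Fin (k - 1), ∃ c : ℤ, ∀ v < n - k,
      (levelCount ⟨i, by omega⟩ v R : ℤ) - levelCount ⟨i + 1, by omega⟩ v R =
        levelCount ⟨i, by omega⟩ v S - levelCount ⟨i + 1, by omega⟩ v S + c := by
    intro i
    obtain ⟨c, hc⟩ := h i
    refine ⟨(levelCount ⟨i, by omega⟩ 0 R : ℤ) - levelCount ⟨i + 1, by omega⟩ 0 R -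
      (levelCount ⟨i, by omega⟩ 0 S - levelCount ⟨i + 1, by omega⟩ 0 S), fun v hv => ?_⟩
    have h1 := hc ⟨v, hv⟩
    have h2 := hc ⟨0, hm⟩
    simp only at h1 h2
    rw [← @Int.cast_inj ℝ]
    push_cast
    linarith
  choose c hc using hc
  -- wrapping intervals absorb the constants `c i`
  set R₁ := R + wrapMultiset k n hkn.le fun i => (-c i).toNat with hR₁
  set S₁ := S + wrapMultiset k n hkn.le fun i => (c i).toNat with hS₁
  have hdiff : ∀ (α : Fin (k - 1) → ℕ) (i : Fin (k - 1)) (v : ℕ), v < n - k →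
      levelCount ⟨i, by omega⟩ v (wrapMultiset k n hkn.le α) =
        levelCount ⟨i + 1, by omega⟩ v (wrapMultiset k n hkn.le α) + α i := by
    intro α i v hv
    rw [levelCount_wrapMultiset _ _ _ hv, levelCount_wrapMultiset _ _ _ hv,
      ← Finset.add_sum_erase _ _ (Finset.mem_univ i),
      ← Finset.add_sum_erase (a := i) _ _ (Finset.mem_univ i), if_pos le_rfl,
      if_neg (by simp), zero_add, add_comm]
    congr 1
    refine Finset.sum_congr rfl fun j hj => ?_
    have hji : (j : ℕ) ≠ i := fun h => (Finset.mem_erase.1 hj).1 (Fin.ext h)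
    simp only
    split_ifs <;> omega
  have hstep : ∀ (s : ℕ) (hs : s < k) (v : ℕ), v < n - k →
      (levelCount ⟨s, hs⟩ v R₁ : ℤ) - levelCount ⟨s, hs⟩ v S₁ =
        levelCount ⟨0, hk⟩ v R₁ - levelCount ⟨0, hk⟩ v S₁ := by
    intro s
    induction s with
    | zero => exact fun _ _ _ => rfl
    | succ s ih =>
      intro hs v hv
      rw [← ih (by omega) v hv, hR₁, hS₁]
      simp only [map_add, Nat.cast_add]
      have h1 := hc ⟨s, by omega⟩ v hv
      have h2 := hdiff (fun i => (-c i).toNat) ⟨s, by omega⟩ v hv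
      have h3 := hdiff (fun i => (c i).toNat) ⟨s, by omega⟩ v hv
      have h4 := Int.toNat_sub_toNat_neg (c ⟨s, by omega⟩)
      simp only at h1 h2 h3
      omega
  -- intervals absorb the remaining difference, which is the same in all positions
  let g : ℕ → ℤ := fun v => if v = 0 then 0 else
    (levelCount ⟨0, hk⟩ (v - 1) R₁ : ℤ) - levelCount ⟨0, hk⟩ (v - 1) S₁
  have hg : ∀ (s : Fin k) (v : ℕ), v ≤ n - k →
      (levelCount s v R₁ : ℤ) - levelCount s v S₁ = g (v + 1) := by
    intro s v hv
    simp only [g, Nat.succ_ne_zero, if_false, Nat.add_sub_cancel]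
    rcases hv.eq_or_lt with rfl | hv
    · simp only [levelCount_eq_card _ le_rfl]
    · exact hstep s s.2 v hv
  set R₂ := R₁ + intervalMultiset k n hkn.le fun v => (-(g (v + 1) - g v)).toNat with hR₂
  set S₂ := S₁ + intervalMultiset k n hkn.le fun v => (g (v + 1) - g v).toNat with hS₂
  have hcount : ∀ (s : Fin k) (v : ℕ), v ≤ n - k → levelCount s v R₂ = levelCount s v S₂ := by
    intro s v hv
    have h1 := hg s v hv
    have h2 := Finset.sum_range_sub g (v + 1)
    have h3 : (∑ w ∈ Finset.range (v + 1), (((g (w + 1) - g w).toNat : ℕ) : ℤ)) -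
        ∑ w ∈ Finset.range (v + 1), (((-(g (w + 1) - g w)).toNat : ℕ) : ℤ) =
        ∑ w ∈ Finset.range (v + 1), (g (w + 1) - g w) := by
      rw [← Finset.sum_sub_distrib]
      exact Finset.sum_congr rfl fun w _ => Int.toNat_sub_toNat_neg _
    have h4 : g 0 = 0 := if_pos rfl
    rw [← @Nat.cast_inj ℤ, hR₂, hS₂, map_add _ R₁, map_add _ S₁, levelCount_intervalMultiset _ _ _ hv,
      levelCount_intervalMultiset _ _ _ hv]
    push_cast at h3 ⊢
    linarith
  have heq : R₂ = S₂ := by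
    apply noncrossing_unique
    · have := hcount ⟨0, hk⟩ (n - k) le_rfl
      rwa [levelCount_eq_card _ le_rfl, levelCount_eq_card _ le_rfl] at this
    · exact noncrossing_add_of_forall (noncrossing_add_of_forall hR
        fun I hI => (mem_wrapMultiset hI).2) fun I hI => (mem_intervalMultiset hI).2
    · exact noncrossing_add_of_forall (noncrossing_add_of_forall hS
        fun I hI => (mem_wrapMultiset hI).2) fun I hI => (mem_intervalMultiset hI).2
    · exact fun s => map_elt_eq_of_levelCount s (hcount s)
  have hcyc : ∀ α β, ∀ J ∈ wrapMultiset k n hkn.le α + intervalMultiset k n hkn.le β,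
      IsCyclicInterval J.1 := by
    intro α β J hJ
    rcases Multiset.mem_add.1 hJ with h1 | h1
    · exact (mem_wrapMultiset h1).1
    · exact (mem_intervalMultiset h1).1
  rw [hR₂, hS₂, hR₁, hS₁, add_assoc, add_assoc] at heq
  rw [← filter_noncyclic_add hRc (hcyc _ _), heq, filter_noncyclic_add hSc (hcyc _ _)]

/-- The subset with `j_s - s = v` for `s ≤ i` and `j_s - s = v + 1` for `s > i`. -/
def unitSubset (k n : ℕ) (i v : ℕ) (h : v + 1 + k ≤ n) : KSubset k n :=
  KSubset.mk' (fun s : Fin k => if (s : ℕ) ≤ i then v + s else v + 1 + s)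
    (fun s t (hst : (s : ℕ) < t) => by dsimp only; split_ifs <;> omega)
    fun s => by split_ifs <;> omega

theorem elt_unitSubset {k n i v : ℕ} (h : v + 1 + k ≤ n) (s : Fin k) :
    ((unitSubset k n i v h).elt s : ℕ) = if (s : ℕ) ≤ i then v + s else v + 1 + s :=
  KSubset.elt_mk' _ _ _ s

theorem tVec_unitSubset {k n : ℕ} (i : Fin (k - 1)) (v : Fin (n - k)) :
    tVec (unitSubset k n i v (by omega)) =
      toTropSpaceL k n (Pi.single i (Pi.single v 1)) := by
  rw [tVec_eq, toTropSpaceL_apply]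
  congr 1
  funext j s
  simp only [tRepr, elt_unitSubset]
  rcases eq_or_ne j i with rfl | hji
  · rw [Pi.single_eq_same, Pi.single_apply]
    simp only [Fin.ext_iff]
    split_ifs <;> first | omega | simp
  · rw [Pi.single_eq_of_ne hji]
    have : (j : ℕ) ≠ i := fun h => hji (Fin.ext h)
    rw [Pi.zero_apply]
    split_ifs <;> first | omega | simp

/-- Every integral point is the point of a noncrossing tableau. -/
theorem NoncrossingTableau.exists_point_eq {k n : ℕ} (hk : 0 < k)
    (y : Fin (k - 1) → Fin (n - k) → ℤ) :
    ∃ 𝒥 : NoncrossingTableau k n, 𝒥.point = toTropSpace fun i s => (y i s : ℝ) := by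
  classical
  let z : Fin (k - 1) → Fin (n - k) → ℕ := fun i s => (y i s + ∑ t, |y i t|).toNat
  have hz : ∀ i s, (z i s : ℝ) = y i s + ∑ t, |(y i t : ℝ)| := by
    intro i s
    have h1 : (0 : ℤ) ≤ y i s + ∑ t, |y i t| := by
      have := Finset.single_le_sum (f := fun t => |y i t|) (fun t _ => abs_nonneg _)
        (Finset.mem_univ s)
      have := neg_abs_le (y i s)
      linarith
    have h2 : ((z i s : ℕ) : ℤ) = y i s + ∑ t, |y i t| := Int.toNat_of_nonneg h1
    exact_mod_cast h2
  let hom : Multiset (KSubset k n) →+ TropSpace k n :=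
    (Multiset.sumAddMonoidHom).comp (Multiset.mapAddMonoidHom tVec)
  have hhom : ∀ R, hom R = (R.map tVec).sum := fun R => rfl
  obtain ⟨S, hS, hSR⟩ := exists_noncrossing hk
    (∑ i, ∑ v, z i v • ({unitSubset k n i v (by omega)} : Multiset (KSubset k n)))
  refine ⟨⟨S.filter fun J => ¬ IsCyclicInterval J.1, fun J hJ => (Multiset.mem_filter.1 hJ).2,
    fun I hI J hJ => hS I (Multiset.mem_filter.1 hI).1 J (Multiset.mem_filter.1 hJ).1⟩, ?_⟩
  have h0 : hom (S.filter fun J => IsCyclicInterval J.1) = 0 := by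
    rw [hhom]
    apply Multiset.sum_eq_zero
    intro x hx
    obtain ⟨J, hJ, rfl⟩ := Multiset.mem_map.1 hx
    exact tVec_eq_zero_of_cyclic J (Multiset.mem_filter.1 hJ).2
  have h1 : hom (S.filter fun J => ¬ IsCyclicInterval J.1) = hom S := by
    conv_rhs => rw [← Multiset.filter_add_not (fun J : KSubset k n => IsCyclicInterval J.1) S]
    rw [map_add, h0, zero_add]
  change hom (S.filter fun J => ¬ IsCyclicInterval J.1) = _
  rw [h1, hhom, sum_tVec]
  simp only [fun s v => levelCount_eq_of_map_elt s (hSR s) v]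
  rw [← sum_tVec, ← hhom]
  have h2 : ∀ (i : Fin (k - 1)) (v : Fin (n - k)), hom {unitSubset k n i v (by omega)} =
      toTropSpaceL k n (Pi.single i (Pi.single v 1)) := by
    intro i v
    rw [hhom, Multiset.map_singleton, Multiset.sum_singleton, tVec_unitSubset]
  simp only [map_sum, map_nsmul, h2]
  simp only [← map_nsmul, ← map_sum]
  rw [toTropSpaceL_apply, toTropSpace_eq_iff]
  refine fun i => ⟨∑ t, |(y i t : ℝ)|, fun s => ?_⟩
  rw [← hz]
  simp only [Finset.sum_apply, nsmul_eq_mul]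
  rw [Finset.sum_eq_single i, Finset.sum_eq_single s]
  · simp
  · intro t _ ht
    simp [ht.symm]
  · simp
  · intro j _ hj
    apply Finset.sum_eq_zero
    intro t _
    simp [Pi.single_eq_of_ne hj.symm]
  · simp

/-! ### Counting functions of subsets -/

/-- The number of elements of `J` smaller than `x`. -/
def countBelow {k n : ℕ} (J : KSubset k n) (x : ℕ) : ℕ :=
  (J.1.filter fun z : Fin n => (z : ℕ) < x).card

theorem countBelow_zero {k n : ℕ} (J : KSubset k n) : countBelow J 0 = 0 := by
  simp [countBelow]

theorem countBelow_succ {k n : ℕ} (J : KSubset k n) (x : Fin n) :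
    countBelow J (x + 1) = countBelow J x + if x ∈ J.1 then 1 else 0 := by
  have h : (J.1.filter fun z : Fin n => (z : ℕ) < x + 1) =
      (J.1.filter fun z : Fin n => (z : ℕ) < x) ∪ J.1.filter fun z => z = x := by
    ext z
    simp only [Finset.mem_filter, Finset.mem_union, Fin.ext_iff, ← and_or_left]
    exact and_congr_right fun _ => by omega
  rw [countBelow, h, Finset.card_union_of_disjoint, Finset.filter_eq', countBelow]
  · split_ifs <;> simp
  · rw [Finset.disjoint_left]
    intro z hz hz'
    have h1 := (Finset.mem_filter.1 hz).2
    rw [(Finset.mem_filter.1 hz').2] at h1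
    omega

theorem countBelow_eq {k n : ℕ} (J : KSubset k n) : countBelow J n = k := by
  rw [countBelow, Finset.filter_true_of_mem fun z _ => z.2, J.2]

theorem countBelow_le_add {k n : ℕ} (J : KSubset k n) {x y : ℕ} (hxy : x ≤ y) (hy : y ≤ n) :
    countBelow J x ≤ countBelow J y ∧ countBelow J y ≤ countBelow J x + (y - x) := by
  induction y, hxy using Nat.le_induction with
  | base => simp
  | succ y hxy ih =>
    have h1 := ih (by omega)
    have h2 := countBelow_succ J ⟨y, by omega⟩
    simp only at h2
    split_ifs at h2 <;> omega

theorem elt_lt_iff {k n : ℕ} (J : KSubset k n) (s : Fin k) (a : ℕ) :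
    (J.elt s : ℕ) < a ↔ (s : ℕ) < countBelow J a := by
  have h : countBelow J a = (Finset.univ.filter fun t : Fin k => (J.elt t : ℕ) < a).card := by
    rw [countBelow, ← Finset.card_map J.elt.toEmbedding]
    congr 1
    ext x
    simp only [Finset.mem_filter, Finset.mem_map, Finset.mem_univ, true_and]
    rw [J.mem_iff]
    constructor
    · rintro ⟨⟨t, rfl⟩, ht⟩
      exact ⟨t, ht, rfl⟩
    · rintro ⟨t, ht, rfl⟩
      exact ⟨⟨t, rfl⟩, ht⟩
  rw [h]
  constructor
  · intro hs
    have : Finset.Iic s ⊆ Finset.univ.filter fun t : Fin k => (J.elt t : ℕ) < a := by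
      intro t ht
      simp only [Finset.mem_filter, Finset.mem_univ, true_and]
      have h1 : J.elt t ≤ J.elt s := J.elt.monotone (Finset.mem_Iic.1 ht)
      have h2 : (J.elt t : ℕ) ≤ J.elt s := h1
      omega
    have := Finset.card_le_card this
    rw [Fin.card_Iic] at this
    omega
  · intro hs
    by_contra hc
    have : (Finset.univ.filter fun t : Fin k => (J.elt t : ℕ) < a) ⊆ Finset.Iio s := by
      intro t ht
      simp only [Finset.mem_filter, Finset.mem_univ, true_and] at ht
      rw [Finset.mem_Iio]
      refine J.elt.lt_iff_lt.1 ?_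
      rw [Fin.lt_def]
      omega
    have := Finset.card_le_card this
    rw [Fin.card_Iio] at this
    omega

/-! ### The directed distance -/

theorem cycSucc_induction {n : ℕ} {P : Fin n → Prop} (h : ∀ i, P i → P (cycSucc i)) {i : Fin n}
    (hi : P i) (j : Fin n) : P j := by
  have key : ∀ r : ℕ, P ⟨((i : ℕ) + r) % n, Nat.mod_lt _ i.pos⟩ := by
    intro r
    induction r with
    | zero =>
      convert hi
      exact Nat.mod_eq_of_lt i.2
    | succ r ih =>
      convert h _ ih using 1
      rw [cycSucc, Fin.mk.injEq, Nat.mod_add_mod]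
      rfl
  convert key (j + n - i)
  rw [show (i : ℕ) + (j + n - i) = j + n by omega, Nat.add_mod_right, Nat.mod_eq_of_lt j.2]

theorem cycSucc_injective {n : ℕ} : Function.Injective (cycSucc : Fin n → Fin n) := by
  intro i j h
  have h1 : ((i : ℕ) + 1) % n = ((j : ℕ) + 1) % n := congrArg Fin.val h
  have h2 := i.2
  have h3 := j.2
  apply Fin.ext
  rcases Nat.lt_or_ge ((i : ℕ) + 1) n with h4 | h4 <;>
    rcases Nat.lt_or_ge ((j : ℕ) + 1) n with h5 | h5
  · rw [Nat.mod_eq_of_lt h4, Nat.mod_eq_of_lt h5] at h1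
    omega
  · rw [Nat.mod_eq_of_lt h4, show (j : ℕ) + 1 = n by omega, Nat.mod_self] at h1
    omega
  · rw [Nat.mod_eq_of_lt h5, show (i : ℕ) + 1 = n by omega, Nat.mod_self] at h1
    omega
  · omega

theorem cycSucc_surjective {n : ℕ} : Function.Surjective (cycSucc : Fin n → Fin n) :=
  Finite.surjective_of_injective cycSucc_injective

/-- A height function for a pair `(K, I)`: its cyclic difference is `e_I - e_K`. Walking from
`e_K` to `e_I` by planar steps amounts to building up a nonnegative height function, one unit at a
time. -/
def IsHeight {k n : ℕ} (c : Fin n → ℤ) (K I : KSubset k n) : Prop :=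
  ∀ j, indVec I.1 (cycSucc j) = indVec K.1 (cycSucc j) + c (cycSucc j) - c j

theorem isHeight_countBelow {k n : ℕ} (K I : KSubset k n) :
    IsHeight (fun j => (countBelow I (j + 1) : ℤ) - countBelow K (j + 1)) K I := by
  intro j
  have hI := countBelow_succ I (cycSucc j)
  have hK := countBelow_succ K (cycSucc j)
  simp only [indVec, hI, hK, Nat.cast_add, Nat.cast_ite, Nat.cast_one, Nat.cast_zero]
  rcases Nat.lt_or_ge (j + 1) n with h | h
  · have : ((cycSucc j : Fin n) : ℕ) = j + 1 := Nat.mod_eq_of_lt h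
    rw [this]
    ring
  · have h1 : (j : ℕ) + 1 = n := by omega
    have : ((cycSucc j : Fin n) : ℕ) = 0 := by
      change ((j : ℕ) + 1) % n = 0
      rw [h1, Nat.mod_self]
    rw [this, h1, countBelow_zero, countBelow_zero, countBelow_eq, countBelow_eq]
    ring

theorem IsHeight.add_const {k n : ℕ} {c : Fin n → ℤ} {K I : KSubset k n} (h : IsHeight c K I)
    (m : ℤ) : IsHeight (fun j => c j + m) K I := by
  intro j
  rw [h j]
  ring

theorem IsHeight.exists_sub_const {k n : ℕ} {c c' : Fin n → ℤ} {K I : KSubset k n}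
    (h : IsHeight c K I) (h' : IsHeight c' K I) (i : Fin n) : ∀ j, c' j = c j + (c' i - c i) := by
  refine cycSucc_induction (i := i) (fun j hj => ?_) (by ring)
  have h1 := h j
  have h2 := h' j
  linarith

theorem indVec_injective {k n : ℕ} {I J : KSubset k n} (h : indVec I.1 = indVec J.1) : I = J := by
  apply Subtype.ext
  ext x
  have := congrFun h x
  simp only [indVec] at this
  split_ifs at this with h1 h2 h2 <;> simp_all

theorem IsHeight.eq_of_zero {k n : ℕ} {c : Fin n → ℤ} {K I : KSubset k n} (h : IsHeight c K I)
    (hc : ∀ j, c j = 0) : K = I := by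
  apply indVec_injective
  funext x
  obtain ⟨j, rfl⟩ := cycSucc_surjective x
  rw [h j, hc, hc]
  ring

theorem exists_height {k n : ℕ} (hn : 0 < n) (K I : KSubset k n) :
    ∃ c : Fin n → ℤ, IsHeight c K I ∧ (∀ j, 0 ≤ c j) ∧ ∃ j, c j = 0 := by
  have : Nonempty (Fin n) := ⟨⟨0, hn⟩⟩
  obtain ⟨i, hi⟩ := Finite.exists_min fun j : Fin n =>
    (countBelow I (j + 1) : ℤ) - countBelow K (j + 1)
  exact ⟨_, (isHeight_countBelow K I).add_const
    (-((countBelow I (i + 1) : ℤ) - countBelow K (i + 1))),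
    fun j => by have := hi j; linarith, i, by ring⟩

theorem exists_step {k n : ℕ} {c : Fin n → ℤ} {K I : KSubset k n} (h : IsHeight c K I)
    (h0 : ∀ j, 0 ≤ c j) {i₀ : Fin n} (hi₀ : c i₀ = 0) (hne : ∃ j, c j ≠ 0) :
    ∃ i, 0 < c i ∧ i ∉ K.1 ∧ cycSucc i ∈ K.1 := by
  by_contra! hcon
  obtain ⟨j, hj0, hj1⟩ : ∃ j, c j = 0 ∧ 0 < c (cycSucc j) := by
    by_contra! hcon
    obtain ⟨j, hj⟩ := hne
    exact hj (cycSucc_induction (P := fun j => c j = 0)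
      (fun i hi => le_antisymm (hcon i hi) (h0 _)) hi₀ j)
  have hall : ∀ i, 0 < c i ∧ i ∉ K.1 := by
    refine cycSucc_induction (i := cycSucc j) (fun i hi => ?_) ⟨hj1, ?_⟩
    · have h1 := hcon i hi.1 hi.2
      refine ⟨?_, h1⟩
      have h2 := h i
      simp only [indVec, if_neg h1] at h2
      split_ifs at h2 <;> linarith [hi.1]
    · intro h1
      have h2 := h j
      simp only [indVec, if_pos h1] at h2
      split_ifs at h2 <;> linarith
  exact absurd (hall i₀).1 (by rw [hi₀]; exact lt_irrefl _)

theorem exists_walk {k n : ℕ} (m : ℕ) {c : Fin n → ℤ} {K I : KSubset k n} (h : IsHeight c K I)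
    (h0 : ∀ j, 0 ≤ c j) {i₀ : Fin n} (hi₀ : c i₀ = 0) (hm : ∑ j, c j = m) :
    ∃ w : ℕ → KSubset k n, w 0 = K ∧ w m = I ∧ ∀ s < m, PlanarStep (w s) (w (s + 1)) := by
  induction m generalizing c K with
  | zero =>
    have hc : ∀ j, c j = 0 := fun j =>
      (Finset.sum_eq_zero_iff_of_nonneg fun j _ => h0 j).1 (by exact_mod_cast hm) j
        (Finset.mem_univ j)
    exact ⟨fun _ => K, rfl, h.eq_of_zero hc, fun s hs => by omega⟩
  | succ m ih =>
    obtain ⟨i, hi, hiK, hiK'⟩ := exists_step h h0 hi₀ (by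
      by_contra! hcon
      rw [Finset.sum_eq_zero fun j _ => hcon j] at hm
      push_cast at hm
      omega)
    have hne : i ≠ cycSucc i := fun h => hiK (h ▸ hiK')
    let K' : KSubset k n := ⟨insert i (K.1.erase (cycSucc i)), by
      rw [Finset.card_insert_of_notMem fun h => hiK (Finset.mem_of_mem_erase h),
        Finset.card_erase_of_mem hiK', Nat.sub_add_cancel (Finset.card_pos.2 ⟨_, hiK'⟩), K.2]⟩
    have hK' : indVec K'.1 = indVec K.1 + Pi.single i 1 - Pi.single (cycSucc i) 1 := by
      funext x
      simp only [indVec, K', Finset.mem_insert, Finset.mem_erase, Pi.add_apply, Pi.sub_apply,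
        Pi.single_apply]
      by_cases h1 : x = i
      · subst h1
        simp [hiK, hne]
      · by_cases h2 : x = cycSucc i
        · subst h2
          simp [hiK', h1]
        · simp [h1, h2]
    obtain ⟨w, hw0, hwm, hw⟩ := ih (c := c - Pi.single i 1) (K := K') (by
      intro j
      rw [hK', h j]
      simp only [Pi.add_apply, Pi.sub_apply, Pi.single_apply, cycSucc_injective.eq_iff]
      ring) (fun j => by
      rw [Pi.sub_apply, Pi.single_apply]
      have := h0 j
      split_ifs with hji
      · rw [hji]
        omega
      · omega) (by
      have : i₀ ≠ i := by
        rintro rfl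
        omega
      simp [hi₀, this]) (by
      simp only [Pi.sub_apply, Finset.sum_sub_distrib, hm, Finset.sum_pi_single', Finset.mem_univ,
        if_true]
      push_cast
      ring)
    refine ⟨fun s => if s = 0 then K else w (s - 1), by simp, by simpa using hwm, fun s hs => ?_⟩
    rcases Nat.eq_zero_or_pos s with rfl | hs0
    · simp only [if_true, zero_add, one_ne_zero, if_false, Nat.sub_self, hw0]
      exact ⟨i, hK'⟩
    · dsimp only
      rw [if_neg (by omega), if_neg (by omega)]
      have := hw (s - 1) (by omega)
      rwa [show s - 1 + 1 = s + 1 - 1 by omega] at this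

theorem exists_height_of_walk {k n : ℕ} (m : ℕ) {K I : KSubset k n}
    (h : ∃ w : ℕ → KSubset k n, w 0 = K ∧ w m = I ∧ ∀ s < m, PlanarStep (w s) (w (s + 1))) :
    ∃ c : Fin n → ℤ, IsHeight c K I ∧ (∀ j, 0 ≤ c j) ∧ ∑ j, c j = m := by
  induction m generalizing I with
  | zero =>
    obtain ⟨w, hw0, hwm, -⟩ := h
    rw [← hw0, ← hwm]
    exact ⟨0, fun j => by simp, fun j => le_rfl, by simp⟩
  | succ m ih =>
    obtain ⟨w, hw0, hwm, hw⟩ := h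
    obtain ⟨c, hc, hc0, hcm⟩ := ih (I := w m) ⟨w, hw0, rfl, fun s hs => hw s (by omega)⟩
    obtain ⟨i, hi⟩ := hw m (by omega)
    rw [hwm] at hi
    refine ⟨c + Pi.single i 1, fun j => ?_, fun j => ?_, ?_⟩
    · rw [hi]
      have := hc j
      simp only [Pi.add_apply, Pi.sub_apply, Pi.single_apply, cycSucc_injective.eq_iff, this]
      ring
    · rw [Pi.add_apply, Pi.single_apply]
      have := hc0 j
      split_ifs <;> omega
    · simp only [Pi.add_apply, Finset.sum_add_distrib, hcm, Finset.sum_pi_single', Finset.mem_univ,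
        if_true]
      push_cast
      ring

/-- The directed distance is the total height of the normalized height function. -/
theorem directedDist_eq {k n : ℕ} {c : Fin n → ℤ} {K I : KSubset k n} (h : IsHeight c K I)
    (h0 : ∀ j, 0 ≤ c j) {i₀ : Fin n} (hi₀ : c i₀ = 0) : (directedDist K I : ℤ) = ∑ j, c j := by
  obtain ⟨m, hm⟩ := Int.eq_ofNat_of_zero_le (Finset.sum_nonneg fun j (_ : j ∈ Finset.univ) => h0 j)
  rw [hm]
  congr 1
  refine IsLeast.csInf_eq ⟨exists_walk m h h0 hi₀ hm, fun m' hm' => ?_⟩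
  obtain ⟨c', hc', hc0', hcm'⟩ := exists_height_of_walk m' hm'
  have h1 := h.exists_sub_const hc' i₀
  have h2 : ∑ j, c j ≤ ∑ j, c' j := by
    refine Finset.sum_le_sum fun j _ => ?_
    rw [h1 j, hi₀]
    linarith [hc0' i₀]
  rw [hm, hcm'] at h2
  exact_mod_cast h2

theorem directedDist_eq_zero_iff {k n : ℕ} (hn : 0 < n) {K I : KSubset k n} :
    directedDist K I = 0 ↔ K = I := by
  constructor
  · intro h
    obtain ⟨c, hc, hc0, i, hi⟩ := exists_height hn K I
    have h1 := directedDist_eq hc hc0 hi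
    rw [h] at h1
    exact hc.eq_of_zero fun j => (Finset.sum_eq_zero_iff_of_nonneg fun j _ => hc0 j).1
      (by exact_mod_cast h1.symm) j (Finset.mem_univ j)
  · rintro rfl
    have := directedDist_eq (c := 0) (K := K) (I := K) (i₀ := ⟨0, hn⟩) (fun j => by simp)
      (fun j => le_rfl) rfl
    simpa using this

/-! ### The planar basis -/

/-- The elements of `J` whose cyclic successor is not in `J`. -/
def ends {k n : ℕ} (J : KSubset k n) : Finset (Fin n) :=
  J.1.filter fun i => cycSucc i ∉ J.1

/-- The subset obtained from `J` by moving the elements of `M ⊆ ends J` forward by one. -/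
def shiftEnds {k n : ℕ} (J : KSubset k n) (M : Finset (Fin n)) (hM : M ⊆ ends J) : KSubset k n :=
  ⟨(J.1 \ M) ∪ M.image cycSucc, by
    rw [Finset.card_union_of_disjoint, Finset.card_image_of_injective _ cycSucc_injective,
      Finset.card_sdiff_add_card_eq_card fun i hi => (Finset.mem_filter.1 (hM hi)).1, J.2]
    rw [Finset.disjoint_right]
    intro x hx hx'
    obtain ⟨i, hi, rfl⟩ := Finset.mem_image.1 hx
    exact (Finset.mem_filter.1 (hM hi)).2 (Finset.mem_sdiff.1 hx').1⟩

theorem isHeight_shiftEnds {k n : ℕ} {c : Fin n → ℤ} {K J : KSubset k n} (h : IsHeight c K J)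
    {M : Finset (Fin n)} (hM : M ⊆ ends J) :
    IsHeight (fun j => c j - if j ∈ M then 1 else 0) K (shiftEnds J M hM) := by
  intro j
  have h1 : indVec (shiftEnds J M hM).1 (cycSucc j) = indVec J.1 (cycSucc j) -
      (if cycSucc j ∈ M then 1 else 0) + if j ∈ M then 1 else 0 := by
    have h2 : cycSucc j ∈ M → cycSucc j ∈ J.1 := fun h => (Finset.mem_filter.1 (hM h)).1
    have h3 : j ∈ M → cycSucc j ∉ J.1 := fun h => (Finset.mem_filter.1 (hM h)).2
    have h4 : cycSucc j ∈ M.image cycSucc ↔ j ∈ M := by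
      simp [cycSucc_injective.eq_iff]
    simp only [indVec, shiftEnds, Finset.mem_union, Finset.mem_sdiff, h4]
    by_cases a1 : cycSucc j ∈ M <;> by_cases a2 : j ∈ M <;> by_cases a3 : cycSucc j ∈ J.1 <;>
      simp_all
  rw [h1, h j]
  ring

theorem ends_nonempty {k n : ℕ} (hk : 0 < k) (hkn : k < n) (J : KSubset k n) :
    (ends J).Nonempty := by
  by_contra hcon
  rw [Finset.not_nonempty_iff_eq_empty] at hcon
  obtain ⟨i, hi⟩ := Finset.card_pos.1 (J.2.symm ▸ hk : 0 < J.1.card)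
  have : ∀ j, j ∈ J.1 := cycSucc_induction (i := i) (fun j hj => by
    by_contra h
    have : j ∈ ends J := Finset.mem_filter.2 ⟨hj, h⟩
    rw [hcon] at this
    simp at this) hi
  have h1 := J.2
  rw [Finset.eq_univ_iff_forall.2 this, Finset.card_univ, Fintype.card_fin] at h1
  omega

theorem eq_of_height_ends {k n : ℕ} {c : Fin n → ℤ} {K J : KSubset k n} (h : IsHeight c K J)
    (h0 : ∀ j, 0 ≤ c j) {i₀ : Fin n} (hi₀ : c i₀ = 0) (hends : ∀ i ∈ ends J, c i = 0) :
    K = J := by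
  refine h.eq_of_zero (cycSucc_induction (i := i₀) (fun j hj => ?_) hi₀)
  by_contra hne
  have hpos : 0 < c (cycSucc j) := lt_of_le_of_ne (h0 _) (Ne.symm hne)
  have hall : ∀ i, 0 < c i ∧ i ∈ J.1 := by
    refine cycSucc_induction (i := cycSucc j) (fun i hi => ?_) ⟨hpos, ?_⟩
    · have h1 : cycSucc i ∈ J.1 := by
        by_contra h1
        have := hends i (Finset.mem_filter.2 ⟨hi.2, h1⟩)
        omega
      refine ⟨?_, h1⟩
      have h2 := h i
      simp only [indVec, if_pos h1] at h2
      split_ifs at h2 <;> linarith [hi.1]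
    · by_contra h1
      have h2 := h j
      simp only [indVec, if_neg h1] at h2
      split_ifs at h2 <;> linarith
  have := (hall j).1
  omega

theorem sum_powerset_neg_one_pow_mul_card_nonpos {α : Type*} [DecidableEq α] (E : Finset α) :
    ∑ M ∈ E.powerset, (-1 : ℤ) ^ M.card * M.card ≤ 0 := by
  induction E using Finset.induction_on with
  | empty => simp
  | insert a E ha ih =>
    rw [Finset.sum_powerset_insert ha]
    have h1 : ∑ M ∈ E.powerset, (-1 : ℤ) ^ (insert a M).card * (insert a M).card =
        -(∑ M ∈ E.powerset, (-1 : ℤ) ^ M.card) - ∑ M ∈ E.powerset, (-1 : ℤ) ^ M.card * M.card := by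
      rw [← Finset.sum_neg_distrib, ← Finset.sum_sub_distrib]
      refine Finset.sum_congr rfl fun M hM => ?_
      rw [Finset.card_insert_of_notMem fun h => ha (Finset.mem_powerset.1 hM h)]
      push_cast
      ring
    rw [h1, Finset.sum_powerset_neg_one_pow_card]
    split_ifs <;> linarith

/-- The alternating sum of directed distances over the cube of shifts of the ends of `J`
depends on `K` only through a Kronecker delta. -/
theorem alternating_sum_directedDist {k n : ℕ} (hk : 0 < k) (hkn : k < n) (K J : KSubset k n) :
    ∑ M ∈ (ends J).powerset.attach, (-1 : ℤ) ^ M.1.card *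
      directedDist K (shiftEnds J M.1 (Finset.mem_powerset.1 M.2)) =
    -(∑ M ∈ (ends J).powerset, (-1 : ℤ) ^ M.card * M.card) - if K = J then (n : ℤ) else 0 := by
  obtain ⟨c, hc, hc0, i₀, hi₀⟩ := exists_height (by omega) K J
  set Z := (ends J).filter fun i => c i = 0 with hZ
  have hd : ∀ M (hM : M ⊆ ends J), (directedDist K (shiftEnds J M hM) : ℤ) =
      ∑ j, c j - M.card + (n : ℤ) - if M ⊆ ends J \ Z then (n : ℤ) else 0 := by
    intro M hM
    have hsum : ∑ j, (if j ∈ M then (1 : ℤ) else 0) = M.card := by simp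
    by_cases hMZ : M ⊆ ends J \ Z
    · rw [directedDist_eq (isHeight_shiftEnds hc hM) (i₀ := i₀), if_pos hMZ,
        Finset.sum_sub_distrib, hsum]
      · ring
      · intro j
        have := hc0 j
        split_ifs with hj
        · have h1 := hMZ hj
          rw [Finset.mem_sdiff, hZ, Finset.mem_filter] at h1
          have : c j ≠ 0 := fun h => h1.2 ⟨h1.1, h⟩
          omega
        · omega
      · rw [if_neg, hi₀, sub_zero]
        intro hj
        have h1 := hMZ hj
        rw [Finset.mem_sdiff, hZ, Finset.mem_filter] at h1
        exact h1.2 ⟨h1.1, hi₀⟩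
    · obtain ⟨i, hiM, hi⟩ : ∃ i ∈ M, c i = 0 := by
        obtain ⟨i, hiM, hi⟩ := Finset.not_subset.1 hMZ
        refine ⟨i, hiM, ?_⟩
        by_contra h
        refine hi (Finset.mem_sdiff.2 ⟨hM hiM, fun h1 => h ?_⟩)
        exact (Finset.mem_filter.1 h1).2
      rw [directedDist_eq ((isHeight_shiftEnds hc hM).add_const 1) (i₀ := i), if_neg hMZ,
        Finset.sum_add_distrib, Finset.sum_sub_distrib, hsum]
      · simp
      · intro j
        have := hc0 j
        split_ifs <;> omega
      · rw [if_pos hiM, hi]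
        ring
  have h1 : ∑ M ∈ (ends J).powerset.attach, (-1 : ℤ) ^ M.1.card *
      directedDist K (shiftEnds J M.1 (Finset.mem_powerset.1 M.2)) =
      ∑ M ∈ (ends J).powerset, (-1 : ℤ) ^ M.card * (∑ j, c j - M.card + (n : ℤ) -
        if M ⊆ ends J \ Z then (n : ℤ) else 0) := by
    rw [← Finset.sum_attach (ends J).powerset]
    exact Finset.sum_congr rfl fun M _ => by rw [hd]
  have h2 : ∑ M ∈ (ends J).powerset, (-1 : ℤ) ^ M.card = 0 := by
    rw [Finset.sum_powerset_neg_one_pow_card, if_neg (ends_nonempty hk hkn J).ne_empty]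
  have h3 : ∑ M ∈ (ends J).powerset, (-1 : ℤ) ^ M.card *
      (if M ⊆ ends J \ Z then (n : ℤ) else 0) = if K = J then (n : ℤ) else 0 := by
    have h4 : ∑ M ∈ (ends J).powerset, (-1 : ℤ) ^ M.card *
        (if M ⊆ ends J \ Z then (n : ℤ) else 0) =
        (∑ M ∈ (ends J \ Z).powerset, (-1 : ℤ) ^ M.card) * n := by
      rw [Finset.sum_mul]
      have : (ends J \ Z).powerset = (ends J).powerset.filter fun M => M ⊆ ends J \ Z := by
        ext M
        simp only [Finset.mem_powerset, Finset.mem_filter]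
        exact ⟨fun h => ⟨h.trans Finset.sdiff_subset, h⟩, fun h => h.2⟩
      rw [this, Finset.sum_filter]
      exact Finset.sum_congr rfl fun M _ => by split_ifs <;> simp
    rw [h4, Finset.sum_powerset_neg_one_pow_card]
    have h5 : ends J \ Z = ∅ ↔ K = J := by
      rw [Finset.sdiff_eq_empty_iff_subset]
      constructor
      · exact fun h => eq_of_height_ends hc hc0 hi₀ fun i hi => (Finset.mem_filter.1 (h hi)).2
      · rintro rfl
        have : ∀ j, c j = 0 := cycSucc_induction (i := i₀) (fun j hj => by
          have := hc j
          omega) hi₀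
        exact fun i hi => Finset.mem_filter.2 ⟨hi, this i⟩
    simp only [h5]
    split_ifs <;> simp
  rw [h1]
  have h6 : ∀ M : Finset (Fin n), (-1 : ℤ) ^ M.card * (∑ j, c j - M.card + (n : ℤ) -
      if M ⊆ ends J \ Z then (n : ℤ) else 0) = (-1 : ℤ) ^ M.card * (∑ j, c j + n) -
      (-1 : ℤ) ^ M.card * M.card -
      (-1 : ℤ) ^ M.card * (if M ⊆ ends J \ Z then (n : ℤ) else 0) := fun M => by ring
  rw [Finset.sum_congr rfl fun M _ => h6 M, Finset.sum_sub_distrib, Finset.sum_sub_distrib,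
    ← Finset.sum_mul, h2, h3]
  ring

theorem linearIndependent_planarBasis {k n : ℕ} (hk : 0 < k) (hkn : k < n) :
    LinearIndependent ℝ (planarBasis : KSubset k n → KSubset k n → ℝ) := by
  have hn : (n : ℝ) ≠ 0 := by
    have : n ≠ 0 := by omega
    exact_mod_cast this
  rw [Fintype.linearIndependent_iff]
  intro a ha
  have hdist : ∀ I : KSubset k n, ∑ K, a K * (directedDist K I : ℝ) = 0 := by
    intro I
    have h1 := congrFun ha I
    simp only [Finset.sum_apply, Pi.smul_apply, planarBasis, smul_eq_mul, Pi.zero_apply] at h1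
    have h2 : ∑ K, a K * (1 / (n : ℝ) * (directedDist K I : ℝ)) =
        1 / (n : ℝ) * ∑ K, a K * (directedDist K I : ℝ) := by
      rw [Finset.mul_sum]
      exact Finset.sum_congr rfl fun K _ => by ring
    rw [h2] at h1
    exact (mul_eq_zero.1 h1).resolve_left (by simpa using hn)
  set g : KSubset k n → ℝ := fun J =>
    -((∑ M ∈ (ends J).powerset, (-1 : ℤ) ^ M.card * M.card : ℤ) : ℝ) with hg
  have hg0 : ∀ J, 0 ≤ g J := fun J => by
    have := sum_powerset_neg_one_pow_mul_card_nonpos (ends J)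
    simp only [hg]
    have h2 : ((∑ M ∈ (ends J).powerset, (-1 : ℤ) ^ M.card * M.card : ℤ) : ℝ) ≤ 0 := by
      exact_mod_cast this
    linarith
  have key : ∀ J, n * a J = g J * ∑ K, a K := by
    intro J
    have h1 : ∀ K, a K * (g J - if K = J then (n : ℝ) else 0) =
        ∑ M ∈ (ends J).powerset.attach, (-1 : ℝ) ^ M.1.card *
        (a K * directedDist K (shiftEnds J M.1 (Finset.mem_powerset.1 M.2))) := by
      intro K
      have := alternating_sum_directedDist hk hkn K J
      have h2 : g J - (if K = J then (n : ℝ) else 0) =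
          ∑ M ∈ (ends J).powerset.attach, (-1 : ℝ) ^ M.1.card *
          directedDist K (shiftEnds J M.1 (Finset.mem_powerset.1 M.2)) := by
        have h3 := congrArg (Int.cast : ℤ → ℝ) this
        push_cast at h3
        rw [h3, hg]
        push_cast
        rfl
      rw [h2, Finset.mul_sum]
      exact Finset.sum_congr rfl fun M _ => by ring
    have h2 : ∑ K, a K * (g J - if K = J then (n : ℝ) else 0) = 0 := by
      rw [Finset.sum_congr rfl fun K _ => h1 K, Finset.sum_comm]
      refine Finset.sum_eq_zero fun M _ => ?_
      rw [← Finset.mul_sum, hdist, mul_zero]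
    simp only [mul_sub, Finset.sum_sub_distrib, mul_ite, mul_zero, Finset.sum_ite_eq',
      Finset.mem_univ, if_true] at h2
    rw [← Finset.sum_mul] at h2
    linarith
  by_cases hσ : ∑ K, a K = 0
  · intro J
    have := key J
    rw [hσ, mul_zero] at this
    exact (mul_eq_zero.1 this).resolve_left hn
  -- otherwise all coefficients have the same sign, so that each term of a vanishing sum vanishes
  exfalso
  have hgd : ∀ I K, g K * (directedDist K I : ℝ) = 0 := by
    intro I
    have h1 : ∑ K, g K * (directedDist K I : ℝ) = 0 := by
      have h2 : (∑ K, a K) * ∑ K, g K * (directedDist K I : ℝ) = 0 := by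
        rw [Finset.mul_sum]
        calc _ = ∑ K, n * (a K * (directedDist K I : ℝ)) :=
              Finset.sum_congr rfl fun K _ => by
                rw [← mul_assoc (n : ℝ), key K]
                ring
          _ = 0 := by rw [← Finset.mul_sum, hdist, mul_zero]
      exact (mul_eq_zero.1 h2).resolve_left hσ
    intro K
    exact (Finset.sum_eq_zero_iff_of_nonneg fun K _ =>
      mul_nonneg (hg0 K) (Nat.cast_nonneg _)).1 h1 K (Finset.mem_univ K)
  obtain ⟨K, hK⟩ : ∃ K, g K ≠ 0 := by
    by_contra! hcon
    apply hσ
    refine Finset.sum_eq_zero fun K _ => ?_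
    have := key K
    rw [hcon K, zero_mul] at this
    exact (mul_eq_zero.1 this).resolve_left hn
  have hKI : ∀ I, K = I := fun I => by
    have := (mul_eq_zero.1 (hgd I K)).resolve_left hK
    exact (directedDist_eq_zero_iff (by omega)).1 (by exact_mod_cast this)
  have h1 := (hKI (intervalSubset k n 0 (by omega))).symm.trans
    (hKI (intervalSubset k n 1 (by omega)))
  have h2 := congrArg (fun J : KSubset k n => (J.elt ⟨0, hk⟩ : ℕ)) h1
  simp only [elt_intervalSubset] at h2
  omega

/-! ### The map `Ψ` -/

/-- The subset `{0, …, i - 1} ∪ {a, …, a + k - i - 1}`. -/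
def twoIntervals (k n i a : ℕ) (h : i ≤ a ∧ a + (k - i) ≤ n) : KSubset k n :=
  KSubset.mk' (fun s : Fin k => if (s : ℕ) < i then (s : ℕ) else a + (s - i))
    (fun s t (hst : (s : ℕ) < t) => by dsimp only; split_ifs <;> omega)
    fun s => by split_ifs <;> omega

theorem elt_twoIntervals {k n i a : ℕ} (h : i ≤ a ∧ a + (k - i) ≤ n) (s : Fin k) :
    ((twoIntervals k n i a h).elt s : ℕ) = if (s : ℕ) < i then (s : ℕ) else a + (s - i) :=
  KSubset.elt_mk' _ _ _ s

theorem mem_twoIntervals {k n i a : ℕ} (h : i ≤ a ∧ a + (k - i) ≤ n) (hi : i ≤ k) (x : Fin n) :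
    x ∈ (twoIntervals k n i a h).1 ↔ (x : ℕ) < i ∨ (a ≤ x ∧ (x : ℕ) < a + (k - i)) := by
  rw [KSubset.mem_iff]
  constructor
  · rintro ⟨s, rfl⟩
    rw [elt_twoIntervals]
    split_ifs <;> omega
  · rintro (hx | hx)
    · refine ⟨⟨x, by omega⟩, Fin.ext ?_⟩
      rw [elt_twoIntervals, if_pos hx]
    · refine ⟨⟨x - a + i, by omega⟩, Fin.ext ?_⟩
      rw [elt_twoIntervals, if_neg (by simp)]
      simp only
      omega

theorem countBelow_twoIntervals {k n i a : ℕ} (h : i ≤ a ∧ a + (k - i) ≤ n) (hi : i ≤ k) {x : ℕ}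
    (hx : x ≤ n) : countBelow (twoIntervals k n i a h) x = min x i + min (x - a) (k - i) := by
  induction x with
  | zero => simp [countBelow_zero]
  | succ x ih =>
    have h1 := countBelow_succ (twoIntervals k n i a h) ⟨x, by omega⟩
    simp only [mem_twoIntervals h hi] at h1
    rw [h1, ih (by omega)]
    split_ifs <;> omega

/-- The value of `𝔥_J` at a union of two intervals: up to an element of the lineality space and a
constant, it is the excess over `i` (or `0`) of the number of elements of `J` below `a`. -/
theorem planarBasis_twoIntervals {k n i a : ℕ} (hn : 0 < n) (h : i ≤ a ∧ a + (k - i) ≤ n)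
    (hi : i ≤ k) (J : KSubset k n) :
    planarBasis J (twoIntervals k n i a h) =
      1 / (n : ℝ) * ∑ j : Fin n, ((countBelow (twoIntervals k n i a h) (j + 1) : ℝ) -
        countBelow J (j + 1)) + ((countBelow J a - i : ℕ) : ℝ) := by
  have hn' : (n : ℝ) ≠ 0 := by exact_mod_cast hn.ne'
  have hk : countBelow J n = k := countBelow_eq J
  have hbound := fun x (hx : x ≤ n) => countBelow_twoIntervals h hi hx
  have hd : (directedDist J (twoIntervals k n i a h) : ℤ) =
      ∑ j : Fin n, ((countBelow (twoIntervals k n i a h) (j + 1) : ℤ) -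
        countBelow J (j + 1) + (countBelow J a - i : ℕ)) := by
    obtain ⟨i₀, hi₀⟩ : ∃ j : Fin n, (countBelow (twoIntervals k n i a h) (j + 1) : ℤ) -
        countBelow J (j + 1) + (countBelow J a - i : ℕ) = 0 := by
      rcases Nat.lt_or_ge i (countBelow J a) with h1 | h1
      · have ha : 0 < a := by
          by_contra h2
          rw [show a = 0 by omega, countBelow_zero] at h1
          omega
        refine ⟨⟨a - 1, by omega⟩, ?_⟩
        simp only [Nat.sub_add_cancel ha]
        rw [hbound a (by omega)]
        omega
      · refine ⟨⟨n - 1, by omega⟩, ?_⟩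
        simp only [Nat.sub_add_cancel hn]
        rw [countBelow_eq, countBelow_eq]
        omega
    refine directedDist_eq ((isHeight_countBelow J _).add_const _) (fun j => ?_) hi₀
    rw [hbound (j + 1) (by omega)]
    have h0 := (countBelow_le_add J (Nat.zero_le (j + 1)) (by omega)).2
    rw [countBelow_zero] at h0
    have h2 := (countBelow_le_add J (show (j : ℕ) + 1 ≤ n by omega) le_rfl).1
    rcases Nat.le_total (j + 1) a with h3 | h3
    · have h4 := (countBelow_le_add J h3 (by omega)).1
      omega
    · have h4 := (countBelow_le_add J h3 (by omega)).2
      omega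
  have hd' : (directedDist J (twoIntervals k n i a h) : ℝ) =
      ∑ j : Fin n, ((countBelow (twoIntervals k n i a h) (j + 1) : ℝ) -
        countBelow J (j + 1) + (countBelow J a - i : ℕ)) := by
    have := congrArg (Int.cast : ℤ → ℝ) hd
    push_cast at this
    exact this
  rw [planarBasis, hd', Finset.sum_add_distrib, mul_add]
  congr 1
  rw [Finset.sum_const, Finset.card_univ, Fintype.card_fin, nsmul_eq_mul]
  field_simp

/-- The tropicalization of the formula that expresses the parameters `x_{i,s}` of the positive
parametrization as ratios of Plücker coordinates. It represents the map `Ψ`. -/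
def psiRepr (k n : ℕ) : (KSubset k n → ℝ) →ₗ[ℝ] Fin (k - 1) → Fin (n - k) → ℝ where
  toFun π i s := π (twoIntervals k n i (s + i + 1) (by omega)) +
    π (twoIntervals k n (i + 2) (s + i + 2) (by omega)) -
    π (twoIntervals k n (i + 1) (s + i + 1) (by omega)) -
    π (twoIntervals k n (i + 1) (s + i + 2) (by omega))
  map_add' π π' := by
    funext i s
    simp only [Pi.add_apply]
    ring
  map_smul' c π := by
    funext i s
    simp only [Pi.smul_apply, smul_eq_mul, RingHom.id_apply]
    ring

theorem psiRepr_apply {k n : ℕ} (π : KSubset k n → ℝ) (i : Fin (k - 1)) (s : Fin (n - k)) :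
    psiRepr k n π i s = π (twoIntervals k n i (s + i + 1) (by omega)) +
    π (twoIntervals k n (i + 2) (s + i + 2) (by omega)) -
    π (twoIntervals k n (i + 1) (s + i + 1) (by omega)) -
    π (twoIntervals k n (i + 1) (s + i + 2) (by omega)) := rfl

theorem psiRepr_indicator {k n : ℕ} (x : Fin n) (i : Fin (k - 1)) (s : Fin (n - k)) :
    psiRepr k n (fun I => if x ∈ I.1 then (1 : ℝ) else 0) i s =
      (if (x : ℕ) = i + 1 then 1 else 0) - if (x : ℕ) = i then 1 else 0 := by
  rw [psiRepr_apply]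
  simp only [mem_twoIntervals _ (show (i : ℕ) ≤ k by omega),
    mem_twoIntervals _ (show (i : ℕ) + 1 ≤ k by omega),
    mem_twoIntervals _ (show (i : ℕ) + 2 ≤ k by omega)]
  have key : ∀ (P : Prop) [Decidable P], (if P then (1 : ℝ) else 0) =
      ((if P then (1 : ℤ) else 0 : ℤ) : ℝ) := fun P _ => by split_ifs <;> simp
  simp only [key]
  norm_cast
  split_ifs <;> first | rfl | omega

theorem psiRepr_mem_ker {k n : ℕ} {π : KSubset k n → ℝ} (h : π ∈ lineality k n) :
    (toTropSpace (psiRepr k n π) : TropSpace k n) = 0 := by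
  have : lineality k n ≤ LinearMap.ker (toTropSpaceL k n ∘ₗ psiRepr k n) := by
    rw [lineality, Submodule.span_le]
    rintro _ ⟨x, rfl⟩
    rw [SetLike.mem_coe, LinearMap.mem_ker, LinearMap.comp_apply, toTropSpaceL_apply,
      show (0 : TropSpace k n) = toTropSpace 0 from rfl, toTropSpace_eq_iff]
    refine fun i => ⟨(if (x : ℕ) = i + 1 then 1 else 0) - if (x : ℕ) = i then 1 else 0,
      fun s => ?_⟩
    rw [psiRepr_indicator, Pi.zero_apply, Pi.zero_apply, zero_add]
  exact this h

theorem countBelow_eq_sum {k n : ℕ} (I : KSubset k n) (x : ℕ) :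
    (countBelow I x : ℝ) =
      ∑ z : Fin n, if (z : ℕ) < x then (if z ∈ I.1 then (1 : ℝ) else 0) else 0 := by
  rw [countBelow, Finset.card_filter, Nat.cast_sum, ← Finset.sum_subset (Finset.subset_univ I.1)]
  · refine Finset.sum_congr rfl fun z hz => ?_
    rw [if_pos hz]
    push_cast
    rfl
  · intro z _ hz
    simp [hz]

theorem countBelow_mem_lineality {k n : ℕ} (x : ℕ) :
    (fun I : KSubset k n => (countBelow I x : ℝ)) ∈ lineality k n := by
  have : (fun I : KSubset k n => (countBelow I x : ℝ)) = ∑ z : Fin n,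
      (if (z : ℕ) < x then (1 : ℝ) else 0) •
        fun I : KSubset k n => if z ∈ I.1 then (1 : ℝ) else 0 := by
    funext I
    rw [countBelow_eq_sum, Finset.sum_apply]
    refine Finset.sum_congr rfl fun z _ => ?_
    simp only [Pi.smul_apply, smul_eq_mul]
    split_ifs <;> simp
  rw [this]
  exact Submodule.sum_mem _ fun z _ => Submodule.smul_mem _ _ (Submodule.subset_span ⟨z, rfl⟩)

theorem const_mem_lineality {k n : ℕ} (hk : 0 < k) (c : ℝ) :
    (fun _ : KSubset k n => c) ∈ lineality k n := by
  have hk' : (k : ℝ) ≠ 0 := by exact_mod_cast hk.ne'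
  have : (fun _ : KSubset k n => c) = (c / k) • fun I : KSubset k n => (countBelow I n : ℝ) := by
    funext I
    rw [Pi.smul_apply, countBelow_eq, smul_eq_mul]
    field_simp
  rw [this]
  exact Submodule.smul_mem _ _ (countBelow_mem_lineality n)

theorem toTropSpace_psiRepr_planarBasis {k n : ℕ} (hk : 0 < k) (hkn : k < n) (J : KSubset k n) :
    toTropSpace (psiRepr k n (planarBasis J)) = tVec J := by
  have hL : (fun I : KSubset k n => 1 / (n : ℝ) * ∑ j : Fin n, ((countBelow I (j + 1) : ℝ) -
      countBelow J (j + 1))) ∈ lineality k n := by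
    have : (fun I : KSubset k n => 1 / (n : ℝ) * ∑ j : Fin n, ((countBelow I (j + 1) : ℝ) -
        countBelow J (j + 1))) = (1 / (n : ℝ)) • ∑ j : Fin n,
        ((fun I : KSubset k n => (countBelow I (j + 1) : ℝ)) -
          fun _ => (countBelow J (j + 1) : ℝ)) := by
      funext I
      simp
    rw [this]
    exact Submodule.smul_mem _ _ (Submodule.sum_mem _ fun j _ =>
      Submodule.sub_mem _ (countBelow_mem_lineality _) (const_mem_lineality hk _))
  have h0 := psiRepr_mem_ker hL
  rw [tVec_eq]
  have h1 : psiRepr k n (planarBasis J) = psiRepr k n (fun I : KSubset k n => 1 / (n : ℝ) *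
      ∑ j : Fin n, ((countBelow I (j + 1) : ℝ) - countBelow J (j + 1))) + tRepr J := by
    funext i s
    rw [Pi.add_apply, Pi.add_apply, psiRepr_apply, psiRepr_apply,
      planarBasis_twoIntervals (by omega) _ (by omega),
      planarBasis_twoIntervals (by omega) _ (by omega),
      planarBasis_twoIntervals (by omega) _ (by omega),
      planarBasis_twoIntervals (by omega) _ (by omega), tRepr]
    have e1 := elt_lt_iff J ⟨i, by omega⟩ (s + i + 1)
    have e2 := elt_lt_iff J ⟨i + 1, by omega⟩ (s + i + 2)
    have e3 := countBelow_le_add J (show (s : ℕ) + i + 1 ≤ s + i + 2 by omega) (by omega)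
    simp only at e1 e2
    have key : ((countBelow J (s + i + 1) - i : ℕ) : ℝ) +
        ((countBelow J (s + i + 2) - (i + 2) : ℕ) : ℝ) -
        ((countBelow J (s + i + 1) - (i + 1) : ℕ) : ℝ) -
        ((countBelow J (s + i + 2) - (i + 1) : ℕ) : ℝ) =
        (if (J.elt ⟨i, by omega⟩ : ℕ) ≤ i + s then 1 else 0) -
          if (J.elt ⟨i + 1, by omega⟩ : ℕ) ≤ i + 1 + s then 1 else 0 := by
      have hint : ((countBelow J (s + i + 1) - i : ℕ) : ℤ) +
          ((countBelow J (s + i + 2) - (i + 2) : ℕ) : ℤ) -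
          ((countBelow J (s + i + 1) - (i + 1) : ℕ) : ℤ) -
          ((countBelow J (s + i + 2) - (i + 1) : ℕ) : ℤ) =
          (if (J.elt ⟨i, by omega⟩ : ℕ) ≤ i + s then 1 else 0) -
          if (J.elt ⟨i + 1, by omega⟩ : ℕ) ≤ i + 1 + s then 1 else 0 := by
        split_ifs <;> omega
      exact_mod_cast hint
    rw [← key]
    ring
  rw [h1, ← toTropSpaceL_apply, map_add, toTropSpaceL_apply, toTropSpaceL_apply, h0, zero_add]

/-- The linear map `Ψ` on the quotient by the lineality space. -/
def psi (k n : ℕ) : ((KSubset k n → ℝ) ⧸ lineality k n) →ₗ[ℝ] TropSpace k n :=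
  (lineality k n).liftQ (toTropSpaceL k n ∘ₗ psiRepr k n) fun _ hπ => psiRepr_mem_ker hπ

theorem psi_mkQ {k n : ℕ} (π : KSubset k n → ℝ) :
    psi k n ((lineality k n).mkQ π) = toTropSpace (psiRepr k n π) := rfl

/-- The basis of planar basis elements. -/
theorem exists_planarBasis_basis {k n : ℕ} (hk : 0 < k) (hkn : k < n) :
    ∃ b : Module.Basis (KSubset k n) ℝ (KSubset k n → ℝ), (∀ J, b J = planarBasis J) ∧
      psi k n ∘ₗ (lineality k n).mkQ = b.constr ℝ (tVec (k := k) (n := n)) := by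
  have : Nonempty (KSubset k n) := ⟨intervalSubset k n 0 (by omega)⟩
  let b := basisOfLinearIndependentOfCardEqFinrank (linearIndependent_planarBasis hk hkn)
    (by simp)
  have hb : ∀ J, b J = planarBasis J := fun J => by simp [b]
  refine ⟨b, hb, b.ext fun J => ?_⟩
  rw [Module.Basis.constr_basis, LinearMap.comp_apply, hb, psi_mkQ,
    toTropSpace_psiRepr_planarBasis hk hkn]

/-! ### Minors of web matrices -/

/-- The minor of a matrix with `l + 1` rows in the columns `f 0, …, f l`. -/
def colMinor {R : Type*} [CommRing R] (l : ℕ) (V : ℕ → ℕ → R) (f : Fin (l + 1) → ℕ) : R :=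
  (Matrix.of fun r s : Fin (l + 1) => V r (f s)).det

/-- The possible `s`-th columns in the expansion of the minor `f`: the columns `c ≤ l` of the
identity matrix stay, the later ones are replaced by a column in the gap to their successor. -/
def stepRange {l : ℕ} (f : Fin (l + 2) → ℕ) (s : Fin (l + 1)) : Finset ℕ :=
  if f s.castSucc ≤ l then {f s.castSucc} else Finset.Ico (f s.castSucc) (f s.succ)

theorem sum_mul_ite_sign {R : Type*} [CommRing R] (l : ℕ) (r : Fin (l + 2)) :
    (-1 : R) ^ (l + 1 + (r : ℕ)) *
      ∏ s : Fin (l + 1), (if s.castSucc < r then (1 : R) else -1) = 1 := by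
  have h1 : ∏ s : Fin (l + 1), (if s.castSucc < r then (1 : R) else -1) =
      ∏ s ∈ Finset.range (l + 1), (if s < (r : ℕ) then (1 : R) else -1) := by
    rw [Finset.prod_range]
    rfl
  have h2 : (Finset.range (l + 1)).filter (fun s => ¬ s < (r : ℕ)) = Finset.Ico (r : ℕ) (l + 1) := by
    ext s
    simp only [Finset.mem_filter, Finset.mem_range, Finset.mem_Ico]
    omega
  rw [h1, Finset.prod_ite, Finset.prod_const_one, one_mul, Finset.prod_const, h2, Nat.card_Ico,
    ← pow_add, show l + 1 + (r : ℕ) + (l + 1 - r) = 2 * (l + 1) by omega, pow_mul]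
  simp

theorem det_sum_smul_col {R : Type*} [CommRing R] {l : ℕ} (V : ℕ → ℕ → R) (wt : ℕ → R)
    (S : Fin (l + 1) → Finset ℕ) :
    (Matrix.of fun r s : Fin (l + 1) => ∑ c ∈ S s, wt c * V r c).det =
      ∑ g ∈ Fintype.piFinset S, (∏ s, wt (g s)) * colMinor l V g := by
  rw [← Matrix.det_transpose]
  have h := MultilinearMap.map_sum_finset
    (Matrix.detRowAlternating : (Fin (l + 1) → R) [⋀^Fin (l + 1)]→ₗ[R] R).toMultilinearMap
    (fun (_ : Fin (l + 1)) (c : ℕ) (r : Fin (l + 1)) => wt c * V r c) S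
  have h1 : (fun s : Fin (l + 1) => ∑ c ∈ S s, fun r : Fin (l + 1) => wt c * V r c) =
      (Matrix.of fun r s : Fin (l + 1) => ∑ c ∈ S s, wt c * V r c).transpose := by
    funext s r
    simp [Finset.sum_apply]
  rw [h1] at h
  refine h.trans (Finset.sum_congr rfl fun g _ => ?_)
  have h2 := Matrix.det_mul_column (fun s => wt (g s))
    (Matrix.of fun s r : Fin (l + 1) => V r (g s))
  rw [colMinor, ← Matrix.det_transpose (Matrix.of fun r s : Fin (l + 1) => V r (g s))]
  exact h2

/-- Expansion of a minor with `l + 2` rows into minors with `l + 1` rows: if the bottom row consists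
of ones, subtracting consecutive columns leaves a single entry in it. -/
theorem colMinor_succ {R : Type*} [CommRing R] {l N : ℕ} {V V' : ℕ → ℕ → R} {ξ : ℕ → R}
    (hV : ∀ r ≤ l + 1, ∀ c ≤ l, V r c = if r = c then 1 else 0)
    (hV' : ∀ r ≤ l, ∀ c ≤ l, V' r c = if r = c then 1 else 0)
    (hbot : ∀ c, l + 1 ≤ c → c < N → V (l + 1) c = 1)
    (hdiff : ∀ r ≤ l, ∀ c, l + 1 ≤ c → c + 1 < N → V r c - V r (c + 1) = ξ c * V' r c)
    {f : Fin (l + 2) → ℕ} (hf : StrictMono f) (hN : ∀ s, f s < N) :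
    colMinor (l + 1) V f = ∑ g ∈ Fintype.piFinset (stepRange f),
      (∏ s, if g s ≤ l then 1 else ξ (g s)) * colMinor l V' g := by
  obtain ⟨r, hr, hmin⟩ := Finset.exists_min_image
    (Finset.univ.filter fun s : Fin (l + 2) => l + 1 ≤ f s) id
    ⟨Fin.last (l + 1), by
      simp only [Finset.mem_filter, Finset.mem_univ, true_and]
      have key : ∀ s : ℕ, ∀ h : s < l + 2, s ≤ f ⟨s, h⟩ := by
        intro s
        induction s with
        | zero => exact fun _ => Nat.zero_le _
        | succ s ih =>
          intro h
          have h1 := ih (by omega)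
          have h2 : f ⟨s, by omega⟩ < f ⟨s + 1, h⟩ := hf (by simp [Fin.lt_def])
          omega
      exact key (l + 1) (by omega)⟩
  simp only [Finset.mem_filter, Finset.mem_univ, true_and, id] at hr hmin
  have hlt : ∀ s, s < r → f s ≤ l := fun s hs => by
    by_contra h
    exact absurd (hmin s (by omega)) (not_le.2 hs)
  have hge : ∀ s, r ≤ s → l + 1 ≤ f s := fun s hs => hr.trans (hf.monotone hs)
  let A : Matrix (Fin (l + 2)) (Fin (l + 2)) R := Matrix.of fun i s => V i (f s)
  let c : Fin (l + 1) → R := fun j => if j.castSucc < r then 0 else 1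
  let B : Matrix (Fin (l + 2)) (Fin (l + 2)) R := Matrix.of fun i s =>
    Fin.cases (A i 0) (fun j => A i j.succ - c j * A i j.castSucc) s
  have hAB : A.det = B.det := by
    refine Matrix.det_eq_of_forall_col_eq_smul_add_pred c (fun i => rfl) fun i j => ?_
    change A i j.succ = A i j.succ - c j * A i j.castSucc + c j * A i j.castSucc
    ring
  have hBle : ∀ i s, s ≤ r → B i s = A i s := by
    intro i s hs
    cases s using Fin.cases with
    | zero => rfl
    | succ j =>
      change A i j.succ - c j * A i j.castSucc = A i j.succ
      have h : j.castSucc < r := lt_of_lt_of_le j.castSucc_lt_succ hs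
      simp [c, h]
  have hBgt : ∀ i (j : Fin (l + 1)), r ≤ j.castSucc →
      B i j.succ = A i j.succ - A i j.castSucc := by
    intro i j hj
    change A i j.succ - c j * A i j.castSucc = A i j.succ - A i j.castSucc
    simp [c, not_lt.2 hj]
  have hBlast : ∀ s, B (Fin.last (l + 1)) s = if s = r then 1 else 0 := by
    intro s
    rcases lt_trichotomy s r with h | h | h
    · rw [hBle _ _ h.le, if_neg h.ne]
      change V (l + 1) (f s) = 0
      have := hlt s h
      rw [hV _ le_rfl _ this, if_neg (by omega)]
    · rw [hBle _ _ h.le, if_pos h]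
      exact hbot _ (hge s h.ge) (hN s)
    · rw [if_neg h.ne']
      cases s using Fin.cases with
      | zero => exact absurd h (by simp)
      | succ j =>
        have hj : r ≤ j.castSucc := Fin.le_castSucc_iff.2 h
        rw [hBgt _ _ hj]
        change V (l + 1) (f j.succ) - V (l + 1) (f j.castSucc) = 0
        rw [hbot _ (hge _ h.le) (hN _), hbot _ (hge _ hj) (hN _), sub_self]
  have htel : ∀ i ≤ l, ∀ a b, l + 1 ≤ a → a ≤ b → b < N →
      V i b - V i a = -∑ c ∈ Finset.Ico a b, ξ c * V' i c := by
    intro i hi a b ha hab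
    induction b, hab using Nat.le_induction with
    | base => simp
    | succ b hab ih =>
      intro hb
      rw [Finset.sum_Ico_succ_top hab, neg_add, ← ih (by omega), ← hdiff i hi b (by omega) hb]
      ring
  have hsub : B.submatrix (Fin.last (l + 1)).succAbove r.succAbove = Matrix.of fun i s =>
      (if s.castSucc < r then (1 : R) else -1) * (Matrix.of fun (i s : Fin (l + 1)) =>
        ∑ c ∈ stepRange f s, (if c ≤ l then 1 else ξ c) * V' i c) i s := by
    ext i s
    rw [Matrix.submatrix_apply, Fin.succAbove_last]
    simp only [Matrix.of_apply]
    by_cases hs : s.castSucc < r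
    · rw [Fin.succAbove_of_castSucc_lt _ _ hs, hBle _ _ hs.le, if_pos hs, stepRange,
        if_pos (hlt _ hs), Finset.sum_singleton, if_pos (hlt _ hs), one_mul, one_mul]
      change V i (f s.castSucc) = _
      rw [hV _ (by omega) _ (hlt _ hs), hV' _ (by omega) _ (hlt _ hs)]
    · have hs' := not_lt.1 hs
      have h1 := hge _ hs'
      rw [Fin.succAbove_of_le_castSucc _ _ hs', hBgt _ _ hs', if_neg hs, stepRange,
        if_neg (by omega)]
      change V i (f s.succ) - V i (f s.castSucc) = _
      rw [htel i (by omega) _ _ h1 (hf s.castSucc_lt_succ).le (hN _), neg_one_mul]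
      congr 1
      refine Finset.sum_congr rfl fun c hc => ?_
      rw [if_neg]
      have := (Finset.mem_Ico.1 hc).1
      omega
  change A.det = _
  rw [hAB, Matrix.det_succ_row B (Fin.last (l + 1)), Finset.sum_eq_single r]
  · rw [hBlast, if_pos rfl, mul_one, hsub, Matrix.det_mul_row, ← mul_assoc, Fin.val_last,
      sum_mul_ite_sign, one_mul]
    exact det_sum_smul_col V' (fun c => if c ≤ l then 1 else ξ c) _
  · intro s _ hs
    rw [hBlast, if_neg hs]
    ring
  · simp

/-- The matrix with `l + 1` rows attached to parameters `x i t`, `i < l`. For `c ≤ l` its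
columns are those of the identity matrix, its bottom row is `1` from column `l` on, and the
differences of consecutive later columns are multiples of columns of the matrix with `l` rows. -/
def web {R : Type*} [CommRing R] (x : ℕ → ℕ → R) : ℕ → ℕ → ℕ → R
  | 0, _, _ => 1
  | l + 1, r, c => if c ≤ l then (if r = c then 1 else 0) else if r = l + 1 then 1 else
      -∑ c' ∈ Finset.Ico (l + 1) c, x l (c' - (l + 1)) * web x l r c'

theorem web_of_le {R : Type*} [CommRing R] (x : ℕ → ℕ → R) (l : ℕ) {r c : ℕ} (hr : r ≤ l)
    (hc : c ≤ l) : web x l r c = if r = c then 1 else 0 := by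
  cases l with
  | zero => rw [web, if_pos (by omega)]
  | succ l =>
    rw [web]
    rcases Nat.lt_or_ge l c with h | h
    · obtain rfl : c = l + 1 := by omega
      rw [if_neg (by omega)]
      split_ifs <;> simp
    · rw [if_pos h]

theorem web_bottom {R : Type*} [CommRing R] (x : ℕ → ℕ → R) (l : ℕ) {c : ℕ} (hc : l + 1 ≤ c) :
    web x (l + 1) (l + 1) c = 1 := by
  rw [web, if_neg (by omega), if_pos rfl]

theorem web_sub {R : Type*} [CommRing R] (x : ℕ → ℕ → R) (l : ℕ) {r c : ℕ} (hr : r ≤ l)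
    (hc : l + 1 ≤ c) :
    web x (l + 1) r c - web x (l + 1) r (c + 1) = x l (c - (l + 1)) * web x l r c := by
  rw [web, web, if_neg (by omega), if_neg (by omega), if_neg (by omega), if_neg (by omega),
    Finset.sum_Ico_succ_top hc]
  ring

/-- The minors of the web matrix. -/
def webMinor {R : Type*} [CommRing R] (x : ℕ → ℕ → R) (l : ℕ) (f : Fin (l + 1) → ℕ) : R :=
  colMinor l (web x l) f

theorem webMinor_zero {R : Type*} [CommRing R] (x : ℕ → ℕ → R) (f : Fin 1 → ℕ) :
    webMinor x 0 f = 1 := by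
  simp [webMinor, colMinor, web]

/-- The weight of column `c` in the expansion of a minor of the web matrix with `l + 2` rows. -/
def webWeight {R : Type*} [CommRing R] (x : ℕ → ℕ → R) (l c : ℕ) : R :=
  if c ≤ l then 1 else x l (c - (l + 1))

theorem webMinor_succ {R : Type*} [CommRing R] (x : ℕ → ℕ → R) {l : ℕ} {f : Fin (l + 2) → ℕ}
    (hf : StrictMono f) : webMinor x (l + 1) f = ∑ g ∈ Fintype.piFinset (stepRange f),
      (∏ s, webWeight x l (g s)) * webMinor x l g :=
  colMinor_succ (N := f (Fin.last _) + 1) (ξ := fun c => x l (c - (l + 1)))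
    (fun r hr c hc => web_of_le x (l + 1) hr (by omega))
    (fun r hr c hc => web_of_le x l hr hc) (fun c hc _ => web_bottom x l hc)
    (fun r hr c hc _ => web_sub x l hr hc) hf
    (fun s => Nat.lt_succ_of_le (hf.monotone (Fin.le_last s)))

theorem stepRange_nonempty {l : ℕ} {f : Fin (l + 2) → ℕ} (hf : StrictMono f) (s : Fin (l + 1)) :
    (stepRange f s).Nonempty := by
  rw [stepRange]
  split_ifs
  · exact Finset.singleton_nonempty _
  · exact Finset.nonempty_Ico.2 (hf s.castSucc_lt_succ)

theorem le_and_lt_of_mem_stepRange {l : ℕ} {f : Fin (l + 2) → ℕ} (hf : StrictMono f)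
    {s : Fin (l + 1)} {c : ℕ} (hc : c ∈ stepRange f s) :
    f s.castSucc ≤ c ∧ c < f s.succ ∧ (f s.castSucc ≤ l → c = f s.castSucc) := by
  have h := hf s.castSucc_lt_succ
  rw [stepRange] at hc
  split_ifs at hc with h1
  · rw [Finset.mem_singleton] at hc
    omega
  · rw [Finset.mem_Ico] at hc
    omega

theorem strictMono_of_mem_stepRange {l : ℕ} {f : Fin (l + 2) → ℕ} (hf : StrictMono f)
    {g : Fin (l + 1) → ℕ} (hg : g ∈ Fintype.piFinset (stepRange f)) : StrictMono g := by
  rw [Fintype.mem_piFinset] at hg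
  intro s t hst
  have h1 := le_and_lt_of_mem_stepRange hf (hg s)
  have h2 := le_and_lt_of_mem_stepRange hf (hg t)
  have h3 : f s.succ ≤ f t.castSucc := hf.monotone (by
    rw [Fin.le_def]
    exact hst)
  omega

/-- Minors of web matrices are subtraction-free in the parameters. -/
theorem webMinor_induction {R : Type*} [CommRing R] {P : R → Prop} (h1 : P 1)
    (hadd : ∀ a b, P a → P b → P (a + b)) (hmul : ∀ a b, P a → P b → P (a * b))
    {x : ℕ → ℕ → R} (l : ℕ) (hx : ∀ i < l, ∀ t, P (x i t)) {f : Fin (l + 1) → ℕ}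
    (hf : StrictMono f) : P (webMinor x l f) := by
  induction l with
  | zero => rwa [webMinor_zero]
  | succ l ih =>
    rw [webMinor_succ x hf]
    refine Finset.sum_induction_nonempty _ _ hadd
      (Fintype.piFinset_nonempty.2 (stepRange_nonempty hf)) fun g hg => ?_
    refine hmul _ _ (Finset.prod_induction _ _ hmul h1 fun s _ => ?_)
      (ih (fun i hi => hx i (by omega)) (strictMono_of_mem_stepRange hf hg))
    rw [webWeight]
    split_ifs
    · exact h1
    · exact hx l (by omega) _

/-- The sequence `0, …, i - 1, a, a + 1, …`. -/
def twoSeq (i a s : ℕ) : ℕ := if s < i then s else a + (s - i)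

theorem twoSeq_strictMono {i a : ℕ} (h : i ≤ a) (l : ℕ) :
    StrictMono fun s : Fin l => twoSeq i a s := by
  intro s t hst
  have : (s : ℕ) < t := hst
  simp only [twoSeq]
  split_ifs <;> omega

theorem piFinset_stepRange_twoSeq (i a l : ℕ) :
    Fintype.piFinset (stepRange fun s : Fin (l + 2) => twoSeq i a s) =
      {fun s : Fin (l + 1) => twoSeq i a s} := by
  have h1 : (stepRange fun s : Fin (l + 2) => twoSeq i a s) =
      fun s : Fin (l + 1) => {twoSeq i a s} := by
    funext s
    rw [stepRange]
    simp only [Fin.val_castSucc, Fin.val_succ]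
    split_ifs with h1
    · rfl
    · have : twoSeq i a (s + 1) = twoSeq i a s + 1 := by
        have := s.2
        unfold twoSeq at *
        split_ifs at * <;> omega
      rw [this, Nat.Ico_succ_singleton]
  rw [h1, Fintype.piFinset_singleton]

theorem webMinor_twoSeq {R : Type*} [CommRing R] (x : ℕ → ℕ → R) {i a : ℕ} (l : ℕ) (h : i ≤ a) :
    webMinor x l (fun s => twoSeq i a s) =
      ∏ l' ∈ Finset.range l, ∏ s ∈ Finset.range (l' + 1), webWeight x l' (twoSeq i a s) := by
  induction l with
  | zero => rw [webMinor_zero, Finset.prod_range_zero]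
  | succ l ih =>
    rw [webMinor_succ x (twoSeq_strictMono h _), piFinset_stepRange_twoSeq i a l,
      Finset.sum_singleton, ih, Finset.prod_range_succ, mul_comm, Finset.prod_range]
    congr 1
    rw [Finset.prod_range]

/-! ### The parametrization matrix as a web matrix -/

open Classical in
/-- The sum of the monomials `x_{i,b_0} x_{i+1,b_1} ⋯` over the weakly increasing sequences
`b_0 ≤ ⋯ ≤ b_{d-1} < j`. -/
def monotoneSum {R : Type*} [CommRing R] (x : ℕ → ℕ → R) (m i d j : ℕ) : R :=
  ∑ b : Fin d → Fin m, if Monotone b ∧ ∀ s, (b s : ℕ) < j then ∏ s : Fin d, x (i + s) (b s) else 0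

theorem monotone_snoc_iff {m d : ℕ} (b : Fin d → Fin m) (t : Fin m) :
    Monotone (Fin.snoc b t : Fin (d + 1) → Fin m) ↔ Monotone b ∧ ∀ s, b s ≤ t := by
  constructor
  · intro h
    refine ⟨fun s s' hs => ?_, fun s => ?_⟩
    · have := h (show s.castSucc ≤ s'.castSucc from hs)
      simpa using this
    · have := h (Fin.le_last s.castSucc)
      simpa using this
  · rintro ⟨h1, h2⟩ s s' hs
    cases s' using Fin.lastCases with
    | last =>
      cases s using Fin.lastCases with
      | last => exact le_rfl
      | cast s => simpa using h2 s
    | cast s' =>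
      cases s using Fin.lastCases with
      | last =>
        exact absurd (lt_of_le_of_lt hs s'.castSucc_lt_last) (lt_irrefl _)
      | cast s =>
        simp only [Fin.snoc_castSucc]
        exact h1 hs

theorem monotoneSum_succ {R : Type*} [CommRing R] (x : ℕ → ℕ → R) (m i d j : ℕ) (hj : j ≤ m) :
    monotoneSum x m i (d + 1) j =
      ∑ t ∈ Finset.range j, x (i + d) t * monotoneSum x m i d (t + 1) := by
  classical
  have h1 : ∀ (t : Fin m) (b : Fin d → Fin m),
      (if Monotone (Fin.snoc b t : Fin (d + 1) → Fin m) ∧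
        ∀ s, ((Fin.snoc b t : Fin (d + 1) → Fin m) s : ℕ) < j then
        ∏ s : Fin (d + 1), x (i + s) ((Fin.snoc b t : Fin (d + 1) → Fin m) s) else 0) =
      if (t : ℕ) < j then x (i + d) t *
        (if Monotone b ∧ ∀ s, (b s : ℕ) < t + 1 then ∏ s : Fin d, x (i + s) (b s) else 0) else 0 := by
    intro t b
    have hiff : (Monotone (Fin.snoc b t : Fin (d + 1) → Fin m) ∧
        ∀ s, ((Fin.snoc b t : Fin (d + 1) → Fin m) s : ℕ) < j) ↔
        (Monotone b ∧ ∀ s, b s ≤ t) ∧ (∀ s, (b s : ℕ) < j) ∧ (t : ℕ) < j := by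
      rw [monotone_snoc_iff, Fin.forall_fin_succ']
      simp only [Fin.snoc_castSucc, Fin.snoc_last]
    rw [if_congr hiff rfl rfl, Fin.prod_univ_castSucc]
    simp only [Fin.snoc_castSucc, Fin.snoc_last, Fin.val_castSucc, Fin.val_last]
    by_cases ht : (t : ℕ) < j
    · by_cases hb : Monotone b ∧ ∀ s, (b s : ℕ) < t + 1
      · rw [if_pos ht, if_pos hb, if_pos ⟨⟨hb.1, fun s => Nat.lt_succ_iff.1 (hb.2 s)⟩,
          fun s => lt_of_lt_of_le (hb.2 s) ht, ht⟩, mul_comm]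
      · rw [if_pos ht, if_neg hb, if_neg, mul_zero]
        rintro ⟨⟨h1, h2⟩, -⟩
        exact hb ⟨h1, fun s => Nat.lt_succ_of_le (h2 s)⟩
    · rw [if_neg ht, if_neg]
      exact fun h => ht h.2.2
  rw [monotoneSum, ← (Fin.snocEquiv fun _ => Fin m).sum_comp, Fintype.sum_prod_type]
  have h2 : ∀ t : Fin m, ∑ b : Fin d → Fin m,
      (if (t : ℕ) < j then x (i + d) t *
        (if Monotone b ∧ ∀ s, (b s : ℕ) < t + 1 then ∏ s : Fin d, x (i + s) (b s) else 0) else 0) =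
      if (t : ℕ) < j then x (i + d) t * monotoneSum x m i d (t + 1) else 0 := by
    intro t
    split_ifs
    · rw [monotoneSum, Finset.mul_sum]
    · simp
  refine (Finset.sum_congr rfl fun t _ =>
    (Finset.sum_congr rfl fun b _ => h1 t b).trans (h2 t)).trans ?_
  rw [← Finset.sum_range (n := m)
    fun t => if t < j then x (i + d) t * monotoneSum x m i d (t + 1) else 0, ← Finset.sum_filter]
  refine Finset.sum_congr ?_ fun _ _ => rfl
  ext t
  simp only [Finset.mem_filter, Finset.mem_range]
  omega

theorem web_eq_monotoneSum {R : Type*} [CommRing R] (x : ℕ → ℕ → R) (m i d j : ℕ) (hj : j ≤ m) :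
    web x (i + d) i (i + d + j) = (-1) ^ d * monotoneSum x m i d j := by
  induction d generalizing j with
  | zero =>
    have h1 : monotoneSum x m i 0 j = 1 := by
      rw [monotoneSum, Fintype.sum_unique, if_pos]
      · simp
      · exact ⟨fun s => s.elim0, fun s => s.elim0⟩
    rw [h1, add_zero, pow_zero, one_mul]
    cases i with
    | zero => rfl
    | succ i =>
      rcases Nat.eq_zero_or_pos j with rfl | hj
      · rw [add_zero, web_of_le _ _ le_rfl le_rfl, if_pos rfl]
      · exact web_bottom x i (by omega)
  | succ d ih =>
    rw [← add_assoc i d 1, web, if_neg (by omega), if_neg (by omega), monotoneSum_succ _ _ _ _ _ hj,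
      Finset.sum_Ico_eq_sum_range, Nat.add_sub_cancel_left, Finset.mul_sum, ← Finset.sum_neg_distrib]
    refine Finset.sum_congr rfl fun t ht => ?_
    rw [Finset.mem_range] at ht
    rw [Nat.add_sub_cancel_left, show i + d + 1 + t = i + d + (t + 1) by omega,
      ih (t + 1) (by omega), pow_succ]
    ring

/-- The index of the variable `x_{l,t}`, with both indices truncated to their ranges. -/
def paramIndex (k n : ℕ) (hk : 2 ≤ k) (hkn : k < n) (l t : ℕ) : Fin (k - 1) × Fin (n - k) :=
  (⟨min l (k - 2), by omega⟩, ⟨min t (n - k - 1), by omega⟩)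

theorem paramIndex_val {k n : ℕ} (hk : 2 ≤ k) (hkn : k < n) (l : Fin (k - 1)) (t : Fin (n - k)) :
    paramIndex k n hk hkn l t = (l, t) := by
  refine Prod.ext (Fin.ext ?_) (Fin.ext ?_)
  · change min (l : ℕ) (k - 2) = l
    omega
  · change min (t : ℕ) (n - k - 1) = t
    omega

theorem paramMatrix_eq_web {k n : ℕ} (hk : 2 ≤ k) (hkn : k < n) (i : Fin k) (c : Fin n) :
    paramMatrix k n i c =
      web (fun l t => MvPolynomial.X (paramIndex k n hk hkn l t)) (k - 1) i c := by
  classical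
  rw [paramMatrix]
  split_ifs with h1 h2
  · rw [web_of_le _ _ (by omega) (by omega), if_pos h2.symm]
  · rw [web_of_le _ _ (by omega) (by omega), if_neg (by omega)]
  · obtain ⟨d, hd⟩ := Nat.exists_eq_add_of_le (show (i : ℕ) ≤ k - 1 by omega)
    have hweb := web_eq_monotoneSum
      (fun l t => (MvPolynomial.X (paramIndex k n hk hkn l t) : MvPolynomial _ ℤ))
      (n - k) i d (c - k + 1) (by omega)
    rw [← hd, show k - 1 + ((c : ℕ) - k + 1) = c by omega] at hweb
    rw [hweb, show k - 1 - (i : ℕ) = d by omega, monotoneSum]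
    congr 1
    let e : Fin d ≃ {l : Fin (k - 1) // (i : ℕ) ≤ l} :=
      { toFun := fun s => ⟨⟨i + s, by omega⟩, by simp⟩
        invFun := fun l => ⟨l.1 - i, by have := l.2; omega⟩
        left_inv := fun s => Fin.ext (by simp)
        right_inv := fun l => Subtype.ext (Fin.ext (by have := l.2; simp only; omega)) }
    refine Fintype.sum_equiv (Equiv.arrowCongr e.symm (Equiv.refl _)) _ _ fun b => ?_
    have hb : ∀ s, Equiv.arrowCongr e.symm (Equiv.refl (Fin (n - k))) b s = b (e s) := fun s => rfl
    have hmono : Monotone b ↔ Monotone (Equiv.arrowCongr e.symm (Equiv.refl (Fin (n - k))) b) := by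
      constructor
      · intro h s t hst
        rw [hb, hb]
        refine h ?_
        change (i : ℕ) + s ≤ i + t
        have : (s : ℕ) ≤ t := hst
        omega
      · intro h l l' hll
        have h3 := h (show e.symm l ≤ e.symm l' by
          change (l.1 : ℕ) - i ≤ l'.1 - i
          have : (l.1 : ℕ) ≤ l'.1 := hll
          omega)
        rwa [hb, hb, e.apply_symm_apply, e.apply_symm_apply] at h3
    have hbd : (∀ l, k + (b l : ℕ) ≤ c) ↔
        ∀ s, (Equiv.arrowCongr e.symm (Equiv.refl (Fin (n - k))) b s : ℕ) < c - k + 1 := by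
      rw [← e.forall_congr_right]
      refine forall_congr' fun s => ?_
      rw [hb]
      omega
    refine if_congr (and_congr hmono hbd) ?_ rfl
    rw [← e.prod_comp]
    refine Finset.prod_congr rfl fun s _ => ?_
    rw [hb]
    congr 1
    exact (paramIndex_val hk hkn (e s).1 (b (e s))).symm

theorem plucker_paramMatrix {l n : ℕ} (hk : 2 ≤ l + 1) (hkn : l + 1 < n) (J : KSubset (l + 1) n) :
    plucker (paramMatrix (l + 1) n) J =
      webMinor (fun i t => MvPolynomial.X (paramIndex (l + 1) n hk hkn i t)) l
        fun s => (J.elt s : ℕ) := by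
  rw [plucker, webMinor, colMinor]
  congr 1
  ext1 r s
  exact paramMatrix_eq_web hk hkn r (J.elt s)

theorem elt_strictMono {k n : ℕ} (J : KSubset k n) : StrictMono fun s => (J.elt s : ℕ) :=
  fun _ _ hst => J.elt.strictMono hst

/-! ### Polynomials with nonnegative coefficients -/

/-- Nonzero polynomials with nonnegative coefficients. -/
def NonnegPoly {σ : Type*} (p : MvPolynomial σ ℤ) : Prop := p ≠ 0 ∧ ∀ m, 0 ≤ p.coeff m

theorem NonnegPoly.add {σ : Type*} {p q : MvPolynomial σ ℤ} (hp : NonnegPoly p)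
    (hq : NonnegPoly q) : NonnegPoly (p + q) := by
  refine ⟨fun h => ?_, fun m => by rw [MvPolynomial.coeff_add]; exact add_nonneg (hp.2 m) (hq.2 m)⟩
  obtain ⟨m, hm⟩ := MvPolynomial.ne_zero_iff.1 hp.1
  have h1 := congrArg (MvPolynomial.coeff m) h
  rw [MvPolynomial.coeff_add, MvPolynomial.coeff_zero] at h1
  have := hp.2 m
  have := hq.2 m
  omega

theorem NonnegPoly.mul {σ : Type*} {p q : MvPolynomial σ ℤ} (hp : NonnegPoly p)
    (hq : NonnegPoly q) : NonnegPoly (p * q) := by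
  classical
  refine ⟨mul_ne_zero hp.1 hq.1, fun m => ?_⟩
  rw [MvPolynomial.coeff_mul]
  exact Finset.sum_nonneg fun x _ => mul_nonneg (hp.2 _) (hq.2 _)

theorem NonnegPoly.monomial {σ : Type*} (m : σ →₀ ℕ) :
    NonnegPoly (MvPolynomial.monomial m (1 : ℤ)) := by
  classical
  refine ⟨by simp, fun m' => ?_⟩
  rw [MvPolynomial.coeff_monomial]
  split_ifs <;> simp

theorem nonnegPoly_plucker {k n : ℕ} (hk : 2 ≤ k) (hkn : k < n) (J : KSubset k n) :
    NonnegPoly (plucker (paramMatrix k n) J) := by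
  obtain ⟨l, rfl⟩ := Nat.exists_eq_add_of_le' (show 1 ≤ k by omega)
  rw [plucker_paramMatrix hk hkn]
  exact webMinor_induction (P := NonnegPoly) (NonnegPoly.monomial 0) (fun _ _ => NonnegPoly.add)
    (fun _ _ => NonnegPoly.mul) l (fun i _ t => NonnegPoly.monomial _) (elt_strictMono J)

/-! ### Tropical evaluation -/

section TropEval

variable {σ : Type*} [Fintype σ]

theorem exists_tropEval_eq {p : MvPolynomial σ ℤ} (hp : p ≠ 0) (y : σ → ℝ) :
    ∃ m ∈ p.support, tropEval p y = ∑ v, (m v : ℝ) * y v := by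
  have : Nonempty p.support := (MvPolynomial.support_nonempty.2 hp).to_subtype
  obtain ⟨m, hm⟩ := exists_eq_ciInf_of_finite (f := fun m : p.support => ∑ v, (m.1 v : ℝ) * y v)
  exact ⟨m.1, m.2, hm.symm⟩

theorem tropEval_le {p : MvPolynomial σ ℤ} (y : σ → ℝ) {m : σ →₀ ℕ} (hm : m ∈ p.support) :
    tropEval p y ≤ ∑ v, (m v : ℝ) * y v :=
  ciInf_le (f := fun m : p.support => ∑ v, (m.1 v : ℝ) * y v) (Set.finite_range _).bddBelow ⟨m, hm⟩

theorem continuous_tropEval {p : MvPolynomial σ ℤ} (hp : p ≠ 0) :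
    Continuous fun y : σ → ℝ => tropEval p y := by
  have : Nonempty p.support := (MvPolynomial.support_nonempty.2 hp).to_subtype
  have h : (fun y : σ → ℝ => tropEval p y) = fun y =>
      (Finset.univ : Finset p.support).inf' Finset.univ_nonempty
        fun m => ∑ v, (m.1 v : ℝ) * y v := by
    funext y
    rw [Finset.inf'_univ_eq_ciInf]
    rfl
  rw [h]
  exact Continuous.finset_inf'_apply _ fun m _ => by fun_prop

/-- A polynomial that is homogeneous in groups of variables transforms by its degrees under
translations along these groups. -/
theorem tropEval_add_of_homogeneous {ι : Type*} [Fintype ι] {p : MvPolynomial σ ℤ} (hp : p ≠ 0)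
    (w : ι → σ → ℕ) (d : ι → ℕ) (hd : ∀ i, MvPolynomial.IsWeightedHomogeneous (w i) p (d i))
    (y : σ → ℝ) (c : ι → ℝ) :
    tropEval p (fun v => y v + ∑ i, c i * w i v) = tropEval p y + ∑ i, c i * d i := by
  have h : ∀ m ∈ p.support, ∑ v, (m v : ℝ) * (y v + ∑ i, c i * w i v) =
      ∑ v, (m v : ℝ) * y v + ∑ i, c i * d i := by
    intro m hm
    have h1 : ∀ i, (d i : ℝ) = ∑ v, (m v : ℝ) * w i v := by
      intro i
      rw [← hd i (MvPolynomial.mem_support_iff.1 hm), Finsupp.weight_apply,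
        Finsupp.sum_fintype _ _ (by simp)]
      simp only [smul_eq_mul, Nat.cast_sum, Nat.cast_mul]
    simp only [h1, mul_add, Finset.sum_add_distrib, Finset.mul_sum]
    rw [Finset.sum_comm]
    congr 1
    exact Finset.sum_congr rfl fun i _ => Finset.sum_congr rfl fun v _ => by ring
  obtain ⟨m, hm, hmy⟩ := exists_tropEval_eq hp y
  obtain ⟨m', hm', hmy'⟩ := exists_tropEval_eq hp fun v => y v + ∑ i, c i * w i v
  apply le_antisymm
  · rw [hmy, ← h m hm]
    exact tropEval_le _ hm
  · rw [hmy', h m' hm']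
    have := tropEval_le y hm'
    linarith

/-- Monomials with coefficient `1` and prescribed tropical evaluation at `y`. -/
def IsMonomialWithValue (y : σ → ℝ) (p : MvPolynomial σ ℤ) (a : ℝ) : Prop :=
  ∃ m : σ →₀ ℕ, p = MvPolynomial.monomial m 1 ∧ ∑ v, (m v : ℝ) * y v = a

theorem IsMonomialWithValue.tropEval_eq {y : σ → ℝ} {p : MvPolynomial σ ℤ} {a : ℝ}
    (h : IsMonomialWithValue y p a) : tropEval p y = a := by
  obtain ⟨m, rfl, rfl⟩ := h
  obtain ⟨m', hm', h'⟩ := exists_tropEval_eq (NonnegPoly.monomial m).1 y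
  rw [h']
  rw [MvPolynomial.support_monomial, if_neg one_ne_zero, Finset.mem_singleton] at hm'
  rw [hm']

theorem IsMonomialWithValue.one (y : σ → ℝ) : IsMonomialWithValue y 1 0 := ⟨0, rfl, by simp⟩

theorem IsMonomialWithValue.var [DecidableEq σ] (y : σ → ℝ) (v : σ) :
    IsMonomialWithValue y (MvPolynomial.X v) (y v) :=
  ⟨Finsupp.single v 1, rfl, by simp [Finsupp.single_apply]⟩

theorem IsMonomialWithValue.mul {y : σ → ℝ} {p q : MvPolynomial σ ℤ} {a b : ℝ}
    (hp : IsMonomialWithValue y p a) (hq : IsMonomialWithValue y q b) :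
    IsMonomialWithValue y (p * q) (a + b) := by
  obtain ⟨m, rfl, rfl⟩ := hp
  obtain ⟨m', rfl, rfl⟩ := hq
  refine ⟨m + m', by simp, ?_⟩
  simp [add_mul, Finset.sum_add_distrib]

theorem IsMonomialWithValue.prod {y : σ → ℝ} {ι : Type*} (s : Finset ι) {p : ι → MvPolynomial σ ℤ}
    {a : ι → ℝ} (h : ∀ i ∈ s, IsMonomialWithValue y (p i) (a i)) :
    IsMonomialWithValue y (∏ i ∈ s, p i) (∑ i ∈ s, a i) := by
  classical
  induction s using Finset.induction_on with
  | empty => exact IsMonomialWithValue.one y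
  | insert i s hi ih =>
    rw [Finset.prod_insert hi, Finset.sum_insert hi]
    exact (h i (Finset.mem_insert_self i s)).mul
      (ih fun j hj => h j (Finset.mem_insert_of_mem hj))

end TropEval

/-! ### The tropical parametrization -/

/-- Iterating the expansion of the minor in the columns `0, …, i - 1, a, a + 1, …` gives a sum of
weights of columns. Its mixed second difference in `i` and `a` is a single weight. -/
theorem tropSum_identity {τ : ℕ → ℕ → ℝ} (hτ : ∀ l c, c ≤ l → τ l c = 0) {i a l : ℕ}
    (hia : i + 1 ≤ a) (hil : i < l) :
    (∑ l' ∈ Finset.range l, ∑ s ∈ Finset.range (l' + 1), τ l' (twoSeq i a s)) +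
    (∑ l' ∈ Finset.range l, ∑ s ∈ Finset.range (l' + 1), τ l' (twoSeq (i + 2) (a + 1) s)) -
    (∑ l' ∈ Finset.range l, ∑ s ∈ Finset.range (l' + 1), τ l' (twoSeq (i + 1) a s)) -
    (∑ l' ∈ Finset.range l, ∑ s ∈ Finset.range (l' + 1), τ l' (twoSeq (i + 1) (a + 1) s)) =
    τ i a := by
  have h1 : ∀ l' s, s ≤ l' → τ l' (twoSeq i a s) + τ l' (twoSeq (i + 2) (a + 1) s) -
      τ l' (twoSeq (i + 1) a s) - τ l' (twoSeq (i + 1) (a + 1) s) =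
      (if s = i then τ l' a else 0) - if s = i + 1 then τ l' a else 0 := by
    intro l' s hs
    rcases lt_trichotomy s i with h | rfl | h
    · simp only [twoSeq, if_pos h, if_pos (show s < i + 1 by omega),
        if_pos (show s < i + 2 by omega), if_neg (show s ≠ i by omega),
        if_neg (show s ≠ i + 1 by omega)]
      ring
    · simp only [twoSeq, if_neg (lt_irrefl s), if_pos (show s < s + 1 by omega),
        if_pos (show s < s + 2 by omega),
        if_neg (show s ≠ s + 1 by omega), Nat.sub_self, add_zero, hτ l' s hs]
      simp
    · obtain ⟨d, rfl⟩ := Nat.exists_eq_add_of_lt h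
      rcases Nat.eq_zero_or_pos d with rfl | hd
      · simp only [twoSeq, add_zero]
        rw [if_neg (by omega), if_pos (by omega), if_neg (by omega), if_neg (by omega),
          if_neg (by omega), hτ l' (i + 1) (by omega),
          show a + (i + 1 - i) = a + 1 by omega, show a + (i + 1 - (i + 1)) = a by omega,
          show a + 1 + (i + 1 - (i + 1)) = a + 1 by omega]
        simp
      · simp only [twoSeq]
        rw [if_neg (by omega), if_neg (by omega), if_neg (by omega), if_neg (by omega),
          if_neg (by omega), if_neg (by omega),
          show a + 1 + (i + d + 1 - (i + 2)) = a + (i + d + 1 - (i + 1)) by omega,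
          show a + 1 + (i + d + 1 - (i + 1)) = a + (i + d + 1 - i) by omega]
        ring
  rw [← Finset.sum_add_distrib, ← Finset.sum_sub_distrib, ← Finset.sum_sub_distrib]
  have h2 : ∀ l' ∈ Finset.range l, (∑ s ∈ Finset.range (l' + 1), τ l' (twoSeq i a s)) +
      (∑ s ∈ Finset.range (l' + 1), τ l' (twoSeq (i + 2) (a + 1) s)) -
      (∑ s ∈ Finset.range (l' + 1), τ l' (twoSeq (i + 1) a s)) -
      (∑ s ∈ Finset.range (l' + 1), τ l' (twoSeq (i + 1) (a + 1) s)) =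
      if l' = i then τ i a else 0 := by
    intro l' _
    rw [← Finset.sum_add_distrib, ← Finset.sum_sub_distrib, ← Finset.sum_sub_distrib,
      Finset.sum_congr rfl fun s hs => h1 l' s (by have := Finset.mem_range.1 hs; omega),
      Finset.sum_sub_distrib, Finset.sum_ite_eq', Finset.sum_ite_eq']
    simp only [Finset.mem_range]
    rcases lt_trichotomy l' i with h | rfl | h
    · rw [if_neg (by omega), if_neg (by omega), if_neg (by omega), sub_zero]
    · rw [if_pos (by omega), if_neg (by omega), if_pos rfl, sub_zero]
    · rw [if_pos (by omega), if_pos (by omega), if_neg (by omega), sub_self]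
  rw [Finset.sum_congr rfl h2, Finset.sum_ite_eq', if_pos (Finset.mem_range.2 hil)]

theorem twoIntervals_elt_eq {k n i a : ℕ} (h : i ≤ a ∧ a + (k - i) ≤ n) :
    (fun s => ((twoIntervals k n i a h).elt s : ℕ)) = fun s : Fin k => twoSeq i a s :=
  funext fun s => elt_twoIntervals h s

/-- The value of the weight of column `c` in the expansion of minors with `l + 2` rows. -/
def tropWeight {k n : ℕ} (hk : 2 ≤ k) (hkn : k < n) (y : Fin (k - 1) → Fin (n - k) → ℝ)
    (l c : ℕ) : ℝ :=
  if c ≤ l then 0 else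
    y (paramIndex k n hk hkn l (c - (l + 1))).1 (paramIndex k n hk hkn l (c - (l + 1))).2

theorem tropParam_twoIntervals {k n i a : ℕ} (hk : 2 ≤ k) (hkn : k < n)
    (h : i ≤ a ∧ a + (k - i) ≤ n) (y : Fin (k - 1) → Fin (n - k) → ℝ) :
    tropParam y (twoIntervals k n i a h) = ∑ l' ∈ Finset.range (k - 1),
      ∑ s ∈ Finset.range (l' + 1), tropWeight hk hkn y l' (twoSeq i a s) := by
  classical
  obtain ⟨l, rfl⟩ := Nat.exists_eq_add_of_le' (show 1 ≤ k by omega)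
  rw [tropParam, plucker_paramMatrix hk hkn]
  apply IsMonomialWithValue.tropEval_eq
  rw [twoIntervals_elt_eq, webMinor_twoSeq _ _ h.1]
  refine IsMonomialWithValue.prod _ fun l' _ => IsMonomialWithValue.prod _ fun s _ => ?_
  rw [webWeight, tropWeight]
  split_ifs
  · exact IsMonomialWithValue.one _
  · exact IsMonomialWithValue.var (fun v : Fin (l + 1 - 1) × Fin (n - (l + 1)) => y v.1 v.2) _

/-- The map `Ψ` recovers the tropical parameters. -/
theorem psiRepr_tropParam {k n : ℕ} (hk : 2 ≤ k) (hkn : k < n)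
    (y : Fin (k - 1) → Fin (n - k) → ℝ) : psiRepr k n (tropParam y) = y := by
  funext i s
  rw [psiRepr_apply, tropParam_twoIntervals hk hkn, tropParam_twoIntervals hk hkn,
    tropParam_twoIntervals hk hkn, tropParam_twoIntervals hk hkn]
  refine (tropSum_identity (τ := tropWeight hk hkn y) (fun l c hc => if_pos hc)
    (a := s + i + 1) (by omega) i.2).trans ?_
  rw [tropWeight, if_neg (by omega), show (s : ℕ) + i + 1 - (i + 1) = s by omega, paramIndex_val]

theorem continuous_tropParam {k n : ℕ} (hk : 2 ≤ k) (hkn : k < n) :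
    Continuous (tropParam : (Fin (k - 1) → Fin (n - k) → ℝ) → KSubset k n → ℝ) :=
  continuous_pi fun J => (continuous_tropEval (nonnegPoly_plucker hk hkn J).1).comp
    (continuous_pi fun v => (continuous_apply v.2).comp (continuous_apply v.1))

/-- The number of entries of `f` that are at most `i`. -/
def seqCount {l : ℕ} (f : Fin l → ℕ) (i : ℕ) : ℕ := ∑ s, if f s ≤ i then 1 else 0

/-- The entries at most `l` stay when passing to the next stage of the expansion of minors. -/
theorem seqCount_stepRange {l : ℕ} {f : Fin (l + 2) → ℕ} (hf : StrictMono f)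
    {g : Fin (l + 1) → ℕ} (hg : g ∈ Fintype.piFinset (stepRange f)) {i : ℕ} (hi : i ≤ l) :
    seqCount g i = seqCount f i := by
  rw [Fintype.mem_piFinset] at hg
  have hlast : l + 1 ≤ f (Fin.last (l + 1)) := by
    have key : ∀ s : ℕ, ∀ h : s < l + 2, s ≤ f ⟨s, h⟩ := by
      intro s
      induction s with
      | zero => exact fun _ => Nat.zero_le _
      | succ s ih =>
        intro h
        have h1 := ih (by omega)
        have h2 : f ⟨s, by omega⟩ < f ⟨s + 1, h⟩ := hf (by simp [Fin.lt_def])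
        omega
    exact key (l + 1) (by omega)
  rw [seqCount, seqCount, Fin.sum_univ_castSucc fun s => if f s ≤ i then 1 else 0,
    if_neg (by omega), add_zero]
  refine Finset.sum_congr rfl fun s _ => ?_
  have h1 := le_and_lt_of_mem_stepRange hf (hg s)
  refine if_congr ?_ rfl rfl
  omega

/-- Row `i` of parameters enters when minors with `i + 2` rows are expanded, with one factor for
each column `c > i`. The number of columns `c ≤ i` has not changed up to this point. -/
theorem webMinor_homogeneous {σ : Type*} {w : σ → ℕ} {i : ℕ} {x : ℕ → ℕ → MvPolynomial σ ℤ}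
    (l : ℕ) (hx : ∀ j < l, ∀ t, (x j t).IsWeightedHomogeneous w (if j = i then 1 else 0))
    {f : Fin (l + 1) → ℕ} (hf : StrictMono f) :
    (webMinor x l f).IsWeightedHomogeneous w (if i < l then i + 1 - seqCount f i else 0) := by
  induction l with
  | zero =>
    rw [webMinor_zero, if_neg (by omega)]
    exact MvPolynomial.isWeightedHomogeneous_one ℤ w
  | succ l ih =>
    rw [webMinor_succ x hf]
    refine MvPolynomial.IsWeightedHomogeneous.sum _ _ _ fun g hg => ?_
    have hwt : ∀ s, (webWeight x l (g s)).IsWeightedHomogeneous w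
        (if l = i then (if g s ≤ l then 0 else 1) else 0) := by
      intro s
      rw [webWeight]
      by_cases h : g s ≤ l
      · rw [if_pos h, if_pos h, ite_self]
        exact MvPolynomial.isWeightedHomogeneous_one ℤ w
      · rw [if_neg h, if_neg h]
        exact hx l (by omega) _
    have h := (MvPolynomial.IsWeightedHomogeneous.prod Finset.univ _ _ fun s _ => hwt s).mul
      (ih (fun j hj => hx j (by omega)) (strictMono_of_mem_stepRange hf hg))
    convert h using 1
    rcases lt_trichotomy i l with h1 | rfl | h1
    · rw [if_pos (by omega), if_pos h1, seqCount_stepRange hf hg h1.le]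
      simp [show l ≠ i by omega]
    · rw [if_pos (by omega), if_neg (lt_irrefl i), ← seqCount_stepRange hf hg le_rfl, seqCount]
      simp only [if_true, add_zero]
      have : (∑ s, if g s ≤ i then 1 else 0) + (∑ s, if g s ≤ i then 0 else 1) = i + 1 := by
        rw [← Finset.sum_add_distrib, Finset.sum_congr rfl fun s _ =>
          show (if g s ≤ i then 1 else 0) + (if g s ≤ i then 0 else 1) = 1 by split_ifs <;> rfl]
        simp
      omega
    · rw [if_neg (by omega), if_neg (by omega)]
      simp [show l ≠ i by omega]

theorem seqCount_elt {k n : ℕ} (J : KSubset k n) (i : ℕ) :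
    seqCount (fun s => (J.elt s : ℕ)) i = countBelow J (i + 1) := by
  rw [seqCount, countBelow, ← Finset.card_filter]
  have : (J.1.filter fun z : Fin n => (z : ℕ) < i + 1) =
      (Finset.univ.filter fun s : Fin k => (J.elt s : ℕ) ≤ i).map J.elt.toEmbedding := by
    ext x
    simp only [Finset.mem_filter, Finset.mem_map, Finset.mem_univ, true_and]
    rw [J.mem_iff]
    constructor
    · rintro ⟨⟨t, rfl⟩, ht⟩
      exact ⟨t, Nat.lt_succ_iff.1 ht, rfl⟩
    · rintro ⟨t, ht, rfl⟩
      exact ⟨⟨t, rfl⟩, Nat.lt_succ_of_le ht⟩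
  rw [this, Finset.card_map]

theorem homogeneous_plucker {k n : ℕ} (hk : 2 ≤ k) (hkn : k < n) (J : KSubset k n)
    (i : Fin (k - 1)) : (plucker (paramMatrix k n) J).IsWeightedHomogeneous
      (fun v : Fin (k - 1) × Fin (n - k) => if v.1 = i then 1 else 0)
      (i + 1 - countBelow J (i + 1)) := by
  obtain ⟨l, rfl⟩ := Nat.exists_eq_add_of_le' (show 1 ≤ k by omega)
  have h := webMinor_homogeneous (i := i)
    (w := fun v : Fin (l + 1 - 1) × Fin (n - (l + 1)) => if v.1 = i then 1 else 0)
    (x := fun j t => MvPolynomial.X (paramIndex (l + 1) n hk hkn j t)) l (fun j hj t => by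
      convert MvPolynomial.isWeightedHomogeneous_X ℤ _ (paramIndex (l + 1) n hk hkn j t) using 1
      refine if_congr ?_ rfl rfl
      rw [Fin.ext_iff]
      change j = i ↔ min j (l + 1 - 2) = i
      omega) (elt_strictMono J)
  rwa [if_pos (show (i : ℕ) < l from i.2), seqCount_elt, ← plucker_paramMatrix hk hkn] at h

/-- By homogeneity, adding constants to the rows of parameters does not change the image of `ρ`. -/
theorem tropParam_add {k n : ℕ} (hk : 2 ≤ k) (hkn : k < n) (y : Fin (k - 1) → Fin (n - k) → ℝ)
    (c : Fin (k - 1) → ℝ) :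
    (lineality k n).mkQ (tropParam fun i s => y i s + c i) = (lineality k n).mkQ (tropParam y) := by
  have h : ∀ J : KSubset k n, tropParam (fun i s => y i s + c i) J =
      tropParam y J + ∑ i : Fin (k - 1), c i * (i + 1 - countBelow J (i + 1)) := by
    intro J
    have h1 := tropEval_add_of_homogeneous (nonnegPoly_plucker hk hkn J).1 _ _
      (homogeneous_plucker hk hkn J) (fun v => y v.1 v.2) c
    have h2 : ∀ i : Fin (k - 1), (((i : ℕ) + 1 - countBelow J (i + 1) : ℕ) : ℝ) =
        i + 1 - countBelow J (i + 1) := by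
      intro i
      have := (countBelow_le_add J (Nat.zero_le (i + 1)) (by omega)).2
      rw [countBelow_zero] at this
      rw [Nat.cast_sub (by omega)]
      push_cast
      rfl
    simp only [h2] at h1
    simp only [tropParam]
    rw [← h1]
    congr 1
    funext v
    simp
  have h3 : (tropParam fun i s => y i s + c i) - tropParam y = ∑ i : Fin (k - 1), c i •
      ((fun _ : KSubset k n => ((i : ℕ) + 1 : ℝ)) -
        fun J : KSubset k n => (countBelow J (i + 1) : ℝ)) := by
    funext J
    rw [Pi.sub_apply, h J]
    simp
  rw [← sub_eq_zero, ← map_sub, h3]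
  refine (Submodule.Quotient.mk_eq_zero _).2 (Submodule.sum_mem _ fun i _ =>
    Submodule.smul_mem _ _ (Submodule.sub_mem _ (const_mem_lineality (by omega) _)
      (countBelow_mem_lineality _)))

/-- The map `ρ` can be computed on any representative. -/
theorem rho_toTropSpace {k n : ℕ} (hk : 2 ≤ k) (hkn : k < n) (y : Fin (k - 1) → Fin (n - k) → ℝ) :
    rho (toTropSpace y) = (lineality k n).mkQ (tropParam y) := by
  have h1 : (toTropSpace (fun l => Quotient.out ((toTropSpace y : TropSpace k n) l)) :
      TropSpace k n) = toTropSpace y := funext fun l => Quotient.out_eq _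
  rw [toTropSpace_eq_iff] at h1
  choose c hc using h1
  have h2 : (fun l => Quotient.out ((toTropSpace y : TropSpace k n) l)) =
      fun i s => y i s + c i := by
    funext i s
    exact hc i s
  change (lineality k n).mkQ
      (tropParam fun l => Quotient.out ((toTropSpace y : TropSpace k n) l)) = _
  rw [h2, tropParam_add hk hkn]

/-! ### Hahn series with positive leading coefficient -/

/-- Hahn series whose leading coefficient is real and positive. -/
def HahnPos (f : HahnSeries ℚ ℂ) : Prop := 0 < f.leadingCoeff.re ∧ f.leadingCoeff.im = 0

namespace HahnPos

variable {f g : HahnSeries ℚ ℂ}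

theorem iff_exists : HahnPos f ↔ ∃ r : ℝ, 0 < r ∧ f.leadingCoeff = r := by
  constructor
  · rintro ⟨h1, h2⟩
    exact ⟨_, h1, Complex.ext rfl h2⟩
  · rintro ⟨r, hr, h⟩
    rw [HahnPos, h]
    exact ⟨hr, rfl⟩

theorem ne_zero (hf : HahnPos f) : f ≠ 0 := by
  rintro rfl
  simp [HahnPos] at hf

theorem one : HahnPos 1 := by
  rw [HahnPos, HahnSeries.leadingCoeff_one]
  simp

theorem mul (hf : HahnPos f) (hg : HahnPos g) : HahnPos (f * g) := by
  obtain ⟨r, hr, hfr⟩ := iff_exists.1 hf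
  obtain ⟨s, hs, hgs⟩ := iff_exists.1 hg
  refine iff_exists.2 ⟨r * s, mul_pos hr hs, ?_⟩
  rw [HahnSeries.leadingCoeff_mul, hfr, hgs, Complex.ofReal_mul]

theorem inv (hf : HahnPos f) : HahnPos f⁻¹ := by
  obtain ⟨r, hr, hfr⟩ := iff_exists.1 hf
  refine iff_exists.2 ⟨r⁻¹, inv_pos.2 hr, ?_⟩
  have h := HahnSeries.leadingCoeff_mul f f⁻¹
  rw [mul_inv_cancel₀ hf.ne_zero, HahnSeries.leadingCoeff_one, hfr] at h
  rw [Complex.ofReal_inv]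
  exact eq_inv_of_mul_eq_one_right h.symm

theorem order_mul (hf : HahnPos f) (hg : HahnPos g) : (f * g).order = f.order + g.order :=
  HahnSeries.order_mul hf.ne_zero hg.ne_zero

theorem coeff_order_add (hf : HahnPos f) (hg : HahnPos g) (h : f.order ≤ g.order) :
    ∃ r : ℝ, 0 < r ∧ (f + g).coeff f.order = r := by
  obtain ⟨r, hr, hfr⟩ := iff_exists.1 hf
  obtain ⟨s, hs, hgs⟩ := iff_exists.1 hg
  rw [HahnSeries.leadingCoeff_eq] at hfr hgs
  rcases h.lt_or_eq with h | h
  · refine ⟨r, hr, ?_⟩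
    rw [HahnSeries.coeff_add, hfr, HahnSeries.coeff_eq_zero_of_lt_order h, add_zero]
  · refine ⟨r + s, add_pos hr hs, ?_⟩
    rw [HahnSeries.coeff_add, hfr, h, hgs, Complex.ofReal_add]

theorem add_of_le (hf : HahnPos f) (hg : HahnPos g) (h : f.order ≤ g.order) :
    HahnPos (f + g) ∧ (f + g).order = f.order := by
  obtain ⟨r, hr, hc⟩ := hf.coeff_order_add hg h
  have h1 : (f + g).coeff f.order ≠ 0 := by
    rw [hc]
    exact_mod_cast hr.ne'
  have h0 : f + g ≠ 0 := by
    intro h0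
    simp [h0] at h1
  have h2 : (f + g).order = f.order := by
    refine le_antisymm (HahnSeries.order_le_of_coeff_ne_zero h1) ?_
    have := HahnSeries.min_order_le_order_add h0
    rwa [min_eq_left h] at this
  refine ⟨iff_exists.2 ⟨r, hr, ?_⟩, h2⟩
  rw [HahnSeries.leadingCoeff_eq, h2, hc]

theorem add (hf : HahnPos f) (hg : HahnPos g) :
    HahnPos (f + g) ∧ (f + g).order = min f.order g.order := by
  rcases le_total f.order g.order with h | h
  · rw [min_eq_left h]
    exact hf.add_of_le hg h
  · rw [min_eq_right h, add_comm]
    exact hg.add_of_le hf h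

theorem prod {ι : Type*} (s : Finset ι) {f : ι → HahnSeries ℚ ℂ} (hf : ∀ i ∈ s, HahnPos (f i)) :
    HahnPos (∏ i ∈ s, f i) ∧ (∏ i ∈ s, f i).order = ∑ i ∈ s, (f i).order := by
  classical
  induction s using Finset.induction_on with
  | empty => simpa using one
  | insert i s hi ih =>
    obtain ⟨h1, h2⟩ := ih fun j hj => hf j (Finset.mem_insert_of_mem hj)
    have h3 := hf i (Finset.mem_insert_self i s)
    rw [Finset.prod_insert hi, Finset.sum_insert hi, ← h2]
    exact ⟨h3.mul h1, h3.order_mul h1⟩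

theorem pow (hf : HahnPos f) (m : ℕ) : HahnPos (f ^ m) := by
  induction m with
  | zero => simpa using one
  | succ m ih =>
    rw [pow_succ]
    exact ih.mul hf

theorem intCast {m : ℤ} (hm : 0 < m) :
    HahnPos (m : HahnSeries ℚ ℂ) ∧ (m : HahnSeries ℚ ℂ).order = 0 := by
  rw [← HahnSeries.single_zero_intCast]
  refine ⟨iff_exists.2 ⟨m, by exact_mod_cast hm, ?_⟩, HahnSeries.order_single ?_⟩
  · rw [HahnSeries.leadingCoeff_of_single]
    simp
  · exact_mod_cast hm.ne'

/-- There is no cancellation in sums of positive series. -/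
theorem sum {ι : Type*} {s : Finset ι} (hs : s.Nonempty) {f : ι → HahnSeries ℚ ℂ}
    (hf : ∀ i ∈ s, HahnPos (f i)) :
    HahnPos (∑ i ∈ s, f i) ∧ (∀ i ∈ s, (∑ i ∈ s, f i).order ≤ (f i).order) ∧
      ∃ i ∈ s, (∑ i ∈ s, f i).order = (f i).order := by
  classical
  induction hs using Finset.Nonempty.cons_induction with
  | singleton i => simpa using hf
  | cons i s hi hs ih =>
    obtain ⟨h1, h2, j, hj, h3⟩ := ih fun j hj => hf j (Finset.mem_cons_of_mem hj)
    obtain ⟨h4, h5⟩ := (hf i (Finset.mem_cons_self i s)).add h1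
    rw [Finset.sum_cons]
    refine ⟨h4, fun j' hj' => ?_, ?_⟩
    · rw [h5]
      rcases Finset.mem_cons.1 hj' with rfl | hj'
      · exact min_le_left _ _
      · exact (min_le_right _ _).trans (h2 j' hj')
    · rw [h5]
      rcases le_total (f i).order (∑ i ∈ s, f i).order with h | h
      · exact ⟨i, Finset.mem_cons_self i s, min_eq_left h⟩
      · exact ⟨j, Finset.mem_cons_of_mem hj, (min_eq_right h).trans h3⟩

/-- The valuation of a subtraction-free polynomial in positive series is given by its
tropicalization. -/
theorem eval₂ {σ : Type*} [Fintype σ] {p : MvPolynomial σ ℤ} (hp : NonnegPoly p)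
    {x : σ → HahnSeries ℚ ℂ} (hx : ∀ v, HahnPos (x v)) :
    HahnPos (p.eval₂ (Int.castRingHom _) x) ∧
      ((p.eval₂ (Int.castRingHom _) x).order : ℝ) = tropEval p fun v => ((x v).order : ℝ) := by
  have hterm : ∀ m ∈ p.support,
      HahnPos (((p.coeff m : ℤ) : HahnSeries ℚ ℂ) * ∏ v, x v ^ m v) ∧
      (((((p.coeff m : ℤ) : HahnSeries ℚ ℂ) * ∏ v, x v ^ m v).order : ℚ) : ℝ) =
        ∑ v, (m v : ℝ) * ((x v).order : ℝ) := by
    intro m hm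
    obtain ⟨h1, h2⟩ := intCast (lt_of_le_of_ne (hp.2 m) (MvPolynomial.mem_support_iff.1 hm).symm)
    obtain ⟨h3, h4⟩ := prod Finset.univ fun v _ => (hx v).pow (m v)
    refine ⟨h1.mul h3, ?_⟩
    rw [h1.order_mul h3, h2, h4, zero_add, Rat.cast_sum]
    refine Finset.sum_congr rfl fun v _ => ?_
    rw [HahnSeries.order_pow, nsmul_eq_mul, Rat.cast_mul, Rat.cast_natCast]
  have heq : p.eval₂ (Int.castRingHom _) x =
      ∑ m ∈ p.support, ((p.coeff m : ℤ) : HahnSeries ℚ ℂ) * ∏ v, x v ^ m v :=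
    MvPolynomial.eval₂_eq' _ _ _
  obtain ⟨h1, h2, m, hm, h3⟩ :=
    sum (MvPolynomial.support_nonempty.2 hp.1) fun m hm => (hterm m hm).1
  rw [← heq] at h1 h2 h3
  refine ⟨h1, le_antisymm ?_ ?_⟩
  · obtain ⟨m', hm', h'⟩ := exists_tropEval_eq hp.1 fun v => ((x v).order : ℝ)
    rw [h', ← (hterm m' hm').2]
    exact_mod_cast h2 m' hm'
  · rw [h3, (hterm m hm).2]
    exact tropEval_le _ hm

end HahnPos

/-! ### The image of the tropical parametrization is positive -/

theorem plucker_map {R S : Type*} [CommRing R] [CommRing S] {k n : ℕ} (φ : R →+* S)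
    (A : Matrix (Fin k) (Fin n) R) (J : KSubset k n) :
    plucker (A.map φ) J = φ (plucker A J) := by
  rw [plucker, plucker, RingHom.map_det]
  rfl

theorem single_mem_puiseux (q : ℚ) : HahnSeries.single q (1 : ℂ) ∈ puiseux := by
  refine ⟨q.den, q.den_pos, fun q' hq' => ⟨q.num, ?_⟩⟩
  rw [HahnSeries.eq_of_mem_support_single hq', mul_comm]
  exact Rat.mul_den_eq_num q

theorem tropParam_mem_tropPosGr {k n : ℕ} (hk : 2 ≤ k) (hkn : k < n)
    (y : Fin (k - 1) → Fin (n - k) → ℝ) : tropParam y ∈ tropPosGr k n := by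
  -- the closure in the definition of `tropPosGr` reduces the claim to rational parameters
  have hdense : DenseRange fun (q : Fin (k - 1) → Fin (n - k) → ℚ) i s => ((q i s : ℚ) : ℝ) :=
    DenseRange.piMap fun _ => DenseRange.piMap fun _ => Rat.denseRange_cast
  refine hdense.induction_on (p := fun y => tropParam y ∈ tropPosGr k n) y
    (isClosed_closure.preimage (continuous_tropParam hk hkn)) fun q => subset_closure ?_
  let x : Fin (k - 1) × Fin (n - k) → puiseux := fun v => ⟨_, single_mem_puiseux (q v.1 v.2)⟩
  have hmap : ∀ J : KSubset k n,
      ((plucker ((paramMatrix k n).map (MvPolynomial.eval₂Hom (Int.castRingHom _) x)) J : puiseux) :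
        HahnSeries ℚ ℂ) =
      (plucker (paramMatrix k n) J).eval₂ (Int.castRingHom _)
        fun v => (x v : HahnSeries ℚ ℂ) := by
    intro J
    rw [plucker_map]
    refine (MvPolynomial.eval₂_comp_left puiseux.subtype (Int.castRingHom _) x _).trans ?_
    congr 1
  have hx : ∀ v, HahnPos (x v) := fun v => by
    rw [HahnPos, HahnSeries.leadingCoeff_of_single]
    simp
  refine ⟨(paramMatrix k n).map (MvPolynomial.eval₂Hom (Int.castRingHom _) x), fun J => ?_,
    fun J => ?_⟩
  · change HahnPos _
    rw [hmap]
    exact (HahnPos.eval₂ (nonnegPoly_plucker hk hkn J) hx).1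
  · rw [hmap, (HahnPos.eval₂ (nonnegPoly_plucker hk hkn J) hx).2, tropParam]
    congr 1
    funext v
    exact congrArg _ (HahnSeries.order_single one_ne_zero).symm

/-! ### Factorization of totally positive matrices -/

theorem colMinor_twoSeq_self {R : Type*} [CommRing R] {l : ℕ} {V : ℕ → ℕ → R}
    (hV : ∀ r ≤ l, ∀ c < l, V r c = if r = c then 1 else 0) (c : ℕ) :
    colMinor l V (fun s => twoSeq l c s) = V l c := by
  rw [colMinor, Matrix.det_of_isUpperTriangular, Fin.prod_univ_castSucc]
  · rw [Finset.prod_eq_one, one_mul]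
    · simp [twoSeq]
    · intro s _
      have h1 : (s : ℕ) < l := s.2
      simp only [Matrix.of_apply, Fin.val_castSucc, twoSeq, if_pos h1]
      rw [hV _ h1.le _ h1, if_pos rfl]
  · intro r s hrs
    have h1 : (s : ℕ) < r := hrs
    have h2 : (s : ℕ) < l := by omega
    simp only [Matrix.of_apply, twoSeq, if_pos h2]
    rw [hV _ (by omega) _ h2, if_neg (by omega)]

theorem web_congr {R : Type*} [CommRing R] {x x' : ℕ → ℕ → R} {m : ℕ} (l : ℕ)
    (h : ∀ i < l, ∀ t < m, x i t = x' i t) (r : ℕ) {c : ℕ} (hc : c ≤ l + m) :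
    web x l r c = web x' l r c := by
  induction l generalizing c with
  | zero => rfl
  | succ l ih =>
    rw [web, web]
    congr 3
    refine Finset.sum_congr rfl fun c' hc' => ?_
    rw [Finset.mem_Ico] at hc'
    rw [h l (by omega) _ (by omega), ih (fun i hi => h i (by omega)) (by omega)]

/-- A matrix of the shape of a web matrix is a web matrix with positive parameters, if its minors
in the columns `0, …, i - 1, a, a + 1, …` are positive. Here positivity is any multiplicative
condition on nonzero elements. -/
theorem exists_web_eq {K : Type*} [Field K] {P : K → Prop} (h0 : ¬ P 0) (h1 : P 1)
    (hmul : ∀ a b, P a → P b → P (a * b)) (hinv : ∀ a, P a → P a⁻¹) (l N : ℕ) {V : ℕ → ℕ → K}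
    (hV : ∀ r ≤ l, ∀ c ≤ l, V r c = if r = c then 1 else 0)
    (hbot : ∀ c, l ≤ c → c < N → V l c = 1)
    (hP : ∀ i a, i ≤ l → i ≤ a → a + (l - i) < N → P (colMinor l V fun s => twoSeq i a s)) :
    ∃ x : ℕ → ℕ → K, (∀ i t, P (x i t)) ∧ ∀ r ≤ l, ∀ c < N, V r c = web x l r c := by
  classical
  induction l generalizing N V with
  | zero =>
    refine ⟨fun _ _ => 1, fun _ _ => h1, fun r hr c hc => ?_⟩
    obtain rfl : r = 0 := by omega
    exact hbot c (Nat.zero_le c) hc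
  | succ l ih =>
    have hseq : ∀ i a, i ≤ l → i ≤ a → a + (l + 1 - i) < N →
        ∀ s : Fin (l + 2), twoSeq i a s < N := by
      intro i a hi hia hN s
      have := s.2
      unfold twoSeq
      split_ifs <;> omega
    -- the minor in the columns `0, …, l - 1, c, c + 1` is a difference of two entries
    have hξ : ∀ c, l + 1 ≤ c → c + 1 < N → P (V l c - V l (c + 1)) := by
      intro c hc hcN
      have h2 := hP l c (by omega) (by omega) (by omega)
      rw [colMinor_succ (N := N) (ξ := fun _ => 1)
        (V' := fun r c => if c ≤ l then (if r = c then 1 else 0) else V r c - V r (c + 1))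
        (fun r hr c hc => hV r hr c (by omega)) (fun r _ c hc => if_pos hc) hbot
        (fun r _ c hc _ => by rw [if_neg (by omega), one_mul]) (twoSeq_strictMono (by omega) _)
        (hseq l c le_rfl (by omega) (by omega)), piFinset_stepRange_twoSeq, Finset.sum_singleton,
        colMinor_twoSeq_self fun r _ c hc => if_pos hc.le, if_neg (by omega)] at h2
      simpa using h2
    obtain ⟨ξ, hξP, hξeq⟩ : ∃ ξ : ℕ → K, (∀ c, P (ξ c)) ∧
        ∀ c, l + 1 ≤ c → c + 1 < N → ξ c = V l c - V l (c + 1) := by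
      refine ⟨fun c => if l + 1 ≤ c ∧ c + 1 < N then V l c - V l (c + 1) else 1, fun c => ?_,
        fun c hc hcN => if_pos ⟨hc, hcN⟩⟩
      dsimp only
      split_ifs with h
      · exact hξ c h.1 h.2
      · exact h1
    have hne : ∀ a, P a → a ≠ 0 := fun a ha h => h0 (h ▸ ha)
    -- the first columns, and the differences of later ones, are those of a smaller matrix
    let V' : ℕ → ℕ → K := fun r c =>
      if c ≤ l then (if r = c then 1 else 0) else (V r c - V r (c + 1)) / ξ c
    have hV' : ∀ r ≤ l, ∀ c ≤ l, V' r c = if r = c then 1 else 0 := fun r _ c hc => if_pos hc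
    have hdiff : ∀ r ≤ l, ∀ c, l + 1 ≤ c → c + 1 < N → V r c - V r (c + 1) = ξ c * V' r c := by
      intro r _ c hc _
      simp only [V']
      rw [if_neg (by omega), mul_div_cancel₀ _ (hne _ (hξP c))]
    obtain ⟨x, hx, hweb⟩ := ih (N - 1) (V := V') hV' (by
      intro c hc hcN
      rcases Nat.eq_or_lt_of_le hc with rfl | hc
      · rw [hV' _ le_rfl _ le_rfl, if_pos rfl]
      · simp only [V']
        rw [if_neg (by omega), ← hξeq c hc (by omega), div_self (hne _ (hξP c))]) (by
      intro i a hi hia hN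
      have h2 := hP i a (by omega) hia (by omega)
      rw [colMinor_succ (N := N) (fun r hr c hc => hV r hr c (by omega)) hV' hbot hdiff
        (twoSeq_strictMono hia _) (hseq i a hi hia (by omega)), piFinset_stepRange_twoSeq,
        Finset.sum_singleton] at h2
      have h3 : P (∏ s : Fin (l + 1), if twoSeq i a s ≤ l then 1 else ξ (twoSeq i a s)) := by
        refine Finset.prod_induction _ _ hmul h1 fun s _ => ?_
        split_ifs
        · exact h1
        · exact hξP _
      have h4 := hmul _ _ (hinv _ h3) h2
      rwa [inv_mul_cancel_left₀ (hne _ h3)] at h4)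
    refine ⟨fun i t => if i = l then ξ (t + (l + 1)) else x i t, fun i t => ?_, ?_⟩
    · dsimp only
      split_ifs
      · exact hξP _
      · exact hx i t
    · intro r hr c hc
      rcases Nat.eq_or_lt_of_le hr with rfl | hr
      · rcases Nat.lt_or_ge c (l + 1) with h | h
        · rw [hV _ le_rfl _ h.le, web_of_le _ _ le_rfl h.le]
        · rw [hbot c h hc, web_bottom _ _ h]
      · rcases Nat.lt_or_ge c (l + 1) with h | h
        · rw [hV _ hr.le _ h.le, web_of_le _ _ hr.le h.le]
        · induction c, h using Nat.le_induction with
          | base => rw [hV _ hr.le _ le_rfl, web_of_le _ _ hr.le le_rfl]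
          | succ c hlc ihc =>
            have h2 := web_sub (fun i t => if i = l then ξ (t + (l + 1)) else x i t) l
              (show r ≤ l by omega) hlc
            have h3 := hdiff r (by omega) c hlc hc
            rw [if_pos rfl, Nat.sub_add_cancel hlc, web_congr (x' := x) (m := c) l
              (fun i hi t _ => if_neg (by omega)) r (by omega), ← hweb r (by omega) c (by omega),
              ← ihc (by omega), ← h3] at h2
            exact (sub_right_injective h2).symm

/-! ### Positive Puiseux matrices are parametrized -/

/-- Rescaling the columns of a matrix changes the valuations of its minors by an element of the
lineality space. -/
theorem sum_elt_mem_lineality {k n : ℕ} (b : ℕ → ℝ) :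
    (fun J : KSubset k n => ∑ s, b (J.elt s)) ∈ lineality k n := by
  have : (fun J : KSubset k n => ∑ s, b (J.elt s)) = ∑ z : Fin n,
      b z • fun J : KSubset k n => if z ∈ J.1 then (1 : ℝ) else 0 := by
    funext J
    have h := Finset.map_orderEmbOfFin_univ J.1 J.2
    have h1 : ∑ s, b (J.elt s) = ∑ z ∈ J.1, b z := by
      conv_rhs => rw [← h, Finset.sum_map]
      rfl
    simp [h1, Finset.sum_apply, Finset.sum_ite_mem]
  rw [this]
  exact Submodule.sum_mem _ fun z _ => Submodule.smul_mem _ _ (Submodule.subset_span ⟨z, rfl⟩)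

/-- The minors of a matrix over a field, divided by its first one, are the minors of a matrix whose
first columns are those of the identity matrix. -/
theorem exists_reduced_matrix {K : Type*} [Field K] {l n : ℕ} (hn : l < n)
    (B : Matrix (Fin (l + 1)) (Fin n) K)
    (h : plucker B (twoIntervals (l + 1) n 0 0 ⟨le_rfl, by omega⟩) ≠ 0) :
    ∃ W : ℕ → ℕ → K, (∀ r ≤ l, ∀ c ≤ l, W r c = if r = c then 1 else 0) ∧
      ∀ J : KSubset (l + 1) n, plucker B J =
        plucker B (twoIntervals (l + 1) n 0 0 ⟨le_rfl, by omega⟩) *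
          colMinor l W fun s => (J.elt s : ℕ) := by
  set J₀ := twoIntervals (l + 1) n 0 0 ⟨le_rfl, by omega⟩ with hJ₀
  let G := B.submatrix id J₀.elt
  have hG : IsUnit G.det := isUnit_iff_ne_zero.2 h
  let W : ℕ → ℕ → K := fun r c => if h : r < l + 1 ∧ c < n then (G⁻¹ * B) ⟨r, h.1⟩ ⟨c, h.2⟩ else 0
  refine ⟨W, fun r hr c hc => ?_, fun J => ?_⟩
  · have h1 : G⁻¹ * G = 1 := Matrix.nonsing_inv_mul G hG
    have h2 := congrFun (congrFun h1 ⟨r, by omega⟩) ⟨c, by omega⟩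
    have h3 : J₀.elt ⟨c, by omega⟩ = ⟨c, by omega⟩ := Fin.ext (by
      rw [hJ₀, elt_twoIntervals]
      simp)
    rw [Matrix.one_apply] at h2
    simp only [W]
    rw [dif_pos ⟨by omega, by omega⟩, ← h3]
    refine Eq.trans h2 (if_congr ?_ rfl rfl)
    rw [Fin.ext_iff]
  · have h1 : (Matrix.of fun r s : Fin (l + 1) => W r (J.elt s)) = G⁻¹ * B.submatrix id J.elt := by
      ext r s
      simp only [Matrix.of_apply, W]
      rw [dif_pos ⟨r.2, (J.elt s).2⟩]
      rfl
    rw [colMinor, h1, Matrix.det_mul, Matrix.det_nonsing_inv, ← mul_assoc]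
    change _ = G.det * Ring.inverse G.det * _
    rw [Ring.mul_inverse_cancel _ hG, one_mul]
    rfl

theorem map_web {R S : Type*} [CommRing R] [CommRing S] (φ : R →+* S) (x : ℕ → ℕ → R)
    (l r c : ℕ) : φ (web x l r c) = web (fun i t => φ (x i t)) l r c := by
  induction l generalizing r c with
  | zero => exact map_one φ
  | succ l ih =>
    rw [web, web]
    split_ifs
    · exact map_one φ
    · exact map_zero φ
    · exact map_one φ
    · simp only [map_neg, map_sum, map_mul, ih]

theorem map_webMinor {R S : Type*} [CommRing R] [CommRing S] (φ : R →+* S) (x : ℕ → ℕ → R)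
    (l : ℕ) (f : Fin (l + 1) → ℕ) :
    φ (webMinor x l f) = webMinor (fun i t => φ (x i t)) l f := by
  rw [webMinor, webMinor, colMinor, colMinor, RingHom.map_det]
  congr 1
  ext r s
  exact map_web φ x l r (f s)

/-- The tropical Plücker vector of a positive matrix lies in the image of `ρ`. -/
theorem mkQ_mem_range_tropParam {k n : ℕ} (hk : 2 ≤ k) (hkn : k < n) {π : KSubset k n → ℝ}
    (A : Matrix (Fin k) (Fin n) puiseux) (hA : ∀ J, PuiseuxPos (plucker A J))
    (hπ : ∀ J, π J = (((plucker A J : puiseux) : HahnSeries ℚ ℂ).order : ℝ)) :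
    ∃ y, (lineality k n).mkQ π = (lineality k n).mkQ (tropParam y) := by
  obtain ⟨l, rfl⟩ := Nat.exists_eq_add_of_le' (show 1 ≤ k by omega)
  let B := A.map puiseux.subtype
  have hBA : ∀ J, plucker B J = plucker A J := fun J => plucker_map puiseux.subtype A J
  have hB : ∀ J, HahnPos (plucker B J) := fun J => by
    rw [hBA]
    exact hA J
  set J₀ := twoIntervals (l + 1) n 0 0 ⟨le_rfl, by omega⟩ with hJ₀
  obtain ⟨W, hW, hWB⟩ := exists_reduced_matrix (by omega) B (hB J₀).ne_zero
  change ∀ J : KSubset (l + 1) n, plucker B J =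
    plucker B J₀ * colMinor l W fun s => (J.elt s : ℕ) at hWB
  have hWpos : ∀ J : KSubset (l + 1) n, HahnPos (colMinor l W fun s => (J.elt s : ℕ)) := by
    intro J
    have h := (hB J₀).inv.mul (hB J)
    rwa [hWB J, inv_mul_cancel_left₀ (hB J₀).ne_zero] at h
  have hWbot : ∀ c, l ≤ c → c < n → HahnPos (W l c) := by
    intro c hc hcn
    have h := hWpos (twoIntervals (l + 1) n l c ⟨hc, by omega⟩)
    rwa [twoIntervals_elt_eq, colMinor_twoSeq_self fun r hr c hc => hW r hr c hc.le] at h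
  -- rescaling the columns turns the bottom row into ones
  obtain ⟨β, hβ, hβ1, hβW⟩ : ∃ β : ℕ → HahnSeries ℚ ℂ, (∀ c, HahnPos (β c)) ∧
      (∀ c ≤ l, β c = 1) ∧ ∀ c, l ≤ c → c < n → β c = W l c := by
    refine ⟨fun c => if l ≤ c ∧ c < n then W l c else 1, fun c => ?_, fun c hc => ?_,
      fun c hc hcn => if_pos ⟨hc, hcn⟩⟩
    · dsimp only
      split_ifs with h
      · exact hWbot c h.1 h.2
      · exact HahnPos.one
    · dsimp only
      split_ifs with h
      · rw [hW l le_rfl c hc, if_pos (by omega)]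
      · rfl
  let V : ℕ → ℕ → HahnSeries ℚ ℂ := fun r c => (β c)⁻¹ * W r c
  have hVW : ∀ f, colMinor l V f = (∏ s, (β (f s))⁻¹) * colMinor l W f := fun f =>
    Matrix.det_mul_row (fun s => (β (f s))⁻¹) (Matrix.of fun r s : Fin (l + 1) => W r (f s))
  have hβprod : ∀ f : Fin (l + 1) → ℕ, HahnPos (∏ s, (β (f s))⁻¹) := fun f =>
    (HahnPos.prod Finset.univ fun s _ => (hβ (f s)).inv).1
  obtain ⟨x, hx, hVx⟩ := exists_web_eq (P := HahnPos) (fun h => h.ne_zero rfl) HahnPos.one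
    (fun _ _ => HahnPos.mul) (fun _ => HahnPos.inv) l n (V := V)
    (fun r hr c hc => by
      simp only [V]
      rw [hβ1 c hc, inv_one, one_mul, hW r hr c hc])
    (fun c hc hcn => by
      simp only [V]
      rw [hβW c hc hcn, inv_mul_cancel₀ (hWbot c hc hcn).ne_zero])
    (fun i a hi hia hN => by
      rw [hVW]
      refine (hβprod _).mul ?_
      have h := hWpos (twoIntervals (l + 1) n i a ⟨hia, by omega⟩)
      rwa [twoIntervals_elt_eq] at h)
  let z : Fin (l + 1 - 1) × Fin (n - (l + 1)) → HahnSeries ℚ ℂ := fun v => x v.1 v.2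
  have hminor : ∀ J : KSubset (l + 1) n, plucker B J = plucker B J₀ * ((∏ s, β (J.elt s)) *
      (plucker (paramMatrix (l + 1) n) J).eval₂ (Int.castRingHom _) z) := by
    intro J
    have h1 : (plucker (paramMatrix (l + 1) n) J).eval₂ (Int.castRingHom _) z =
        colMinor l V fun s => (J.elt s : ℕ) := by
      rw [plucker_paramMatrix hk hkn]
      refine (map_webMinor (MvPolynomial.eval₂Hom (Int.castRingHom _) z) _ l _).trans ?_
      rw [webMinor, colMinor, colMinor]
      congr 1
      ext1 r s
      have hs := (J.elt s).2
      rw [Matrix.of_apply, Matrix.of_apply, hVx r (by omega) _ hs]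
      refine web_congr (m := n - (l + 1)) l (fun i hi t ht => ?_) _ (by omega)
      rw [MvPolynomial.coe_eval₂Hom, MvPolynomial.eval₂_X]
      change x (min i (l + 1 - 2)) (min t (n - (l + 1) - 1)) = x i t
      rw [min_eq_left (by omega), min_eq_left (by omega)]
    have h2 : (∏ s, β (J.elt s)) * ∏ s, (β (J.elt s))⁻¹ = 1 := by
      rw [← Finset.prod_mul_distrib]
      exact Finset.prod_eq_one fun s _ => mul_inv_cancel₀ (hβ _).ne_zero
    rw [h1, hVW, ← mul_assoc (∏ s, β (J.elt s)), h2, one_mul]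
    exact hWB J
  let y : Fin (l + 1 - 1) → Fin (n - (l + 1)) → ℝ := fun i t => ((x i t).order : ℝ)
  have hval : ∀ J : KSubset (l + 1) n, π J = ((plucker B J₀).order : ℝ) +
      (∑ s, ((β (J.elt s)).order : ℝ) + tropParam y J) := by
    intro J
    obtain ⟨h1, h2⟩ := HahnPos.prod Finset.univ fun s _ => hβ (J.elt s)
    obtain ⟨h3, h4⟩ := HahnPos.eval₂ (nonnegPoly_plucker hk hkn J) fun v => hx v.1 v.2
    rw [hπ, ← hBA, hminor, (hB J₀).order_mul (h1.mul h3), h1.order_mul h3, h2, Rat.cast_add,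
      Rat.cast_add, Rat.cast_sum, h4]
    rfl
  refine ⟨y, ?_⟩
  rw [← sub_eq_zero, ← map_sub]
  refine (Submodule.Quotient.mk_eq_zero _).2 ?_
  have h : π - tropParam y = (fun _ => ((plucker B J₀).order : ℝ)) +
      fun J : KSubset (l + 1) n => ∑ s, ((β (J.elt s)).order : ℝ) := by
    funext J
    rw [Pi.sub_apply, hval, Pi.add_apply]
    ring
  rw [h]
  exact Submodule.add_mem _ (const_mem_lineality (by omega) _)
    (sum_elt_mem_lineality fun c => ((β c).order : ℝ))

theorem psi_rho {k n : ℕ} (hk : 2 ≤ k) (hkn : k < n) (t : TropSpace k n) :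
    psi k n (rho t) = t := by
  obtain ⟨y, rfl⟩ := toTropSpace_surjective t
  rw [rho_toTropSpace hk hkn, psi_mkQ, psiRepr_tropParam hk hkn]

/-- The relation `ρ ∘ Ψ = id` holds on the tropicalizations of positive matrices, and it is a
closed condition. -/
theorem rho_psi_of_mem {k n : ℕ} (hk : 2 ≤ k) (hkn : k < n)
    {p : (KSubset k n → ℝ) ⧸ lineality k n} (hp : p ∈ tropPosX k n) : rho (psi k n p) = p := by
  obtain ⟨π, hπ, rfl⟩ := hp
  have hclosed : IsClosed {π | π - tropParam (psiRepr k n π) ∈ lineality k n} :=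
    (Submodule.closed_of_finiteDimensional (lineality k n)).preimage
      (continuous_id.sub ((continuous_tropParam hk hkn).comp
        (LinearMap.continuous_of_finiteDimensional (psiRepr k n))))
  have hmem := closure_minimal (t := {π | π - tropParam (psiRepr k n π) ∈ lineality k n}) ?_
    hclosed hπ
  · rw [psi_mkQ, rho_toTropSpace hk hkn, eq_comm, ← sub_eq_zero, ← map_sub]
    exact (Submodule.Quotient.mk_eq_zero (lineality k n)).2 hmem
  · rintro π ⟨A, hA, hπ⟩
    obtain ⟨y, hy⟩ := mkQ_mem_range_tropParam hk hkn A hA hπ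
    refine (Submodule.Quotient.mk_eq_zero (lineality k n)).1 ?_
    change (lineality k n).mkQ _ = 0
    rw [map_sub, sub_eq_zero, ← rho_toTropSpace hk hkn, ← psi_mkQ, hy, ← rho_toTropSpace hk hkn,
      psi_rho hk hkn]

theorem rho_mem_tropPosX {k n : ℕ} (hk : 2 ≤ k) (hkn : k < n) (t : TropSpace k n) :
    rho t ∈ tropPosX k n :=
  ⟨_, tropParam_mem_tropPosGr hk hkn _, rfl⟩

/-! ### Integral points -/

theorem exists_int_tropParam {k n : ℕ} (hk : 2 ≤ k) (hkn : k < n)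
    (y : Fin (k - 1) → Fin (n - k) → ℤ) (J : KSubset k n) :
    ∃ m : ℤ, tropParam (fun i s => (y i s : ℝ)) J = m := by
  obtain ⟨m, -, h⟩ := exists_tropEval_eq (nonnegPoly_plucker hk hkn J).1 fun v => (y v.1 v.2 : ℝ)
  refine ⟨∑ v, m v * y v.1 v.2, ?_⟩
  rw [tropParam, h]
  push_cast
  rfl

theorem exists_int_psi {k n : ℕ} {p : (KSubset k n → ℝ) ⧸ lineality k n}
    (hp : p ∈ tropPosXInt k n) : ∃ y : Fin (k - 1) → Fin (n - k) → ℤ,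
      psi k n p = toTropSpace fun i s => (y i s : ℝ) := by
  obtain ⟨π, ⟨-, hπ⟩, rfl⟩ := hp
  choose m hm using hπ
  have h : ∀ i s, ∃ y : ℤ, psiRepr k n π i s = y := by
    intro i s
    rw [psiRepr_apply, hm, hm, hm, hm]
    exact ⟨_ + _ - _ - _, by push_cast; rfl⟩
  choose y hy using h
  exact ⟨y, by rw [psi_mkQ]; exact congrArg _ (funext fun i => funext fun s => hy i s)⟩

theorem exists_point_eq_psi {k n : ℕ} (hk : 0 < k) {p : (KSubset k n → ℝ) ⧸ lineality k n}
    (hp : p ∈ tropPosXInt k n) : ∃ 𝒥 : NoncrossingTableau k n, psi k n p = 𝒥.point := by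
  obtain ⟨y, hy⟩ := exists_int_psi hp
  obtain ⟨𝒥, h⟩ := NoncrossingTableau.exists_point_eq hk y
  exact ⟨𝒥, hy.trans h.symm⟩

theorem exists_int_point {k n : ℕ} (𝒥 : NoncrossingTableau k n) :
    ∃ y : Fin (k - 1) → Fin (n - k) → ℤ, 𝒥.point = toTropSpace fun i s => (y i s : ℝ) := by
  rw [NoncrossingTableau.point, sum_tVec]
  exact ⟨fun i s => (levelCount ⟨i, by omega⟩ s 𝒥.1 : ℤ) - levelCount ⟨i + 1, by omega⟩ s 𝒥.1,
    congrArg _ (funext fun i => funext fun s => by push_cast; rfl)⟩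

theorem tropPosXInt_subset {k n : ℕ} : tropPosXInt k n ⊆ tropPosX k n :=
  Set.image_mono fun _ h => h.1

theorem theorem2p5 (k n : ℕ) (hk : 2 ≤ k) (hkn : k < n) :
    -- the planar basis elements form a basis, which defines `Ψ`
    ∃ b : Module.Basis (KSubset k n) ℝ (KSubset k n → ℝ), (∀ J, b J = planarBasis J) ∧
      -- `Ψ` descends modulo the lineality space
      ∃ Ψ : ((KSubset k n → ℝ) ⧸ lineality k n) →ₗ[ℝ] TropSpace k n,
        Ψ ∘ₗ (lineality k n).mkQ = b.constr ℝ (tVec (k := k) (n := n)) ∧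
        -- `ρ` does not depend on the representatives used to compute it
        (∀ y : Fin (k - 1) → Fin (n - k) → ℝ,
          rho (toTropSpace y) = (lineality k n).mkQ (tropParam y)) ∧
        -- `Ψ` restricts to a bijection with inverse `ρ`
        Set.BijOn Ψ (tropPosX k n) Set.univ ∧
        Set.MapsTo rho Set.univ (tropPosX k n) ∧
        Set.InvOn rho Ψ (tropPosX k n) Set.univ ∧
        -- the induced bijection between integral points and noncrossing tableaux
        ∃ e : tropPosXInt k n ≃ NoncrossingTableau k n,
          ∀ (p : tropPosXInt k n) (𝒥 : NoncrossingTableau k n), e p = 𝒥 ↔ Ψ p = 𝒥.point := by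
  obtain ⟨b, hb, hΨ⟩ := exists_planarBasis_basis (show 0 < k by omega) hkn
  have hinv : Set.InvOn rho (psi k n) (tropPosX k n) Set.univ :=
    ⟨fun p hp => rho_psi_of_mem hk hkn hp, fun t _ => psi_rho hk hkn t⟩
  have hmaps : Set.MapsTo rho Set.univ (tropPosX k n) := fun t _ => rho_mem_tropPosX hk hkn t
  refine ⟨b, hb, psi k n, hΨ, rho_toTropSpace hk hkn, hinv.bijOn (Set.mapsTo_univ _ _) hmaps, hmaps,
    hinv, ?_⟩
  choose F hF using fun p : tropPosXInt k n => exists_point_eq_psi (show 0 < k by omega) p.2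
  have hinj := NoncrossingTableau.point_injective (show 0 < k by omega) hkn
  have hFbij : Function.Bijective F := by
    constructor
    · intro p q hpq
      have h : psi k n p = psi k n q := by rw [hF, hF, hpq]
      exact Subtype.ext (hinv.1.injOn (tropPosXInt_subset p.2) (tropPosXInt_subset q.2) h)
    · intro 𝒥
      obtain ⟨y, hy⟩ := exists_int_point 𝒥
      refine ⟨⟨rho 𝒥.point, tropParam fun i s => (y i s : ℝ), ⟨tropParam_mem_tropPosGr hk hkn _,
        exists_int_tropParam hk hkn y⟩, ?_⟩, hinj ?_⟩
      · rw [hy, rho_toTropSpace hk hkn]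
      · rw [← hF, psi_rho hk hkn]
  refine ⟨Equiv.ofBijective F hFbij, fun p 𝒥 => ?_⟩
  rw [Equiv.ofBijective_apply, hF]
  exact hinj.eq_iff.symm
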